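/- **Setting.** Let $d\ge 1$, $|n|=\max_i|n_i|$ and $\langle n\rangle=\max\{1,|n|\}$ for $n\in\mathbb Z^d$. For $r>d$ let $\mathcal T$ be the bounded operator on $\ell^2(\mathbb Z^d)$ with kernel $\mathcal T(m,n)=|m-n|^{-r}$ for $m\ne n$ and $\mathcal T(m,m)=0$, and let $\|\mathcal T\|$ be its operator norm. Let $\{V_\omega(n)\}_{n\in\mathbb Z^d}$ be i.i.d. real random variables on a probability space $(\Omega,\mathcal F,\mathbb P)$ with common law $\mu$, where $\mathrm{supp}(\mu)$ has at least two points and $\mathrm{supp}(\mu)\subset[-M,M]$, $M>0$. For $\lambda\ge1$ put $H_\omega=\lambda^{-1}\mathcal T+V_\omega(n)\delta_{nn'}$. For $L\in\mathbb N$ let $\Lambda_L(n)=\{k\in\mathbb Z^d:|k-n|\le L\}$, and let $H_{\Lambda}$ be the restriction of $H_\omega$ to a finite set $\Lambda\subset\mathbb Z^d$. Fix $s_0>d/2$ and a normalisation constant $C_0>0$. For a matrix $A=(A(k_1,k_2))_{k_1\in X_1,k_2\in X_2}$ with finite $X_1,X_2\subset\mathbb Z^d$ let $$\|A\|_s^2=C_0\sum_{k\in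 X_1-X_2}\Bigl(\sup_{k_1-k_2=k}|A(k_1,k_2)|\Bigr)^2\langle k\rangle^{2s}.$$ Let $s_0\le r_1<r-d/2$, $\tau'>0$, $\delta\in(0,1)$. The cube $\Lambda_L(n)$ is *$(E,\delta)$-good* if $G=(H_{\Lambda_L(n)}-E)^{-1}$ exists and $\|G\|_s\le L^{\tau'+\delta s}$ for all $s\in[s_0,r_1]$; otherwise it is *$(E,\delta)$-bad*. The measure $\mu$ is *Hölder continuous of order $\rho>0$* if $$\frac1{\mathcal K_\rho(\mu)}:=\inf_{t>0}\ \sup_{0<|a-b|\le t}|a-b|^{-\rho}\mu([a,b])<\infty .$$ **Theorem.** Let $\mu$ be Hölder continuous of order $\rho>0$ and let $0<\kappa<\mathcal K_\rho(\mu)$. Let $\alpha,\tau,\tau',r_1>1$, $\xi>0$, $\delta\in(0,1)$, $p\in\mathbb R$ and let $J\ge 2$ be an even integer such that $$-(1-\delta)r_1+\tau'+2s_0<0,\qquad -\xi r_1+\tau'+\alpha\tau+(3+\delta+4\xi)s_0<0,$$ $$\alpha^{-1}\bigl(2\tau'+2\alpha\tau+(5+4\xi+2\delta)s_0\bigr)+s_0<\tau',$$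 $$\tau>\frac{2p+(2+\rho)d}{\rho},\qquad \frac{1+\xi}{\alpha}\le\delta,\qquad p>\alpha d+\frac{2\alpha p}{J}.$$ Then there is $\underline L_0>0$, depending only on $\kappa,\mu,\rho,r,M,J,\alpha,\tau,\xi,\tau',\delta,p,r_1,s_0,C_0,d$, such that for every integer $L_0\ge\underline L_0$ there are $\lambda_0=\lambda_0(L_0,\kappa,\rho,p,s_0,C_0,d)>0$ and $\eta=\eta(L_0,\kappa,\rho,p,d)>0$, depending only on the quantities listed, with the following property. Define $L_{k+1}=[L_k^\alpha]$ (integer part) for $k\ge0$. For all $E_0\in\mathbb R$ with $|E_0|\le2(\|\mathcal T\|+M)$, all $\lambda\ge\max\{1,\lambda_0\}$, all $k\ge0$ and all $m,n\in\mathbb Z^d$ with $|m-n|>2L_k$, $$\mathbb P\bigl(\exists\,E\in[E_0-\eta,E_0+\eta]:\ \Lambda_{L_k}(m)\text{ and }\Lambda_{L_k}(n)\text{ are both }(E,\delta)\text{-bad}\bigr)\le L_k^{-2p}.$$ -/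

import Mathlib

open MeasureTheory ProbabilityTheory

namespace LongRangeMSA

/-! Points of `ℤ^d` are functions `Fin d → ℤ`; Mathlib's norm on this type is the sup norm
`‖n‖ = max_i |n i|`. -/

/-- The polynomial long-range hopping kernel: `|m - n|^{-r}` off the diagonal, `0` on it. -/
noncomputable def hop {d : ℕ} (r : ℝ) (m n : Fin d → ℤ) : ℝ :=
  if m = n then 0 else ‖m - n‖ ^ (-r)

/-- The Hilbert space `ℓ²(ℤ^d)`. -/
abbrev EllTwo (d : ℕ) : Type := lp (fun _ : Fin d → ℤ => ℂ) 2

theorem memℓp_translate {d : ℕ} (k : Fin d → ℤ) (u : EllTwo d) :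
    Memℓp (fun m : Fin d → ℤ => (u (m - k) : ℂ)) 2 := by
  have hp : 0 < (2 : ENNReal).toReal := by norm_num
  have h := (memℓp_gen_iff hp).1 (lp.memℓp u)
  exact (memℓp_gen_iff hp).2 ((Equiv.subRight k).summable_iff.2 h)

/-- The translation `(S_k u)(m) = u(m - k)` on `ℓ²(ℤ^d)`. -/
noncomputable def translate {d : ℕ} (k : Fin d → ℤ) : EllTwo d →ₗᵢ[ℂ] EllTwo d where
  toFun u := ⟨fun m => u (m - k), memℓp_translate k u⟩
  map_add' u v := by ext m; rfl
  map_smul' c u := by ext m; rfl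
  norm_map' u := by
    have hp : 0 < (2 : ENNReal).toReal := by norm_num
    rw [lp.norm_eq_tsum_rpow hp, lp.norm_eq_tsum_rpow hp]
    congr 1
    exact (Equiv.subRight k).tsum_eq (fun m => ‖u m‖ ^ (2 : ENNReal).toReal)

/-- The hopping operator on `ℓ²(ℤ^d)`, as the operator-norm convergent series
`∑_k hop(k, 0) S_k`; `hoppingOp_apply` below identifies it with the operator with kernel `hop`. -/
noncomputable def hoppingOp (d : ℕ) (r : ℝ) : EllTwo d →L[ℂ] EllTwo d :=
  ∑' k : Fin d → ℤ, ((hop r k 0 : ℝ) : ℂ) • (translate k).toContinuousLinearMap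

theorem hop_zero_right {d : ℕ} (r : ℝ) (m n : Fin d → ℤ) : hop r (m - n) 0 = hop r m n := by
  simp [hop, sub_eq_zero]

theorem summable_hop {d : ℕ} {r : ℝ} (hr : (d : ℝ) < r) :
    Summable fun k : Fin d → ℤ => hop r k 0 := by
  let L : Submodule ℤ (Fin d → ℝ) :=
    Submodule.span ℤ (Set.range (Pi.basisFun ℝ (Fin d)))
  have hrank : Module.finrank ℤ L = d := by
    rw [ZLattice.rank ℝ L]; simp
  have hmem : ∀ k : Fin d → ℤ, (fun i => (k i : ℝ)) ∈ L := by
    intro k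
    have h : (fun i => (k i : ℝ)) = ∑ i, k i • Pi.basisFun ℝ (Fin d) i := by
      ext j
      simp [Pi.single_apply]
    rw [h]
    exact Submodule.sum_mem _ fun i _ =>
      Submodule.smul_mem _ _ (Submodule.subset_span ⟨i, rfl⟩)
  let f : (Fin d → ℤ) → L := fun k => ⟨fun i => (k i : ℝ), hmem k⟩
  have hf : Function.Injective f := by
    intro a b hab
    ext i
    have h := congrFun (congrArg Subtype.val hab) i
    exact Int.cast_injective (α := ℝ) h
  have hnorm : ∀ k, ‖f k‖ = ‖k‖ := by
    intro k
    change ‖(fun i => (k i : ℝ))‖ = ‖k‖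
    simp [Pi.norm_def, nnnorm]
    rfl
  have hs := (ZLattice.summable_norm_rpow L (-r) (by rw [hrank]; linarith)).comp_injective hf
  refine hs.of_nonneg_of_le (fun k => ?_) (fun k => ?_)
  · unfold hop; split_ifs <;> positivity
  · simp only [Function.comp, hnorm, hop, sub_zero]
    split_ifs
    · positivity
    · exact le_rfl

/-- For `r > d` the operator `hoppingOp d r` acts by the kernel `hop r`. -/
theorem hoppingOp_apply {d : ℕ} {r : ℝ} (hr : (d : ℝ) < r) (u : EllTwo d) (m : Fin d → ℤ) :
    HasSum (fun n => ((hop r m n : ℝ) : ℂ) * u n) (hoppingOp d r u m) := by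
  have hnn : ∀ k : Fin d → ℤ, 0 ≤ hop r k 0 := fun k => by
    unfold hop; split_ifs <;> positivity
  have hs : Summable fun k : Fin d → ℤ =>
      ((hop r k 0 : ℝ) : ℂ) • (translate k).toContinuousLinearMap := by
    refine Summable.of_norm_bounded (summable_hop hr) fun k => ?_
    rw [norm_smul, Complex.norm_real, Real.norm_of_nonneg (hnn k)]
    exact mul_le_of_le_one_right (hnn k) (LinearIsometry.norm_toContinuousLinearMap_le _)
  have h1 := (ContinuousLinearMap.apply ℂ (EllTwo d) u).hasSum hs.hasSum
  have h2 := (lp.evalCLM ℂ (fun _ : Fin d → ℤ => ℂ) 2 m).hasSum h1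
  have h3 := (Equiv.subLeft m).hasSum_iff.2 h2
  have h4 : ∀ n, ((hop r m n : ℝ) : ℂ) * u n =
      ((hop r (m - n) 0 : ℝ) : ℂ) * u (m - (m - n)) := fun n => by
    rw [hop_zero_right, sub_sub_cancel]
  simp only [h4]
  exact h3

/-- The operator norm `‖T‖` of the hopping operator on `ℓ²(ℤ^d)`. -/
noncomputable def hopNorm (d : ℕ) (r : ℝ) : ℝ := ‖hoppingOp d r‖

/-- The cube `Λ_L(n) = {k ∈ ℤ^d : |k - n| ≤ L}`. -/
noncomputable def cube {d : ℕ} (L : ℕ) (n : Fin d → ℤ) : Finset (Fin d → ℤ) :=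
  Finset.Icc (fun i => n i - L) (fun i => n i + L)

theorem mem_cube {d : ℕ} (L : ℕ) (n k : Fin d → ℤ) : k ∈ cube L n ↔ ‖k - n‖ ≤ L := by
  rw [pi_norm_le_iff_of_nonneg (Nat.cast_nonneg L), cube, Finset.mem_Icc, Pi.le_def, Pi.le_def,
    ← forall_and]
  refine forall_congr' fun i => ?_
  have h : ‖(k - n) i‖ ≤ (L : ℝ) ↔ |k i - n i| ≤ (L : ℤ) := by
    rw [Pi.sub_apply, Int.norm_eq_abs]
    exact_mod_cast Iff.rfl
  rw [h, abs_le]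
  constructor <;> rintro ⟨h1, h2⟩ <;> constructor <;> linarith

/-- `⟨k⟩ = max {1, |k|}`. -/
noncomputable def japanese {d : ℕ} (k : Fin d → ℤ) : ℝ := max 1 ‖k‖

open scoped Pointwise in
/-- The Sobolev norm of a matrix with rows in `X` and columns in `Y`, normalised by `C₀`:
`‖A‖_s² = C₀ ∑_{k ∈ X - Y} (sup_{k₁ - k₂ = k} |A(k₁, k₂)|)² ⟨k⟩^{2s}`. -/
noncomputable def sobolevNorm {d : ℕ} (C₀ s : ℝ) {X Y : Finset (Fin d → ℤ)}
    (A : Matrix X Y ℂ) : ℝ :=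
  Real.sqrt (C₀ * ∑ k ∈ X - Y,
    (⨆ q : {q : X × Y // (q.1 : Fin d → ℤ) - (q.2 : Fin d → ℤ) = k}, ‖A q.1.1 q.1.2‖) ^ 2
      * japanese k ^ (2 * s))

/-- The restriction `H_Λ` of `H = lam⁻¹ T + v(n) δ_{nn'}` to `Λ`, for a potential `v`. -/
noncomputable def hamiltonian {d : ℕ} (r lam : ℝ) (v : (Fin d → ℤ) → ℝ)
    (X : Finset (Fin d → ℤ)) : Matrix X X ℂ :=
  Matrix.of fun m n => ((lam⁻¹ * hop r (m : Fin d → ℤ) n + if m = n then v m else 0 : ℝ) : ℂ)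

/-- `H_Λ - E`. -/
noncomputable def shifted {d : ℕ} (r lam : ℝ) (v : (Fin d → ℤ) → ℝ)
    (X : Finset (Fin d → ℤ)) (E : ℝ) : Matrix X X ℂ :=
  hamiltonian r lam v X - (E : ℂ) • (1 : Matrix X X ℂ)

/-- The cube `Λ_L(n)` is `(E, δ)`-good: the Green's function `(H_{Λ_L(n)} - E)⁻¹` exists and its
Sobolev norm of order `s` is at most `L^{τ' + δ s}` for all `s ∈ [s₀, r₁]`. -/
def IsGood {d : ℕ} (C₀ s₀ r₁ τ' r lam : ℝ) (v : (Fin d → ℤ) → ℝ) (E δ : ℝ)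
    (L : ℕ) (n : Fin d → ℤ) : Prop :=
  IsUnit (shifted r lam v (cube L n) E) ∧
    ∀ s ∈ Set.Icc s₀ r₁,
      sobolevNorm C₀ s (shifted r lam v (cube L n) E)⁻¹ ≤ (L : ℝ) ^ (τ' + δ * s)

/-- `(E, δ)`-bad means not `(E, δ)`-good. -/
def IsBad {d : ℕ} (C₀ s₀ r₁ τ' r lam : ℝ) (v : (Fin d → ℤ) → ℝ) (E δ : ℝ)
    (L : ℕ) (n : Fin d → ℤ) : Prop :=
  ¬ IsGood C₀ s₀ r₁ τ' r lam v E δ L n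

/-- `1 / K_ρ(μ) = inf_{t > 0} sup_{0 < |a - b| ≤ t} |a - b|^{-ρ} μ([a, b])`, in `[0, ∞]`. -/
noncomputable def holderInv (ρ : ℝ) (μ : Measure ℝ) : ENNReal :=
  ⨅ (t : ℝ) (_ : 0 < t), ⨆ (a : ℝ) (b : ℝ) (_ : 0 < |a - b| ∧ |a - b| ≤ t),
    ENNReal.ofReal (|a - b| ^ (-ρ)) * μ (Set.Icc a b)

/-- `K_ρ(μ)`, in `[0, ∞]`. -/
noncomputable def holderOrder (ρ : ℝ) (μ : Measure ℝ) : ENNReal := (holderInv ρ μ)⁻¹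

/-- `μ` is Hölder continuous of order `ρ > 0`. -/
def IsHolder (ρ : ℝ) (μ : Measure ℝ) : Prop := 0 < ρ ∧ holderInv ρ μ < ⊤

/-- The three parameter inequalities of the multi-scale analysis. -/
def ParamIneq (α τ τ' ξ δ r₁ s₀ : ℝ) : Prop :=
  -(1 - δ) * r₁ + τ' + 2 * s₀ < 0 ∧
  -ξ * r₁ + τ' + α * τ + (3 + δ + 4 * ξ) * s₀ < 0 ∧
  α⁻¹ * (2 * τ' + 2 * α * τ + (5 + 4 * ξ + 2 * δ) * s₀) + s₀ < τ'

/-- The scales `L_{k+1} = [L_k^α]`. -/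
noncomputable def scale (α : ℝ) (L₀ : ℕ) : ℕ → ℕ
  | 0 => L₀
  | k + 1 => ⌊(scale α L₀ k : ℝ) ^ α⌋₊

end LongRangeMSA

namespace LongRangeMSA

/-! The proof is a multi-scale induction. Passing from scale l to L ~ l^α rests on a deterministic
criterion: a cube of radius L is good if the entries of its Green's function are at most L^τ and it
contains fewer than J separated bad cubes of radius l.

The criterion is `isGood_of_sparse`, through `abs_green_le_of_sparse`. A column G(·, y) is compared
with `decayWeight`, which decays like |x - y|^{-r₁} at scale lY, Y = l^ξ, and is larger by up to
Y^q, q = r₁ - s₀, near y and near the bad sites. At a good site the resolvent identity with the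
Green's function of a small good cube bounds G by a source term plus half the best constant. At a
bad site far from y, cut off to a ball whose boundary stays away from all bad sites. For each hop
across that boundary, either the endpoint at which G is evaluated lies near the boundary, where the
weight carries Y^{-q}, or the hop is long and itself yields Y^{-q}; this beats the a priori bound
times the volume of the ball. Near y the a priori bound suffices. Then
`le_two_mul_of_self_improving` closes the estimate at once, without iterating the expansion.

The probabilistic step is `localBound_step`. If two distant cubes are bad at one energy, then one of
them is crowded with bad small cubes or both are resonant. Resonance is controlled by
`measure_resonantSet_le`: condition on the potential in one cube, test the other at its finitely
many eigenvalues, and move a single potential value. Crowding is controlled by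
`localBound_crowdedSet`: J separated bad cubes form J/2 pairs in disjoint regions, so independence
gives l^{-pJ} against at most (2L+1)^{dJ} choices of centres. Independence needs events determined
by the potential in the cubes, so the induction carries `LocalBound` rather than a bare probability
bound.

At the initial scale η makes it unlikely that the potential on a cube meets [E₀ - 2η, E₀ + 2η];
otherwise, for λ ≥ L₀/η and L₀ large, the diagonal dominates and `isGood_of_potential_far` applies.
-/

/-! ### Polynomial weights and lattice sums. -/

theorem one_le_japanese {d : ℕ} (k : Fin d → ℤ) : 1 ≤ japanese k := le_max_left _ _

theorem japanese_pos {d : ℕ} (k : Fin d → ℤ) : 0 < japanese k :=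
  zero_lt_one.trans_le (one_le_japanese k)

theorem norm_le_japanese {d : ℕ} (k : Fin d → ℤ) : ‖k‖ ≤ japanese k := le_max_right _ _

theorem japanese_sub_comm {d : ℕ} (x y : Fin d → ℤ) : japanese (x - y) = japanese (y - x) := by
  rw [japanese, japanese, norm_sub_rev]

theorem one_le_norm_of_ne_zero {d : ℕ} {k : Fin d → ℤ} (hk : k ≠ 0) : 1 ≤ ‖k‖ := by
  obtain ⟨i, hi⟩ := Function.ne_iff.1 hk
  refine le_trans ?_ (norm_le_pi_norm k i)
  rw [Int.norm_eq_abs]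
  exact_mod_cast Int.one_le_abs hi

theorem japanese_eq_norm {d : ℕ} {k : Fin d → ℤ} (hk : k ≠ 0) : japanese k = ‖k‖ :=
  max_eq_right (one_le_norm_of_ne_zero hk)

theorem hop_nonneg {d : ℕ} (r : ℝ) (m n : Fin d → ℤ) : 0 ≤ hop r m n := by
  unfold hop; split_ifs <;> positivity

theorem hop_comm {d : ℕ} (r : ℝ) (m n : Fin d → ℤ) : hop r m n = hop r n m := by
  unfold hop; rw [norm_sub_rev]; simp only [eq_comm]

theorem hop_le_japanese {d : ℕ} (r : ℝ) (m n : Fin d → ℤ) :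
    hop r m n ≤ japanese (m - n) ^ (-r) := by
  unfold hop
  split_ifs with h
  · exact Real.rpow_nonneg (japanese_pos _).le _
  · rw [japanese_eq_norm (sub_ne_zero.2 h)]

theorem summable_japanese {d : ℕ} {b : ℝ} (hb : (d : ℝ) < b) :
    Summable fun k : Fin d → ℤ => japanese k ^ (-b) := by
  refine ((summable_hop hb).add (summable_of_ne_finset_zero (s := {0})
    (f := fun k : Fin d → ℤ => if k = 0 then (1 : ℝ) else 0) ?_)).congr ?_
  · intro k hk
    simp only [Finset.mem_singleton] at hk
    simp [hk]
  · intro k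
    by_cases hk : k = 0
    · simp [hk, hop, japanese]
    · simp [hk, hop, japanese_eq_norm hk]

/-- `∑_k ⟨k⟩^{-b}`. -/
noncomputable def japaneseSum (d : ℕ) (b : ℝ) : ℝ := ∑' k : Fin d → ℤ, japanese k ^ (-b)

theorem sum_japanese_le {d : ℕ} {b : ℝ} (hb : (d : ℝ) < b) (X : Finset (Fin d → ℤ))
    (x : Fin d → ℤ) : ∑ j ∈ X, japanese (x - j) ^ (-b) ≤ japaneseSum d b := by
  classical
  have h : ∑ j ∈ X, japanese (x - j) ^ (-b) =
      ∑ k ∈ X.image (fun j => x - j), japanese k ^ (-b) := by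
    rw [Finset.sum_image]
    intro a _ c _ hac
    exact sub_right_injective hac
  rw [h]
  exact (summable_japanese hb).sum_le_tsum _
    (fun k _ => Real.rpow_nonneg (japanese_pos k).le _)

theorem japaneseSum_pos {d : ℕ} {b : ℝ} (hb : (d : ℝ) < b) : 0 < japaneseSum d b := by
  have h := sum_japanese_le hb {(0 : Fin d → ℤ)} 0
  rw [Finset.sum_singleton] at h
  exact lt_of_lt_of_le (Real.rpow_pos_of_pos (japanese_pos _) _) h

/-- `max {1, |x - y| / D}`. -/
noncomputable def dilated {d : ℕ} (D : ℝ) (y x : Fin d → ℤ) : ℝ := max 1 (‖x - y‖ / D)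

theorem one_le_dilated {d : ℕ} (D : ℝ) (y x : Fin d → ℤ) : 1 ≤ dilated D y x := le_max_left _ _

theorem dilated_pos {d : ℕ} (D : ℝ) (y x : Fin d → ℤ) : 0 < dilated D y x :=
  zero_lt_one.trans_le (one_le_dilated D y x)

theorem dilated_le_add {d : ℕ} {D : ℝ} (hD : 0 < D) (y x j : Fin d → ℤ) :
    dilated D y x ≤ dilated D y j + ‖x - j‖ / D := by
  have h0 : 0 ≤ ‖x - j‖ / D := by positivity
  refine max_le (by linarith [one_le_dilated D y j]) ?_
  have h1 : ‖x - y‖ ≤ ‖j - y‖ + ‖x - j‖ := by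
    have := norm_add_le (j - y) (x - j)
    rwa [show j - y + (x - j) = x - y by abel] at this
  calc ‖x - y‖ / D ≤ (‖j - y‖ + ‖x - j‖) / D := by gcongr
    _ = ‖j - y‖ / D + ‖x - j‖ / D := add_div _ _ _
    _ ≤ _ := by gcongr; exact le_max_right _ _

theorem japanese_le_dilated {d : ℕ} {D : ℝ} (hD : 1 ≤ D) (y x : Fin d → ℤ) :
    japanese (x - y) ≤ D * dilated D y x := by
  have hD0 : 0 < D := by linarith
  refine max_le (by nlinarith [one_le_dilated D y x]) ?_
  calc ‖x - y‖ = D * (‖x - y‖ / D) := by field_simp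
    _ ≤ _ := by gcongr; exact le_max_right _ _

/-- From `a ≤ 2 c` with positive bases, `c^{-t} ≤ 2^t a^{-t}`. -/
theorem rpow_neg_le_of_le_two_mul {a c t : ℝ} (ha : 0 < a) (hac : a ≤ 2 * c) (ht : 0 ≤ t) :
    c ^ (-t) ≤ 2 ^ t * a ^ (-t) := by
  have h1 : a / 2 ≤ c := by linarith
  calc c ^ (-t) ≤ (a / 2) ^ (-t) :=
        Real.rpow_le_rpow_of_nonpos (by positivity) h1 (by linarith)
    _ = 2 ^ t * a ^ (-t) := by
        rw [Real.div_rpow ha.le (by norm_num), Real.rpow_neg (by norm_num : (0:ℝ) ≤ 2)]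
        field_simp

/-- Off-diagonal sums at distance at least `D` preserve polynomial decay at scale `D`. -/
theorem sum_far_le {d : ℕ} {b q r r₁ D : ℝ} (hb : (d : ℝ) < b) (hq : 0 ≤ q) (hr : q + b ≤ r)
    (hr₁ : b ≤ r₁) (hrr : r₁ ≤ r) (hD : 1 ≤ D) (X : Finset (Fin d → ℤ)) (x y : Fin d → ℤ) :
    ∑ j ∈ X with D ≤ ‖x - j‖, japanese (x - j) ^ (-r) * dilated D y j ^ (-r₁) ≤
      2 ^ (r₁ + 1) * japaneseSum d b * D ^ (-q) * dilated D y x ^ (-r₁) := by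
  have hD0 : 0 < D := by linarith
  have hb0 : 0 ≤ b := (Nat.cast_nonneg d).trans hb.le
  have key : ∀ j ∈ X.filter (fun j => D ≤ ‖x - j‖),
      japanese (x - j) ^ (-r) * dilated D y j ^ (-r₁) ≤
        2 ^ r₁ * D ^ (-q) * dilated D y x ^ (-r₁) * japanese (x - j) ^ (-b) +
        2 ^ r₁ * D ^ (-q) * dilated D y x ^ (-r₁) * japanese (y - j) ^ (-b) := by
    intro j hj
    have hj' : D ≤ japanese (x - j) := (Finset.mem_filter.1 hj).2.trans (norm_le_japanese _)
    have hJ := japanese_pos (x - j)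
    have hR := dilated_pos D y j
    have hRx := dilated_pos D y x
    have hp : ∀ k : Fin d → ℤ, 0 ≤ 2 ^ r₁ * D ^ (-q) * dilated D y x ^ (-r₁) * japanese k ^ (-b) :=
      fun k => mul_nonneg (by positivity) (Real.rpow_nonneg (japanese_pos k).le _)
    -- Either the weight at `j` is already comparable with that at `x`, and the long hop gives
    -- D^{-q}; or the hop covers at least a fixed fraction of the distance to `y` and supplies the
    -- decay of order `r₁`. In the second case the sum converges through the weight at `j`, centred
    -- at `y`.
    rcases le_or_gt (dilated D y x) (2 * dilated D y j) with h | h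
    · refine le_trans ?_ (le_add_of_nonneg_right (hp _))
      have h1 : japanese (x - j) ^ (-r) ≤ D ^ (-q) * japanese (x - j) ^ (-b) := by
        calc japanese (x - j) ^ (-r) ≤ japanese (x - j) ^ (-q + -b) :=
              Real.rpow_le_rpow_of_exponent_le (one_le_japanese _) (by linarith)
          _ = japanese (x - j) ^ (-q) * japanese (x - j) ^ (-b) := Real.rpow_add hJ _ _
          _ ≤ _ := by
              gcongr ?_ * _
              exact Real.rpow_le_rpow_of_nonpos hD0 hj' (by linarith)
      have h2 := rpow_neg_le_of_le_two_mul hRx h (hb0.trans hr₁)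
      calc _ ≤ (D ^ (-q) * japanese (x - j) ^ (-b)) * (2 ^ r₁ * dilated D y x ^ (-r₁)) := by
            gcongr
        _ = _ := by ring
    · refine le_trans ?_ (le_add_of_nonneg_left (hp _))
      have h3 : dilated D y x ≤ 2 * (japanese (x - j) / D) := by
        have h4 := dilated_le_add hD0 y x j
        have h5 : ‖x - j‖ / D ≤ japanese (x - j) / D := by
          gcongr; exact norm_le_japanese _
        linarith
      have h1 : japanese (x - j) ^ (-r) ≤ 2 ^ r₁ * dilated D y x ^ (-r₁) * D ^ (-r) := by
        calc japanese (x - j) ^ (-r) = (japanese (x - j) / D) ^ (-r) * D ^ (-r) := by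
              rw [← Real.mul_rpow (by positivity) hD0.le, div_mul_cancel₀ _ hD0.ne']
          _ ≤ (japanese (x - j) / D) ^ (-r₁) * D ^ (-r) := by
              gcongr ?_ * _
              exact Real.rpow_le_rpow_of_exponent_le ((one_le_div hD0).2 hj') (by linarith)
          _ ≤ _ := by
              gcongr
              exact rpow_neg_le_of_le_two_mul hRx h3 (hb0.trans hr₁)
      have h2 : dilated D y j ^ (-r₁) ≤ D ^ b * japanese (y - j) ^ (-b) := by
        calc dilated D y j ^ (-r₁) ≤ dilated D y j ^ (-b) :=
              Real.rpow_le_rpow_of_exponent_le (one_le_dilated _ _ _) (by linarith)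
          _ ≤ (japanese (y - j) / D) ^ (-b) := by
              refine Real.rpow_le_rpow_of_nonpos (div_pos (japanese_pos _) hD0) ?_ (by linarith)
              rw [div_le_iff₀ hD0, japanese_sub_comm, mul_comm]
              exact japanese_le_dilated hD y j
          _ = _ := by
              rw [Real.div_rpow (japanese_pos _).le hD0.le, Real.rpow_neg hD0.le]
              field_simp
      have h4 : D ^ (-r) * D ^ b ≤ D ^ (-q) := by
        rw [← Real.rpow_add hD0]
        exact Real.rpow_le_rpow_of_exponent_le hD (by linarith)
      have hJy := Real.rpow_nonneg (japanese_pos (y - j)).le (-b)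
      calc _ ≤ (2 ^ r₁ * dilated D y x ^ (-r₁) * D ^ (-r)) * (D ^ b * japanese (y - j) ^ (-b)) := by
            gcongr
        _ = 2 ^ r₁ * dilated D y x ^ (-r₁) * (D ^ (-r) * D ^ b) * japanese (y - j) ^ (-b) := by ring
        _ ≤ 2 ^ r₁ * dilated D y x ^ (-r₁) * D ^ (-q) * japanese (y - j) ^ (-b) := by gcongr
        _ = _ := by ring
  refine (Finset.sum_le_sum key).trans ?_
  rw [Finset.sum_add_distrib, ← Finset.mul_sum, ← Finset.mul_sum]
  have hc : 0 ≤ 2 ^ r₁ * D ^ (-q) * dilated D y x ^ (-r₁) := by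
    have := dilated_pos D y x; positivity
  have h1 := mul_le_mul_of_nonneg_left
    (sum_japanese_le hb (X.filter fun j => D ≤ ‖x - j‖) x) hc
  have h2 := mul_le_mul_of_nonneg_left
    (sum_japanese_le hb (X.filter fun j => D ≤ ‖x - j‖) y) hc
  have h3 : (2 : ℝ) ^ (r₁ + 1) = 2 ^ r₁ * 2 := by
    rw [Real.rpow_add (by norm_num), Real.rpow_one]
  rw [h3]
  linarith

/-- A maximum principle for weighted sums. -/
theorem le_two_mul_of_self_improving {ι : Type*} {X : Finset ι} {u w : ι → ℝ} {S : ℝ}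
    (hu : ∀ x ∈ X, 0 ≤ u x) (hw : ∀ x ∈ X, 0 < w x)
    (h : ∀ Ψ : ℝ, 0 ≤ Ψ → (∀ x ∈ X, u x ≤ Ψ * w x) → ∀ x ∈ X, u x ≤ (S + Ψ / 2) * w x) :
    ∀ x ∈ X, u x ≤ 2 * S * w x := by
  intro x hx
  obtain ⟨z, hz, hmax⟩ := X.exists_max_image (fun x => u x / w x) ⟨x, hx⟩
  have hΨ : 0 ≤ u z / w z := div_nonneg (hu z hz) (hw z hz).le
  have h1 : ∀ x ∈ X, u x ≤ u z / w z * w x := fun x hx =>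
    (div_le_iff₀ (hw x hx)).1 (hmax x hx)
  -- At the maximiser the best constant Ψ satisfies Ψ ≤ S + Ψ/2. Finiteness of `X` makes Ψ finite,
  -- so it can be absorbed.
  have h2 := (div_le_iff₀ (hw z hz)).2 (h _ hΨ h1 z hz)
  have h3 : u z / w z ≤ 2 * S := by linarith
  exact (h1 x hx).trans (mul_le_mul_of_nonneg_right h3 (hw x hx).le)

/-! ### Green's functions of finite blocks. -/

/-- The finite block of an infinite matrix. -/
def block {ι : Type*} (K : ι → ι → ℝ) (X : Finset ι) : Matrix X X ℝ :=
  Matrix.of fun i j => K i j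

/-- The inverse of a finite block, extended by zero. -/
noncomputable def green {ι : Type*} [DecidableEq ι] (K : ι → ι → ℝ) (X : Finset ι) (i j : ι) : ℝ :=
  if h : i ∈ X ∧ j ∈ X then (block K X)⁻¹ ⟨i, h.1⟩ ⟨j, h.2⟩ else 0

section Green

variable {ι : Type*} [DecidableEq ι] {K : ι → ι → ℝ} {X F U : Finset ι}

theorem green_of_mem {x y : ι} (hx : x ∈ X) (hy : y ∈ X) :
    green K X x y = (block K X)⁻¹ ⟨x, hx⟩ ⟨y, hy⟩ := dif_pos ⟨hx, hy⟩

theorem green_eq_zero {x y : ι} (hy : y ∉ X) : green K X x y = 0 := dif_neg fun h => hy h.2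

theorem sum_green_mul (h : IsUnit (block K X)) {x j : ι} (hx : x ∈ X) (hj : j ∈ X) :
    ∑ i ∈ X, green K X x i * K i j = if x = j then 1 else 0 := by
  have h1 : (block K X)⁻¹ * block K X = 1 :=
    Matrix.nonsing_inv_mul _ ((Matrix.isUnit_iff_isUnit_det _).1 h)
  have h2 := congrFun (congrFun h1 ⟨x, hx⟩) ⟨j, hj⟩
  rw [Matrix.mul_apply, Matrix.one_apply] at h2
  simp only [Subtype.mk.injEq] at h2
  rw [← h2, ← Finset.sum_coe_sort X]
  refine Finset.sum_congr rfl fun i _ => ?_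
  rw [green_of_mem hx i.2]; rfl

theorem sum_mul_green (h : IsUnit (block K X)) {i y : ι} (hi : i ∈ X) (hy : y ∈ X) :
    ∑ j ∈ X, K i j * green K X j y = if i = y then 1 else 0 := by
  have h1 : block K X * (block K X)⁻¹ = 1 :=
    Matrix.mul_nonsing_inv _ ((Matrix.isUnit_iff_isUnit_det _).1 h)
  have h2 := congrFun (congrFun h1 ⟨i, hi⟩) ⟨y, hy⟩
  rw [Matrix.mul_apply, Matrix.one_apply] at h2
  simp only [Subtype.mk.injEq] at h2
  rw [← h2, ← Finset.sum_coe_sort X]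
  refine Finset.sum_congr rfl fun j _ => ?_
  rw [green_of_mem j.2 hy]; rfl

/-- The resolvent identity for a sub-block. -/
theorem green_eq_sub (hX : IsUnit (block K X)) (hF : IsUnit (block K F)) (hFX : F ⊆ X) {x y : ι}
    (hx : x ∈ F) (hy : y ∈ X) :
    green K X x y = green K F x y -
      ∑ j ∈ X \ F, (∑ i ∈ F, green K F x i * K i j) * green K X j y := by
  -- The triple product G_F K G_X is evaluated in both orders. Associating to the right gives G_F;
  -- to the left, the terms with j ∈ F give G_X and the rest is the coupling.
  have h1 : ∑ i ∈ F, green K F x i * ∑ j ∈ X, K i j * green K X j y = green K F x y := by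
    have : ∀ i ∈ F, green K F x i * ∑ j ∈ X, K i j * green K X j y =
        if i = y then green K F x i else 0 := by
      intro i hi
      rw [sum_mul_green hX (hFX hi) hy]; split_ifs <;> simp
    rw [Finset.sum_congr rfl this, Finset.sum_ite_eq']
    split_ifs with h
    · rfl
    · rw [green_eq_zero h]
  have h2 : ∑ i ∈ F, green K F x i * ∑ j ∈ X, K i j * green K X j y =
      ∑ j ∈ X, (∑ i ∈ F, green K F x i * K i j) * green K X j y := by
    simp_rw [Finset.mul_sum, Finset.sum_mul]
    rw [Finset.sum_comm]
    refine Finset.sum_congr rfl fun j _ => Finset.sum_congr rfl fun i _ => by ring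
  have h3 : ∑ j ∈ F, (∑ i ∈ F, green K F x i * K i j) * green K X j y = green K X x y := by
    have : ∀ j ∈ F, (∑ i ∈ F, green K F x i * K i j) * green K X j y =
        if x = j then green K X j y else 0 := by
      intro j hj
      rw [sum_green_mul hF hx hj]; split_ifs <;> simp
    rw [Finset.sum_congr rfl this, Finset.sum_ite_eq, if_pos hx]
  rw [← h1, h2, ← Finset.sum_sdiff hFX, h3]
  ring

/-- Localisation of a column of the inverse to `U`, at the cost of the hopping across `∂U`. -/
theorem abs_green_le_of_cutoff (hX : IsUnit (block K X)) {Q : ℝ}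
    (hQ : ∀ x ∈ X, ∀ y ∈ X, |green K X x y| ≤ Q) (hU : U ⊆ X) {x y : ι} (hx : x ∈ U)
    (hy : y ∈ X \ U) :
    |green K X x y| ≤ Q * ∑ i ∈ U, (∑ j ∈ X \ U, |K j i| * |green K X i y| +
      ∑ j ∈ X \ U, |K i j| * |green K X j y|) := by
  obtain ⟨hyX, hyU⟩ := Finset.mem_sdiff.1 hy
  have hQ0 : 0 ≤ Q := (abs_nonneg _).trans (hQ y hyX y hyX)
  have h1 : ∑ i ∈ X, green K X x i * ∑ j ∈ U, K i j * green K X j y = green K X x y := by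
    have h2 : ∑ i ∈ X, green K X x i * ∑ j ∈ U, K i j * green K X j y =
        ∑ j ∈ U, (∑ i ∈ X, green K X x i * K i j) * green K X j y := by
      simp_rw [Finset.mul_sum, Finset.sum_mul]
      rw [Finset.sum_comm]
      refine Finset.sum_congr rfl fun j _ => Finset.sum_congr rfl fun i _ => by ring
    have : ∀ j ∈ U, (∑ i ∈ X, green K X x i * K i j) * green K X j y =
        if x = j then green K X j y else 0 := by
      intro j hj
      rw [sum_green_mul hX (hU hx) (hU hj)]; split_ifs <;> simp
    rw [h2, Finset.sum_congr rfl this, Finset.sum_ite_eq, if_pos hx]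
  -- Since `y` lies outside `U`, row `i` of K G vanishes at `y`, so the hops inside `U` equal, up to
  -- sign, those leaving `U`. Only hops across the boundary remain.
  have h3 : ∀ i ∈ U, ∑ j ∈ U, K i j * green K X j y = -∑ j ∈ X \ U, K i j * green K X j y := by
    intro i hi
    have h4 := sum_mul_green hX (hU hi) hyX
    rw [if_neg (fun h : i = y => hyU (h ▸ hi)), ← Finset.sum_sdiff hU] at h4
    linarith
  have h5 : ∀ i ∈ U, |∑ j ∈ U, K i j * green K X j y| ≤
      ∑ j ∈ X \ U, |K i j| * |green K X j y| := by
    intro i hi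
    rw [h3 i hi, abs_neg]
    refine (Finset.abs_sum_le_sum_abs _ _).trans_eq (Finset.sum_congr rfl fun j _ => abs_mul _ _)
  have h6 : ∀ i ∈ X \ U, |∑ j ∈ U, K i j * green K X j y| ≤
      ∑ j ∈ U, |K i j| * |green K X j y| := by
    intro i _
    refine (Finset.abs_sum_le_sum_abs _ _).trans_eq (Finset.sum_congr rfl fun j _ => abs_mul _ _)
  have h7 : |green K X x y| ≤ Q * ∑ i ∈ X, |∑ j ∈ U, K i j * green K X j y| := by
    rw [← h1, Finset.mul_sum]
    refine (Finset.abs_sum_le_sum_abs _ _).trans (Finset.sum_le_sum fun i hi => ?_)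
    rw [abs_mul]
    exact mul_le_mul_of_nonneg_right (hQ x (hU hx) i hi) (abs_nonneg _)
  refine h7.trans (mul_le_mul_of_nonneg_left ?_ hQ0)
  rw [← Finset.sum_sdiff hU, Finset.sum_add_distrib]
  refine add_le_add ((Finset.sum_le_sum h6).trans_eq Finset.sum_comm) (Finset.sum_le_sum h5)

end Green

/-! ### Weights adapted to the bad sites. -/

/-- The distance to `A` in units of `l`, truncated to `[1, Y]`. -/
noncomputable def plateau {d : ℕ} (l Y : ℝ) (A : Set (Fin d → ℤ)) (x : Fin d → ℤ) : ℝ :=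
  min Y (max 1 (Metric.infDist x A / l))

section Plateau

variable {d : ℕ} {l Y : ℝ} {A : Set (Fin d → ℤ)}

theorem one_le_plateau (hY : 1 ≤ Y) (x : Fin d → ℤ) : 1 ≤ plateau l Y A x :=
  le_min hY (le_max_left _ _)

theorem plateau_le (x : Fin d → ℤ) : plateau l Y A x ≤ Y := min_le_left _ _

theorem plateau_le_of_mem (hl : 0 < l) {z : Fin d → ℤ} (hz : z ∈ A) (x : Fin d → ℤ) :
    plateau l Y A x ≤ max 1 (‖x - z‖ / l) := by
  refine (min_le_right _ _).trans (max_le_max le_rfl ?_)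
  rw [← dist_eq_norm]
  gcongr
  exact Metric.infDist_le_dist_of_mem hz

theorem plateau_eq (hl : 0 < l) (hA : A.Nonempty) {x : Fin d → ℤ}
    (h : ∀ z ∈ A, l * Y ≤ ‖x - z‖) : plateau l Y A x = Y := by
  refine min_eq_left (le_max_of_le_right ?_)
  rw [le_div_iff₀ hl, mul_comm]
  exact (Metric.le_infDist hA).2 fun z hz => by rw [dist_eq_norm]; exact h z hz

/-- The plateau grows by at most |x - j|/l, and being at least 1 it turns this additive bound into a
multiplicative one. -/
theorem plateau_le_mul (hl : 0 < l) (hY : 1 ≤ Y) (x j : Fin d → ℤ) :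
    plateau l Y A x ≤ plateau l Y A j * (1 + ‖x - j‖ / l) := by
  have h0 : 0 ≤ ‖x - j‖ / l := by positivity
  have h1 := one_le_plateau (l := l) (A := A) hY j
  have h2 : plateau l Y A x ≤ plateau l Y A j + ‖x - j‖ / l := by
    unfold plateau
    rw [← min_add_add_right]
    refine min_le_min (by linarith) ?_
    rw [← max_add_add_right]
    refine max_le_max (by linarith) ?_
    rw [← add_div]
    gcongr
    rw [← dist_eq_norm]
    exact Metric.infDist_le_infDist_add_dist
  nlinarith

end Plateau

/-- The weight for the decay of a column `y` of the Green's function around the bad sites. -/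
noncomputable def decayWeight {d : ℕ} (l Y q r₁ : ℝ) (B : Finset (Fin d → ℤ))
    (y x : Fin d → ℤ) : ℝ :=
  dilated (l * Y) y x ^ (-r₁) * plateau l Y (insert y (B : Set (Fin d → ℤ))) x ^ (-q)

section Weight

variable {d : ℕ} {l Y q r₁ : ℝ} {B : Finset (Fin d → ℤ)} {x y j : Fin d → ℤ}

theorem plateau_pos (hY : 1 ≤ Y) {A : Set (Fin d → ℤ)} : 0 < plateau l Y A x :=
  zero_lt_one.trans_le (one_le_plateau hY x)

theorem decayWeight_pos (hY : 1 ≤ Y) : 0 < decayWeight l Y q r₁ B y x :=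
  mul_pos (Real.rpow_pos_of_pos (dilated_pos _ _ _) _)
    (Real.rpow_pos_of_pos (plateau_pos hY) _)

theorem decayWeight_le (hY : 1 ≤ Y) (hq : 0 ≤ q) :
    decayWeight l Y q r₁ B y x ≤ dilated (l * Y) y x ^ (-r₁) :=
  mul_le_of_le_one_right (Real.rpow_nonneg (dilated_pos _ _ _).le _)
    (Real.rpow_le_one_of_one_le_of_nonpos (one_le_plateau hY x) (by linarith))

theorem le_decayWeight (hY : 1 ≤ Y) (hq : 0 ≤ q) :
    dilated (l * Y) y x ^ (-r₁) * Y ^ (-q) ≤ decayWeight l Y q r₁ B y x :=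
  mul_le_mul_of_nonneg_left
    (Real.rpow_le_rpow_of_nonpos (plateau_pos hY) (plateau_le x) (by linarith))
    (Real.rpow_nonneg (dilated_pos _ _ _).le _)

/-- The plateau is saturated here and equals 1 on bad sites (`decayWeight_of_mem`). The resulting
ratio Y^{-q} is what pays for the a priori bound at a bad site. -/
theorem decayWeight_eq (hl : 0 < l) (h : ∀ z ∈ B, l * Y ≤ ‖x - z‖) (hy : l * Y ≤ ‖x - y‖) :
    decayWeight l Y q r₁ B y x = dilated (l * Y) y x ^ (-r₁) * Y ^ (-q) := by
  rw [decayWeight, plateau_eq hl (Set.insert_nonempty _ _)]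
  rintro z (rfl | hz)
  · exact hy
  · exact h z hz

theorem decayWeight_of_mem (hl : 0 < l) (hY : 1 ≤ Y) (hx : x ∈ B) :
    decayWeight l Y q r₁ B y x = dilated (l * Y) y x ^ (-r₁) := by
  have h : plateau l Y (insert y (B : Set (Fin d → ℤ))) x = 1 := by
    refine le_antisymm ?_ (one_le_plateau hY x)
    have := plateau_le_of_mem (Y := Y) (A := insert y (B : Set (Fin d → ℤ))) hl
      (Set.mem_insert_of_mem _ (Finset.mem_coe.2 hx)) x
    simpa using this
  rw [decayWeight, h, Real.one_rpow, mul_one]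

/-- This is why `y` is inserted into the plateau's set: the source term of the resolvent identity,
supported near `y`, then costs only 2^q. -/
theorem decayWeight_near_source (hl : 0 < l) (hY : 2 ≤ Y) (hq : 0 ≤ q) (h : ‖x - y‖ ≤ 2 * l) :
    2 ^ (-q) ≤ decayWeight l Y q r₁ B y x := by
  have h1 : dilated (l * Y) y x = 1 := by
    refine max_eq_left ?_
    rw [div_le_one (by positivity)]
    nlinarith
  have h2 : plateau l Y (insert y (B : Set (Fin d → ℤ))) x ≤ 2 := by
    refine (plateau_le_of_mem hl (Set.mem_insert _ _) x).trans (max_le (by norm_num) ?_)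
    rwa [div_le_iff₀ hl]
  rw [decayWeight, h1, Real.one_rpow, one_mul]
  exact Real.rpow_le_rpow_of_nonpos (plateau_pos (by linarith)) h2 (by linarith)

/-- In a hop of length between l and lY, the dilated distance at `x` is at most twice that at `j`,
and the plateau at `x` at most 2|x - j|/l times that at `j`. The factor l^{-q} is the gain that
makes the resolvent expansion contract. -/
theorem decayWeight_near (hl : 0 < l) (hY : 1 ≤ Y) (hq : 0 ≤ q) (hr₁ : 0 ≤ r₁)
    (h1 : l ≤ ‖x - j‖) (h2 : ‖x - j‖ ≤ l * Y) :
    decayWeight l Y q r₁ B y j ≤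
      2 ^ (r₁ + q) * l ^ (-q) * ‖x - j‖ ^ q * decayWeight l Y q r₁ B y x := by
  have hlY : 0 < l * Y := by positivity
  have hn : 0 < ‖x - j‖ := hl.trans_le h1
  have h3 : dilated (l * Y) y x ≤ 2 * dilated (l * Y) y j := by
    have := dilated_le_add hlY y x j
    have h4 : ‖x - j‖ / (l * Y) ≤ 1 := (div_le_one hlY).2 h2
    linarith [one_le_dilated (l * Y) y j]
  have h5 := rpow_neg_le_of_le_two_mul (dilated_pos _ _ _) h3 hr₁
  set A : Set (Fin d → ℤ) := insert y (B : Set (Fin d → ℤ))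
  have hPx : 0 < plateau l Y A x := plateau_pos hY
  have hPj : 0 < plateau l Y A j := plateau_pos hY
  have h6 : plateau l Y A x / (‖x - j‖ / l) ≤ 2 * plateau l Y A j := by
    rw [div_le_iff₀ (by positivity)]
    have h7 := plateau_le_mul (A := A) hl hY x j
    have h8 : 1 ≤ ‖x - j‖ / l := (one_le_div hl).2 h1
    nlinarith
  have h7 := rpow_neg_le_of_le_two_mul (t := q) (by positivity) h6 hq
  have h8 : (plateau l Y A x / (‖x - j‖ / l)) ^ (-q) =
      plateau l Y A x ^ (-q) * (‖x - j‖ ^ q * l ^ (-q)) := by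
    rw [Real.div_rpow hPx.le (by positivity), Real.div_rpow hn.le hl.le,
      Real.rpow_neg hn.le, Real.rpow_neg hl.le]
    field_simp
  rw [h8] at h7
  have h9 : (2 : ℝ) ^ (r₁ + q) = 2 ^ r₁ * 2 ^ q := Real.rpow_add (by norm_num) _ _
  have hd := dilated_pos (l * Y) y x
  have hdj := dilated_pos (l * Y) y j
  calc decayWeight l Y q r₁ B y j ≤ (2 ^ r₁ * dilated (l * Y) y x ^ (-r₁)) *
        (2 ^ q * (plateau l Y A x ^ (-q) * (‖x - j‖ ^ q * l ^ (-q)))) :=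
        mul_le_mul h5 h7 (by positivity) (by positivity)
    _ = _ := by rw [h9, decayWeight]; ring

end Weight

/-! ### Decay of the Green's function by self-improvement. -/

/-- Off-diagonal decay of order `r`. -/
def HasDecay {d : ℕ} (r : ℝ) (K : (Fin d → ℤ) → (Fin d → ℤ) → ℝ) : Prop :=
  ∀ i j, i ≠ j → |K i j| ≤ japanese (i - j) ^ (-r)

section Coupling

variable {d : ℕ} {b q r r₁ l Y : ℝ} {K : (Fin d → ℤ) → (Fin d → ℤ) → ℝ}
  {X F B : Finset (Fin d → ℤ)}

/-- Hops beyond lY give (lY)^{-q} by `sum_far_le`, which is l^{-q} times the smallest plateau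
factor. For shorter ones |x - j|^q ≤ 2^q ⟨x - i⟩^q ⟨i - j⟩^q: the hopping absorbs ⟨i - j⟩^q because
q + b ≤ r, while ⟨x - i⟩^q is left for the row sums of the local Green's function, which goodness
controls at order q. -/
theorem sum_hopping_weight_le (hb : (d : ℝ) < b) (hq : 0 ≤ q) (hr : q + b ≤ r) (hr₁ : b ≤ r₁)
    (hrr : r₁ ≤ r) (hl : 1 ≤ l) (hY : 4 ≤ Y) {x i : Fin d → ℤ} (hi : ‖x - i‖ ≤ 2 * l)
    (hF : ∀ j ∈ X \ F, l ≤ ‖x - j‖) (y : Fin d → ℤ) :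
    ∑ j ∈ X \ F, japanese (i - j) ^ (-r) * decayWeight l Y q r₁ B y j ≤
      japanese (x - i) ^ q * ((2 ^ (r₁ + 2 * q) + 2 ^ (r + r₁ + 1)) * japaneseSum d b * l ^ (-q) *
        decayWeight l Y q r₁ B y x) := by
  have hl0 : 0 < l := by linarith
  have hY0 : 0 < Y := by linarith
  have hlY : 1 ≤ l * Y := by nlinarith
  have hr₁0 : 0 ≤ r₁ := (Nat.cast_nonneg d).trans (hb.le.trans hr₁)
  have hr0 : 0 ≤ r := hr₁0.trans hrr
  have hw := decayWeight_pos (l := l) (q := q) (r₁ := r₁) (B := B) (x := x) (y := y)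
    (by linarith : 1 ≤ Y)
  set w := decayWeight l Y q r₁ B y with hw_def
  have hJi := japanese_pos (x - i)
  have hS := japaneseSum_pos hb
  have hJq : 1 ≤ japanese (x - i) ^ q := Real.one_le_rpow (one_le_japanese _) hq
  rw [← Finset.sum_filter_add_sum_filter_not (X \ F) (fun j => l * Y ≤ ‖x - j‖)]
  have far : ∑ j ∈ X \ F with l * Y ≤ ‖x - j‖, japanese (i - j) ^ (-r) * w j ≤
      2 ^ (r + r₁ + 1) * japaneseSum d b * l ^ (-q) * w x := by
    have h1 : ∀ j ∈ (X \ F).filter (fun j => l * Y ≤ ‖x - j‖), japanese (i - j) ^ (-r) * w j ≤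
        2 ^ r * (japanese (x - j) ^ (-r) * dilated (l * Y) y j ^ (-r₁)) := by
      intro j hj
      have h2 := (Finset.mem_filter.1 hj).2
      -- Y ≥ 4 enters here: |x - i| ≤ 2l ≤ lY/2 ≤ |x - j|/2.
      have h3 : japanese (x - j) ≤ 2 * japanese (i - j) := by
        have h4 : ‖x - j‖ ≤ ‖x - i‖ + ‖i - j‖ := by
          have := norm_add_le (x - i) (i - j)
          rwa [sub_add_sub_cancel] at this
        have h5 := norm_le_japanese (i - j)
        refine max_le (by linarith [one_le_japanese (i - j)]) ?_
        nlinarith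
      have h6 := rpow_neg_le_of_le_two_mul (japanese_pos _) h3 hr0
      have h7 := decayWeight_le (l := l) (r₁ := r₁) (B := B) (y := y) (x := j)
        (by linarith : 1 ≤ Y) hq
      have h8 := Real.rpow_nonneg (japanese_pos (x - j)).le (-r)
      calc _ ≤ (2 ^ r * japanese (x - j) ^ (-r)) * dilated (l * Y) y j ^ (-r₁) :=
            mul_le_mul h6 h7 (decayWeight_pos (by linarith)).le (by positivity)
        _ = _ := by ring
    refine (Finset.sum_le_sum h1).trans ?_
    rw [← Finset.mul_sum]
    have h2 := sum_far_le hb hq hr hr₁ hrr hlY (X \ F) x y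
    have h3 := le_decayWeight (l := l) (r₁ := r₁) (B := B) (y := y) (x := x)
      (by linarith : 1 ≤ Y) hq
    have h4 : (2 : ℝ) ^ (r + r₁ + 1) = 2 ^ r * 2 ^ (r₁ + 1) := by
      rw [add_assoc, Real.rpow_add (by norm_num)]
    calc _ ≤ 2 ^ r * (2 ^ (r₁ + 1) * japaneseSum d b * (l * Y) ^ (-q) *
          dilated (l * Y) y x ^ (-r₁)) := by gcongr
      _ = 2 ^ r * (2 ^ (r₁ + 1)) * japaneseSum d b * l ^ (-q) *
          (dilated (l * Y) y x ^ (-r₁) * Y ^ (-q)) := by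
          rw [Real.mul_rpow hl0.le hY0.le]; ring
      _ ≤ _ := by rw [h4]; gcongr
  have near : ∑ j ∈ X \ F with ¬ l * Y ≤ ‖x - j‖, japanese (i - j) ^ (-r) * w j ≤
      japanese (x - i) ^ q * (2 ^ (r₁ + 2 * q) * japaneseSum d b * l ^ (-q) * w x) := by
    have h1 : ∀ j ∈ (X \ F).filter (fun j => ¬ l * Y ≤ ‖x - j‖), japanese (i - j) ^ (-r) * w j ≤
        japanese (x - i) ^ q * (2 ^ (r₁ + 2 * q) * l ^ (-q) * w x) *
          japanese (i - j) ^ (-b) := by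
      intro j hj
      obtain ⟨hj1, hj2⟩ := Finset.mem_filter.1 hj
      have h2 := decayWeight_near (B := B) (y := y) hl0 (by linarith : 1 ≤ Y) hq hr₁0
        (hF j hj1) (not_le.1 hj2).le
      have hJ := japanese_pos (i - j)
      have h3 : ‖x - j‖ ≤ 2 * japanese (x - i) * japanese (i - j) := by
        have h4 : ‖x - j‖ ≤ ‖x - i‖ + ‖i - j‖ := by
          have := norm_add_le (x - i) (i - j)
          rwa [sub_add_sub_cancel] at this
        nlinarith [norm_le_japanese (i - j), norm_le_japanese (x - i), one_le_japanese (i - j),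
          one_le_japanese (x - i)]
      have h4 : ‖x - j‖ ^ q ≤ 2 ^ q * japanese (x - i) ^ q * japanese (i - j) ^ q := by
        rw [← Real.mul_rpow (by norm_num) hJi.le, ← Real.mul_rpow (by positivity) hJ.le]
        exact Real.rpow_le_rpow (norm_nonneg _) h3 hq
      have h5 : japanese (i - j) ^ (-r) * japanese (i - j) ^ q ≤ japanese (i - j) ^ (-b) := by
        rw [← Real.rpow_add hJ]
        exact Real.rpow_le_rpow_of_exponent_le (one_le_japanese _) (by linarith)
      have h6 : (2 : ℝ) ^ (r₁ + 2 * q) = 2 ^ (r₁ + q) * 2 ^ q := by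
        rw [← Real.rpow_add (by norm_num)]; ring_nf
      calc _ ≤ japanese (i - j) ^ (-r) * (2 ^ (r₁ + q) * l ^ (-q) *
            (2 ^ q * japanese (x - i) ^ q * japanese (i - j) ^ q) * w x) := by
            refine mul_le_mul_of_nonneg_left (h2.trans ?_) (by positivity)
            gcongr
        _ = japanese (x - i) ^ q * (2 ^ (r₁ + q) * 2 ^ q * l ^ (-q) * w x) *
            (japanese (i - j) ^ (-r) * japanese (i - j) ^ q) := by ring
        _ ≤ _ := by rw [h6]; gcongr
    refine (Finset.sum_le_sum h1).trans ?_
    rw [← Finset.mul_sum]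
    have h2 := sum_japanese_le hb ((X \ F).filter fun j => ¬ l * Y ≤ ‖x - j‖) i
    calc _ ≤ japanese (x - i) ^ q * (2 ^ (r₁ + 2 * q) * l ^ (-q) * w x) * japaneseSum d b := by
          gcongr
      _ = _ := by ring
  have h9 : 0 ≤ 2 ^ (r + r₁ + 1) * japaneseSum d b * l ^ (-q) * w x := by positivity
  calc _ ≤ _ := add_le_add far near
    _ ≤ japanese (x - i) ^ q * (2 ^ (r + r₁ + 1) * japaneseSum d b * l ^ (-q) * w x) +
        japanese (x - i) ^ q * (2 ^ (r₁ + 2 * q) * japaneseSum d b * l ^ (-q) * w x) := by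
        exact add_le_add (le_mul_of_one_le_left h9 hJq) le_rfl
    _ = _ := by ring

/-- One step of the resolvent expansion at a good site. -/
theorem abs_green_le_of_good (hK : HasDecay r K) (hb : (d : ℝ) < b) (hq : 0 ≤ q)
    (hr : q + b ≤ r) (hr₁ : b ≤ r₁) (hrr : r₁ ≤ r) (hl : 1 ≤ l) (hY : 4 ≤ Y)
    (hX : IsUnit (block K X)) (hFu : IsUnit (block K F)) (hFX : F ⊆ X) {x y : Fin d → ℤ}
    (hx : x ∈ F) (hy : y ∈ X) (hnear : ∀ i ∈ F, ‖x - i‖ ≤ 2 * l)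
    (hF : ∀ j ∈ X \ F, l ≤ ‖x - j‖) {R R₀ : ℝ} (hR₀ : ∀ i ∈ F, |green K F x i| ≤ R₀)
    (hR : ∑ i ∈ F, |green K F x i| * japanese (x - i) ^ q ≤ R) {Ψ : ℝ}
    (hΨ0 : 0 ≤ Ψ) (hΨ : ∀ j ∈ X, |green K X j y| ≤ Ψ * decayWeight l Y q r₁ B y j) :
    |green K X x y| ≤ (2 ^ q * R₀ + Ψ * ((2 ^ (r₁ + 2 * q) + 2 ^ (r + r₁ + 1)) *
      japaneseSum d b * l ^ (-q) * R)) * decayWeight l Y q r₁ B y x := by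
  set w := decayWeight l Y q r₁ B y with hw_def
  have hl0 : 0 < l := by linarith
  have hw : 0 < w x := decayWeight_pos (by linarith : 1 ≤ Y)
  have hS := japaneseSum_pos hb
  have hterm : ∀ i ∈ F, 0 ≤ |green K F x i| * japanese (x - i) ^ q := fun i _ =>
    mul_nonneg (abs_nonneg _) (Real.rpow_nonneg (japanese_pos _).le _)
  have hR0 : 0 ≤ R := (Finset.sum_nonneg hterm).trans hR
  have hR₀0 : 0 ≤ R₀ := (abs_nonneg _).trans (hR₀ x hx)
  have h1 : |green K F x y| ≤ 2 ^ q * R₀ * w x := by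
    by_cases hyF : y ∈ F
    · have h3 := decayWeight_near_source (r₁ := r₁) (B := B) hl0 (by linarith : 2 ≤ Y) hq
        (hnear y hyF)
      calc |green K F x y| ≤ R₀ := hR₀ y hyF
        _ = 2 ^ q * R₀ * 2 ^ (-q) := by
          rw [Real.rpow_neg (by norm_num)]; field_simp
        _ ≤ _ := by gcongr
    · rw [green_eq_zero hyF, abs_zero]; positivity
  have h2 : |∑ j ∈ X \ F, (∑ i ∈ F, green K F x i * K i j) * green K X j y| ≤
      ∑ i ∈ F, |green K F x i| * ∑ j ∈ X \ F, japanese (i - j) ^ (-r) * (Ψ * w j) := by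
    simp_rw [Finset.mul_sum, Finset.sum_mul]
    rw [Finset.sum_comm]
    refine (Finset.abs_sum_le_sum_abs _ _).trans (Finset.sum_le_sum fun i hi => ?_)
    refine (Finset.abs_sum_le_sum_abs _ _).trans (Finset.sum_le_sum fun j hj => ?_)
    obtain ⟨hj1, hj2⟩ := Finset.mem_sdiff.1 hj
    rw [abs_mul, abs_mul, mul_assoc]
    refine mul_le_mul_of_nonneg_left (mul_le_mul (hK i j fun h => hj2 (h ▸ hi)) (hΨ j hj1)
      (abs_nonneg _) (Real.rpow_nonneg (japanese_pos _).le _)) (abs_nonneg _)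
  have h3 : ∑ i ∈ F, |green K F x i| * ∑ j ∈ X \ F, japanese (i - j) ^ (-r) * (Ψ * w j) ≤
      Ψ * ((2 ^ (r₁ + 2 * q) + 2 ^ (r + r₁ + 1)) * japaneseSum d b * l ^ (-q) * w x) * R := by
    have h4 : ∀ i ∈ F, |green K F x i| * ∑ j ∈ X \ F, japanese (i - j) ^ (-r) * (Ψ * w j) ≤
        Ψ * ((2 ^ (r₁ + 2 * q) + 2 ^ (r + r₁ + 1)) * japaneseSum d b * l ^ (-q) * w x) *
          (|green K F x i| * japanese (x - i) ^ q) := by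
      intro i hi
      have h5 : ∑ j ∈ X \ F, japanese (i - j) ^ (-r) * (Ψ * w j) =
          Ψ * ∑ j ∈ X \ F, japanese (i - j) ^ (-r) * w j := by
        rw [Finset.mul_sum]
        exact Finset.sum_congr rfl fun j _ => by ring
      have h6 := sum_hopping_weight_le (B := B) hb hq hr hr₁ hrr hl hY (hnear i hi) hF y
      rw [h5]
      calc _ ≤ |green K F x i| * (Ψ * (japanese (x - i) ^ q * ((2 ^ (r₁ + 2 * q) +
            2 ^ (r + r₁ + 1)) * japaneseSum d b * l ^ (-q) * w x))) := by gcongr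
        _ = _ := by ring
    refine (Finset.sum_le_sum h4).trans ?_
    rw [← Finset.mul_sum]
    gcongr
  rw [green_eq_sub hX hFu hFX hx hy]
  calc _ ≤ _ := abs_sub _ _
    _ ≤ 2 ^ q * R₀ * w x + Ψ * ((2 ^ (r₁ + 2 * q) + 2 ^ (r + r₁ + 1)) * japaneseSum d b *
        l ^ (-q) * w x) * R := add_le_add h1 (h2.trans h3)
    _ = _ := by ring

/-- Localisation around a bad site by a ball whose boundary avoids bad sites. -/
theorem abs_green_le_of_bad (hK : HasDecay r K) (hb : (d : ℝ) < b) (hq : 0 ≤ q)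
    (hr : q + b ≤ r) (hr₁ : b ≤ r₁) (hrr : r₁ ≤ r) (hl : 1 ≤ l) (hY : 4 ≤ Y)
    (hX : IsUnit (block K X)) {Q : ℝ} (hQ : ∀ x ∈ X, ∀ y ∈ X, |green K X x y| ≤ Q)
    {x y : Fin d → ℤ} (hxX : x ∈ X) (hx : x ∈ B) (hy : y ∈ X) {a : ℝ} (ha : 0 ≤ a)
    (hay : 2 * (a + 2 * (l * Y)) ≤ ‖x - y‖)
    (hshell : ∀ z ∈ B, a + 2 * (l * Y) ≤ ‖x - z‖ ∨ ‖x - z‖ ≤ a - 2 * (l * Y)) {N : ℝ}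
    (hN : ((X.filter fun z => ‖x - z‖ ≤ a).card : ℝ) ≤ N) {Ψ : ℝ}
    (hΨ0 : 0 ≤ Ψ) (hΨ : ∀ j ∈ X, |green K X j y| ≤ Ψ * decayWeight l Y q r₁ B y j) :
    |green K X x y| ≤ Ψ * (Q * N * (2 ^ r₁ * Y ^ (-q) *
      ((2 + 2 ^ (r₁ + 1)) * japaneseSum d b))) * decayWeight l Y q r₁ B y x := by
  have hl0 : 0 < l := by linarith
  have hY0 : 0 < Y := by linarith
  have hY1 : 1 ≤ Y := by linarith
  have hD : 1 ≤ l * Y := by nlinarith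
  set D := l * Y with hD_def
  have hD0 : 0 < D := by linarith
  have hr₁0 : 0 ≤ r₁ := (Nat.cast_nonneg d).trans (hb.le.trans hr₁)
  have hS := japaneseSum_pos hb
  have hQ0 : 0 ≤ Q := (abs_nonneg _).trans (hQ y hy y hy)
  set P := dilated D y x ^ (-r₁) with hP
  have hP0 : 0 < P := Real.rpow_pos_of_pos (dilated_pos _ _ _) _
  have hYq : 0 < Y ^ (-q) := Real.rpow_pos_of_pos hY0 _
  rw [decayWeight_of_mem hl0 hY1 hx]
  set U := X.filter fun z => ‖x - z‖ ≤ a with hU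
  have hUX : U ⊆ X := Finset.filter_subset _ _
  have hxU : x ∈ U := Finset.mem_filter.2 ⟨hxX, by simpa using ha⟩
  have hyU : y ∈ X \ U := by
    refine Finset.mem_sdiff.2 ⟨hy, fun h => ?_⟩
    have := (Finset.mem_filter.1 h).2
    linarith
  have hDY : D ^ (-q) ≤ Y ^ (-q) :=
    Real.rpow_le_rpow_of_nonpos hY0 (by rw [hD_def]; nlinarith) (by linarith)
  have tri : ∀ z z' : Fin d → ℤ, ‖x - z‖ ≤ ‖x - z'‖ + ‖z - z'‖ := by
    intro z z'
    have := norm_sub_le (x - z') (z - z')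
    rwa [sub_sub_sub_cancel_right] at this
  -- `y` is at least twice as far from `x` as this enlarged ball reaches, so the dilated factor on
  -- it is comparable with that at `x`.
  have hPle : ∀ z : Fin d → ℤ, ‖x - z‖ ≤ a + D → dilated D y z ^ (-r₁) ≤ 2 ^ r₁ * P := by
    intro z hz
    refine rpow_neg_le_of_le_two_mul (dilated_pos _ _ _) (max_le ?_ ?_) hr₁0
    · linarith [one_le_dilated D y z]
    · have h1 : ‖x - y‖ ≤ 2 * ‖z - y‖ := by
        have := tri y z
        rw [norm_sub_rev y z] at this
        linarith
      calc ‖x - y‖ / D ≤ 2 * ‖z - y‖ / D := by gcongr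
        _ = 2 * (‖z - y‖ / D) := by ring
        _ ≤ _ := by gcongr; exact le_max_right _ _
  have hfar : ∀ z ∈ X, ‖x - z‖ ≤ a + D → |green K X z y| ≤ Ψ * (2 ^ r₁ * P) := by
    intro z hzX hz
    refine (hΨ z hzX).trans (mul_le_mul_of_nonneg_left ?_ hΨ0)
    exact (decayWeight_le hY1 hq).trans (hPle z hz)
  -- Within D of the sphere of radius `a`, both `B` and `y` are still D away; the plateau is
  -- saturated.
  have hedge : ∀ z ∈ X, ‖x - z‖ ≤ a + D → a - D ≤ ‖x - z‖ →
      |green K X z y| ≤ Ψ * (2 ^ r₁ * P) * Y ^ (-q) := by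
    intro z hzX hz1 hz2
    have h1 : decayWeight l Y q r₁ B y z = dilated D y z ^ (-r₁) * Y ^ (-q) := by
      refine decayWeight_eq hl0 (fun z' hz' => ?_) ?_
      · have h3 := tri z z'
        have h4 := tri z' z
        rw [norm_sub_rev z' z] at h4
        rcases hshell z' hz' with h | h <;> linarith
      · have := tri y z
        rw [norm_sub_rev y z] at this
        linarith
    have h2 := hΨ z hzX
    rw [h1] at h2
    calc _ ≤ _ := h2
      _ ≤ Ψ * (2 ^ r₁ * P * Y ^ (-q)) := by gcongr; exact hPle z hz1
      _ = _ := by ring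
  have hsumb : ∀ (W : Finset (Fin d → ℤ)) (i : Fin d → ℤ),
      (∀ j ∈ W, D ≤ ‖i - j‖) → ∑ j ∈ W, japanese (i - j) ^ (-r) ≤ Y ^ (-q) * japaneseSum d b := by
    intro W i hW
    have h1 : ∀ j ∈ W, japanese (i - j) ^ (-r) ≤ Y ^ (-q) * japanese (i - j) ^ (-b) := by
      intro j hj
      have hJ := japanese_pos (i - j)
      calc japanese (i - j) ^ (-r) ≤ japanese (i - j) ^ (-q + -b) :=
            Real.rpow_le_rpow_of_exponent_le (one_le_japanese _) (by linarith)
        _ = japanese (i - j) ^ (-q) * japanese (i - j) ^ (-b) := Real.rpow_add hJ _ _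
        _ ≤ D ^ (-q) * japanese (i - j) ^ (-b) := by
            gcongr ?_ * _
            exact Real.rpow_le_rpow_of_nonpos hD0 ((hW j hj).trans (norm_le_japanese _))
              (by linarith)
        _ ≤ _ := by gcongr
    refine (Finset.sum_le_sum h1).trans ?_
    rw [← Finset.mul_sum]
    gcongr
    exact sum_japanese_le hb W i
  have hsum : ∀ (W : Finset (Fin d → ℤ)) (i : Fin d → ℤ),
      ∑ j ∈ W, japanese (i - j) ^ (-r) ≤ japaneseSum d b := fun W i =>
    (Finset.sum_le_sum fun j _ => Real.rpow_le_rpow_of_exponent_le (one_le_japanese _)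
      (by linarith)).trans (sum_japanese_le hb W i)
  have hKij : ∀ i ∈ U, ∀ j ∈ X \ U, |K i j| ≤ japanese (i - j) ^ (-r) := fun i hi j hj =>
    hK i j fun h => (Finset.mem_sdiff.1 hj).2 (h ▸ hi)
  have hKji : ∀ i ∈ U, ∀ j ∈ X \ U, |K j i| ≤ japanese (i - j) ^ (-r) := fun i hi j hj => by
    rw [japanese_sub_comm]
    exact hK j i fun h => (Finset.mem_sdiff.1 hj).2 (h ▸ hi)
  have hcross : ∀ i ∈ U, ∀ j ∈ X \ U, a < ‖x - j‖ := by
    intro i _ j hj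
    obtain ⟨h1, h2⟩ := Finset.mem_sdiff.1 hj
    by_contra h
    exact h2 (Finset.mem_filter.2 ⟨h1, not_lt.1 h⟩)
  set M := Ψ * (2 ^ r₁ * P) * Y ^ (-q) * japaneseSum d b with hM
  have hM0 : 0 ≤ M := by positivity
  have out : ∀ i ∈ U, ∑ j ∈ X \ U, |K j i| * |green K X i y| ≤ M := by
    intro i hi
    obtain ⟨hiX, hia⟩ := Finset.mem_filter.1 hi
    rw [← Finset.sum_mul]
    have h1 := Finset.sum_le_sum (hKji i hi)
    have h0 : 0 ≤ ∑ j ∈ X \ U, |K j i| := Finset.sum_nonneg fun _ _ => abs_nonneg _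
    -- Exactly one gain Y^{-q} is needed: from the weight if `i` is near the sphere, otherwise from
    -- the hopping, since leaving the ball then takes a hop longer than D.
    rcases le_or_gt (a - D) ‖x - i‖ with h | h
    · calc _ ≤ japaneseSum d b * (Ψ * (2 ^ r₁ * P) * Y ^ (-q)) :=
            mul_le_mul (h1.trans (hsum _ _)) (hedge i hiX (by linarith) h) (abs_nonneg _) hS.le
        _ = M := by rw [hM]; ring
    · have h2 := hsumb (X \ U) i
        (fun j hj => by
          have := tri j i
          rw [norm_sub_rev j i] at this
          linarith [hcross i hi j hj])
      calc _ ≤ Y ^ (-q) * japaneseSum d b * (Ψ * (2 ^ r₁ * P)) :=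
            mul_le_mul (h1.trans h2) (hfar i hiX (by linarith)) (abs_nonneg _) (by positivity)
        _ = M := by rw [hM]; ring
  have inn : ∀ i ∈ U, ∑ j ∈ X \ U, |K i j| * |green K X j y| ≤ (1 + 2 ^ (r₁ + 1)) * M := by
    intro i hi
    obtain ⟨hiX, hia⟩ := Finset.mem_filter.1 hi
    have h1 : ∀ j ∈ X \ U, |K i j| * |green K X j y| ≤
        Ψ * (2 ^ r₁ * P) * Y ^ (-q) * japanese (i - j) ^ (-r) +
        if D ≤ ‖i - j‖ then Ψ * (japanese (i - j) ^ (-r) * dilated D y j ^ (-r₁)) else 0 := by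
      intro j hj
      have hjX := (Finset.mem_sdiff.1 hj).1
      have hJ := Real.rpow_nonneg (japanese_pos (i - j)).le (-r)
      have hdj := dilated_pos D y j
      rcases le_or_gt ‖x - j‖ (a + D) with h | h
      · refine le_trans ?_ (le_add_of_nonneg_right ?_)
        · rw [mul_comm]
          exact mul_le_mul (hedge j hjX h (by linarith [hcross i hi j hj])) (hKij i hi j hj)
            (abs_nonneg _) (by positivity)
        · split_ifs <;> positivity
      · have h2 := tri j i
        rw [norm_sub_rev j i] at h2
        rw [if_pos (by linarith)]
        refine le_trans ?_ (le_add_of_nonneg_left (by positivity))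
        calc _ ≤ japanese (i - j) ^ (-r) * (Ψ * dilated D y j ^ (-r₁)) := by
              refine mul_le_mul (hKij i hi j hj) ?_ (abs_nonneg _) hJ
              exact (hΨ j hjX).trans (mul_le_mul_of_nonneg_left (decayWeight_le hY1 hq) hΨ0)
          _ = _ := by ring
    refine (Finset.sum_le_sum h1).trans ?_
    rw [Finset.sum_add_distrib, ← Finset.mul_sum, ← Finset.sum_filter, ← Finset.mul_sum]
    have h2 := sum_far_le hb hq hr hr₁ hrr hD (X \ U) i y
    have h3 := hPle i (by linarith)
    calc _ ≤ Ψ * (2 ^ r₁ * P) * Y ^ (-q) * japaneseSum d b +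
          Ψ * (2 ^ (r₁ + 1) * japaneseSum d b * Y ^ (-q) * (2 ^ r₁ * P)) := by
          gcongr
          · exact hsum _ _
          · refine h2.trans ?_
            have := dilated_pos D y i
            gcongr
      _ = _ := by rw [hM]; ring
  have h1 := abs_green_le_of_cutoff hX hQ hUX hxU hyU
  have h2 : ∑ i ∈ U, (∑ j ∈ X \ U, |K j i| * |green K X i y| +
      ∑ j ∈ X \ U, |K i j| * |green K X j y|) ≤ U.card • ((2 + 2 ^ (r₁ + 1)) * M) :=
    Finset.sum_le_card_nsmul _ _ _ fun i hi => by
      have h3 := out i hi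
      have h4 := inn i hi
      linarith
  rw [nsmul_eq_mul] at h2
  calc _ ≤ _ := h1
    _ ≤ Q * (N * ((2 + 2 ^ (r₁ + 1)) * M)) := by
        refine mul_le_mul_of_nonneg_left (h2.trans ?_) hQ0
        gcongr
    _ = _ := by rw [hM]; ring

/-- Polynomial decay of the Green's function of a large block from that of small good blocks, an
a priori bound, and sparsity of the bad sites. -/
theorem abs_green_le_of_sparse (hK : HasDecay r K) (hb : (d : ℝ) < b) (hq : 0 ≤ q)
    (hr : q + b ≤ r) (hr₁ : b ≤ r₁) (hrr : r₁ ≤ r) (hl : 1 ≤ l) (hY : 4 ≤ Y)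
    (hX : IsUnit (block K X)) {Q R R₀ N c : ℝ} (hc : 1 ≤ c) (hR₀ : 0 ≤ R₀)
    (hQ : ∀ x ∈ X, ∀ y ∈ X, |green K X x y| ≤ Q)
    (hgood : ∀ x ∈ X, x ∉ B → ∃ F ⊆ X, x ∈ F ∧ IsUnit (block K F) ∧ (∀ i ∈ F, ‖x - i‖ ≤ 2 * l) ∧
      (∀ j ∈ X \ F, l ≤ ‖x - j‖) ∧ (∀ i ∈ F, |green K F x i| ≤ R₀) ∧
      ∑ i ∈ F, |green K F x i| * japanese (x - i) ^ q ≤ R)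
    (hbad : ∀ x ∈ B, ∃ a, 0 ≤ a ∧ 2 * (a + 2 * (l * Y)) ≤ c * (l * Y) ∧
      (∀ z ∈ B, a + 2 * (l * Y) ≤ ‖x - z‖ ∨ ‖x - z‖ ≤ a - 2 * (l * Y)) ∧
      ((X.filter fun z => ‖x - z‖ ≤ a).card : ℝ) ≤ N)
    (hsmall₁ : (2 ^ (r₁ + 2 * q) + 2 ^ (r + r₁ + 1)) * japaneseSum d b * l ^ (-q) * R ≤ 1 / 2)
    (hsmall₂ : Q * N * (2 ^ r₁ * Y ^ (-q) * ((2 + 2 ^ (r₁ + 1)) * japaneseSum d b)) ≤ 1 / 2)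
    {x y : Fin d → ℤ} (hx : x ∈ X) (hy : y ∈ X) :
    |green K X x y| ≤ 2 * (2 ^ q * R₀ + c ^ r₁ * Q) * dilated (l * Y) y x ^ (-r₁) := by
  have hY1 : 1 ≤ Y := by linarith
  have hl0 : 0 < l := by linarith
  have hlY : 0 < l * Y := by nlinarith
  have hQ0 : 0 ≤ Q := (abs_nonneg _).trans (hQ y hy y hy)
  have hr₁0 : 0 ≤ r₁ := (Nat.cast_nonneg d).trans (hb.le.trans hr₁)
  have key := le_two_mul_of_self_improving (X := X) (u := fun x => |green K X x y|)
    (w := decayWeight l Y q r₁ B y) (S := 2 ^ q * R₀ + c ^ r₁ * Q) (fun _ _ => abs_nonneg _)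
    (fun _ _ => decayWeight_pos hY1) (fun Ψ hΨ0 hΨ x hx => by
      have hw : 0 < decayWeight l Y q r₁ B y x := decayWeight_pos hY1
      have hcQ : 0 ≤ c ^ r₁ * Q := by positivity
      have hqR : 0 ≤ 2 ^ q * R₀ := by positivity
      by_cases hxB : x ∈ B
      · obtain ⟨a, ha0, hac, hsh, hcard⟩ := hbad x hxB
        rcases le_or_gt (2 * (a + 2 * (l * Y))) ‖x - y‖ with h | h
        · refine (abs_green_le_of_bad hK hb hq hr hr₁ hrr hl hY hX hQ hx hxB hy ha0 h hsh hcard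
            hΨ0 hΨ).trans (mul_le_mul_of_nonneg_right ?_ hw.le)
          nlinarith
        -- Too close to `y` for a cutoff: the weight is at least c^{-r₁}, so the a priori bound
        -- suffices and becomes part of the source term.
        · have h1 : dilated (l * Y) y x ≤ c := by
            refine max_le hc ?_
            rw [div_le_iff₀ hlY]
            linarith
          rw [decayWeight_of_mem hl0 hY1 hxB] at hw ⊢
          have h2 : c ^ (-r₁) ≤ dilated (l * Y) y x ^ (-r₁) :=
            Real.rpow_le_rpow_of_nonpos (dilated_pos _ _ _) h1 (by linarith)
          have h3 : Q = c ^ r₁ * Q * c ^ (-r₁) := by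
            rw [Real.rpow_neg (by linarith)]
            have : c ^ r₁ ≠ 0 := (Real.rpow_pos_of_pos (by linarith) _).ne'
            field_simp
          calc |green K X x y| ≤ c ^ r₁ * Q * c ^ (-r₁) := (hQ x hx y hy).trans_eq h3
            _ ≤ c ^ r₁ * Q * dilated (l * Y) y x ^ (-r₁) := by gcongr
            _ ≤ _ := by
              refine mul_le_mul_of_nonneg_right ?_ hw.le
              linarith
      · obtain ⟨F, hFX, hxF, hFu, hnear, hfar, hF₀, hRF⟩ := hgood x hx hxB
        refine (abs_green_le_of_good hK hb hq hr hr₁ hrr hl hY hX hFu hFX hxF hy hnear hfar hF₀ hRF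
          hΨ0 hΨ).trans (mul_le_mul_of_nonneg_right ?_ hw.le)
        nlinarith)
  refine (key x hx).trans (mul_le_mul_of_nonneg_left (decayWeight_le hY1 hq) (by positivity))

end Coupling

/-! ### Sobolev norms against entries and rows. -/

section Sobolev

variable {d : ℕ} {C₀ s : ℝ} {X Y : Finset (Fin d → ℤ)} {A : Matrix X Y ℂ}

theorem japanese_rpow_two_mul (k : Fin d → ℤ) (s : ℝ) :
    japanese k ^ (2 * s) = (japanese k ^ s) ^ 2 := by
  rw [mul_comm, Real.rpow_mul (japanese_pos k).le, Real.rpow_two]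

open scoped Pointwise in
-- Counts the diagonals crudely. For a cube the loss is of order L^{d/2}, which the parameter
-- inequalities leave room for.
theorem sobolevNorm_le {N T : ℝ} (hC₀ : 0 ≤ C₀) (hT : 0 ≤ T)
    (hA : ∀ i j, ‖A i j‖ * japanese (i.1 - j.1) ^ s ≤ T)
    (hN : ((X - Y).card : ℝ) ≤ N) : sobolevNorm C₀ s A ≤ Real.sqrt (C₀ * N) * T := by
  have h1 : ∀ k ∈ X - Y, (⨆ q : {q : X × Y // (q.1 : Fin d → ℤ) - (q.2 : Fin d → ℤ) = k},
      ‖A q.1.1 q.1.2‖) ^ 2 * japanese k ^ (2 * s) ≤ T ^ 2 := by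
    intro k _
    have hJ := Real.rpow_pos_of_pos (japanese_pos k) s
    rw [japanese_rpow_two_mul, ← mul_pow]
    refine pow_le_pow_left₀ (mul_nonneg (Real.iSup_nonneg fun _ => norm_nonneg _) hJ.le) ?_ 2
    rw [← le_div_iff₀ hJ]
    refine Real.iSup_le (fun q => ?_) (by positivity)
    rw [le_div_iff₀ hJ]
    have := hA q.1.1 q.1.2
    rwa [q.2] at this
  unfold sobolevNorm
  rw [← Real.sqrt_sq hT, ← Real.sqrt_mul' _ (sq_nonneg T)]
  refine Real.sqrt_le_sqrt ?_
  rw [mul_assoc]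
  refine mul_le_mul_of_nonneg_left ?_ hC₀
  refine (Finset.sum_le_card_nsmul _ _ _ h1).trans ?_
  rw [nsmul_eq_mul]
  gcongr

open scoped Pointwise in
-- A row meets each diagonal at most once, since j ↦ i - j is injective, and every entry is below
-- the supremum of its diagonal.
theorem sum_sq_le_sobolevNorm_sq (hC₀ : 0 < C₀) (i : X) :
    ∑ j : Y, (‖A i j‖ * japanese (i.1 - j.1) ^ s) ^ 2 ≤
      C₀⁻¹ * sobolevNorm C₀ s A ^ 2 := by
  unfold sobolevNorm
  have h0 : ∀ k : Fin d → ℤ,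
      0 ≤ (⨆ q : {q : X × Y // (q.1 : Fin d → ℤ) - (q.2 : Fin d → ℤ) = k},
        ‖A q.1.1 q.1.2‖) ^ 2 * japanese k ^ (2 * s) := fun k =>
    mul_nonneg (sq_nonneg _) (Real.rpow_nonneg (japanese_pos k).le _)
  rw [Real.sq_sqrt (mul_nonneg hC₀.le (Finset.sum_nonneg fun k _ => h0 k)),
    inv_mul_cancel_left₀ hC₀.ne']
  have h1 : ∀ j ∈ (Finset.univ : Finset Y),
      (‖A i j‖ * japanese (i.1 - j.1) ^ s) ^ 2 ≤
      (fun k => (⨆ q : {q : X × Y // (q.1 : Fin d → ℤ) - (q.2 : Fin d → ℤ) = k},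
        ‖A q.1.1 q.1.2‖) ^ 2 * japanese k ^ (2 * s)) (i.1 - j.1) := by
    intro j _
    have hJ := Real.rpow_nonneg (japanese_pos (i.1 - j.1)).le s
    simp only
    rw [japanese_rpow_two_mul, ← mul_pow]
    refine pow_le_pow_left₀ (by positivity) (mul_le_mul_of_nonneg_right ?_ hJ) 2
    exact le_ciSup (f := fun q : {q : X × Y // (q.1 : Fin d → ℤ) - (q.2 : Fin d → ℤ) =
      i.1 - j.1} => ‖A q.1.1 q.1.2‖) (Set.finite_range _).bddAbove ⟨(i, j), rfl⟩
  refine (Finset.sum_le_sum h1).trans ?_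
  rw [← Finset.sum_image (s := (Finset.univ : Finset Y)) (g := fun j => i.1 - j.1)
    (f := fun k => (⨆ q : {q : X × Y // (q.1 : Fin d → ℤ) - (q.2 : Fin d → ℤ) = k},
        ‖A q.1.1 q.1.2‖) ^ 2 * japanese k ^ (2 * s))]
  · refine Finset.sum_le_sum_of_subset_of_nonneg ?_ fun k _ _ => h0 k
    intro k hk
    obtain ⟨j, _, rfl⟩ := Finset.mem_image.1 hk
    exact Finset.sub_mem_sub i.2 j.2
  · intro a _ b _ hab
    exact Subtype.ext (sub_right_injective hab)

/-- Cauchy–Schwarz; the loss √|Y| is the l^{d/2} in the estimates for small cubes. -/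
theorem sum_row_le_sobolevNorm (hC₀ : 0 < C₀) (i : X) :
    ∑ j : Y, ‖A i j‖ * japanese (i.1 - j.1) ^ s ≤
      Real.sqrt (Y.card / C₀) * sobolevNorm C₀ s A := by
  have hn : 0 ≤ sobolevNorm C₀ s A := Real.sqrt_nonneg _
  have h1 := sq_sum_le_card_mul_sum_sq (s := (Finset.univ : Finset Y))
    (f := fun j => ‖A i j‖ * japanese (i.1 - j.1) ^ s)
  have h2 := sum_sq_le_sobolevNorm_sq (s := s) (A := A) hC₀ i
  refine le_of_sq_le_sq ?_ (by positivity)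
  rw [mul_pow, Real.sq_sqrt (by positivity)]
  refine h1.trans ?_
  rw [Finset.card_univ, Fintype.card_coe]
  calc _ ≤ (Y.card : ℝ) * (C₀⁻¹ * sobolevNorm C₀ s A ^ 2) := by gcongr
    _ = _ := by ring

end Sobolev

/-! ### Green's functions of the model in cubes. -/

section Model

variable {d : ℕ}

/-- The infinite matrix of `H - E`. -/
noncomputable def kern {d : ℕ} (r lam : ℝ) (v : (Fin d → ℤ) → ℝ) (E : ℝ)
    (i j : Fin d → ℤ) : ℝ := lam⁻¹ * hop r i j + if i = j then v i - E else 0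

theorem hasDecay_kern {r lam : ℝ} (hlam : 1 ≤ lam) (v : (Fin d → ℤ) → ℝ) (E : ℝ) :
    HasDecay r (kern r lam v E) := by
  intro i j hij
  have h := hop_nonneg r i j
  rw [kern, if_neg hij, add_zero, abs_of_nonneg (by positivity)]
  exact (mul_le_of_le_one_left h (inv_le_one_of_one_le₀ hlam)).trans (hop_le_japanese r i j)

/-- The entries are real, so invertibility and Green's functions can be studied over ℝ. -/
theorem shifted_eq_map (r lam : ℝ) (v : (Fin d → ℤ) → ℝ) (X : Finset (Fin d → ℤ)) (E : ℝ) :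
    shifted r lam v X E = Complex.ofRealHom.mapMatrix (block (kern r lam v E) X) := by
  ext i j
  by_cases h : i = j
  · subst h
    simp [shifted, hamiltonian, block, kern]
    ring
  · simp [shifted, hamiltonian, block, kern, h]

theorem isUnit_shifted_iff {r lam : ℝ} {v : (Fin d → ℤ) → ℝ} {X : Finset (Fin d → ℤ)} {E : ℝ} :
    IsUnit (shifted r lam v X E) ↔ IsUnit (block (kern r lam v E) X) := by
  rw [shifted_eq_map, Matrix.isUnit_iff_isUnit_det, Matrix.isUnit_iff_isUnit_det,
    ← RingHom.map_det, isUnit_iff_ne_zero, isUnit_iff_ne_zero]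
  exact map_ne_zero_iff _ Complex.ofRealHom.injective

theorem norm_shifted_inv {r lam : ℝ} {v : (Fin d → ℤ) → ℝ} {X : Finset (Fin d → ℤ)} {E : ℝ}
    (h : IsUnit (block (kern r lam v E) X)) (i j : X) :
    ‖(shifted r lam v X E)⁻¹ i j‖ = |green (kern r lam v E) X i j| := by
  have h1 : (shifted r lam v X E)⁻¹ =
      Complex.ofRealHom.mapMatrix (block (kern r lam v E) X)⁻¹ := by
    refine Matrix.inv_eq_right_inv ?_
    rw [shifted_eq_map, ← map_mul,
      Matrix.mul_nonsing_inv _ ((Matrix.isUnit_iff_isUnit_det _).1 h), map_one]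
  rw [h1, green_of_mem i.2 j.2]
  simp

theorem card_cube (L : ℕ) (n : Fin d → ℤ) : ((cube L n).card : ℝ) = (2 * L + 1) ^ d := by
  have h : (cube L n).card = (2 * L + 1) ^ d := by
    rw [cube, Pi.card_Icc]
    have : ∀ i, (Finset.Icc (n i - (L : ℤ)) (n i + L)).card = 2 * L + 1 := by
      intro i
      rw [Int.card_Icc]
      omega
    simp [this]
  rw [h]; push_cast; ring

open scoped Pointwise in
theorem card_cube_sub_cube_le (L : ℕ) (n : Fin d → ℤ) :
    ((cube L n - cube L n).card : ℝ) ≤ (4 * L + 1) ^ d := by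
  have h : cube L n - cube L n ⊆ cube (2 * L) 0 := by
    intro k hk
    obtain ⟨i, hi, j, hj, rfl⟩ := Finset.mem_sub.1 hk
    rw [mem_cube] at hi hj ⊢
    have := norm_sub_le (i - n) (j - n)
    rw [sub_sub_sub_cancel_right] at this
    rw [sub_zero]
    push_cast
    linarith
  have h2 : ((cube L n - cube L n).card : ℝ) ≤ (cube (2 * L) (0 : Fin d → ℤ)).card := by
    exact_mod_cast Finset.card_le_card h
  rw [card_cube] at h2
  refine h2.trans_eq ?_
  push_cast
  ring

theorem card_filter_norm_le (X : Finset (Fin d → ℤ)) (x : Fin d → ℤ) {a : ℝ} (ha : 0 ≤ a) :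
    ((X.filter fun z => ‖x - z‖ ≤ a).card : ℝ) ≤ (2 * a + 1) ^ d := by
  have h : X.filter (fun z => ‖x - z‖ ≤ a) ⊆ cube ⌊a⌋₊ x := by
    intro z hz
    have h1 := (Finset.mem_filter.1 hz).2
    rw [norm_sub_rev] at h1
    have h2 : ‖z - x‖ = ((‖z - x‖₊ : NNReal) : ℝ) := rfl
    rw [cube, Finset.mem_Icc, Pi.le_def, Pi.le_def, ← forall_and]
    intro i
    have h3 : |((z i - x i : ℤ) : ℝ)| ≤ a := by
      have := (norm_le_pi_norm (z - x) i).trans h1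
      rwa [Pi.sub_apply, Int.norm_eq_abs] at this
    have h4 : ((z i - x i).natAbs : ℝ) ≤ a := by rwa [Nat.cast_natAbs, Int.cast_abs]
    have h5 := Nat.le_floor h4
    constructor <;> omega
  have h2 : ((X.filter fun z => ‖x - z‖ ≤ a).card : ℝ) ≤ (cube ⌊a⌋₊ x).card := by
    exact_mod_cast Finset.card_le_card h
  rw [card_cube] at h2
  refine h2.trans ?_
  gcongr
  exact Nat.floor_le ha

/-- The row sums of the Green's function of a good cube. -/
theorem sum_green_row_le_of_isGood {C₀ s₀ r₁ τ' r lam E δ q : ℝ} {v : (Fin d → ℤ) → ℝ} {L : ℕ}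
    {n : Fin d → ℤ} (hC₀ : 0 < C₀) (h : IsGood C₀ s₀ r₁ τ' r lam v E δ L n)
    (hq : q ∈ Set.Icc s₀ r₁) {x : Fin d → ℤ} (hx : x ∈ cube L n) :
    ∑ j ∈ cube L n, |green (kern r lam v E) (cube L n) x j| * japanese (x - j) ^ q ≤
      Real.sqrt ((2 * L + 1) ^ d / C₀) * (L : ℝ) ^ (τ' + δ * q) := by
  have hu := isUnit_shifted_iff.1 h.1
  have h1 := sum_row_le_sobolevNorm (s := q) (A := (shifted r lam v (cube L n) E)⁻¹) hC₀ ⟨x, hx⟩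
  rw [card_cube] at h1
  refine le_trans (le_of_eq ?_) (h1.trans (mul_le_mul_of_nonneg_left (h.2 q hq)
    (Real.sqrt_nonneg _)))
  rw [← Finset.sum_coe_sort]
  refine Finset.sum_congr rfl fun j _ => ?_
  rw [norm_shifted_inv hu]

/-- Pointwise decay of order `r₁` at scale `D` gives the Sobolev bounds of a good cube. -/
theorem isGood_of_decay {C₀ s₀ r₁ τ' r lam E δ S D : ℝ} {v : (Fin d → ℤ) → ℝ} {L : ℕ}
    {n : Fin d → ℤ} (hC₀ : 0 < C₀) (hs₀ : 0 ≤ s₀) (hS : 0 ≤ S) (hD : 1 ≤ D)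
    (hu : IsUnit (block (kern r lam v E) (cube L n)))
    (hdecay : ∀ x ∈ cube L n, ∀ y ∈ cube L n,
      |green (kern r lam v E) (cube L n) x y| ≤ S * dilated D y x ^ (-r₁))
    (hbound : ∀ s ∈ Set.Icc s₀ r₁,
      Real.sqrt (C₀ * (4 * L + 1) ^ d) * (S * D ^ s) ≤ (L : ℝ) ^ (τ' + δ * s)) :
    IsGood C₀ s₀ r₁ τ' r lam v E δ L n := by
  refine ⟨isUnit_shifted_iff.2 hu, fun s hs => ?_⟩
  refine le_trans (sobolevNorm_le hC₀.le (by positivity) (fun i j => ?_)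
    (card_cube_sub_cube_le L n)) (hbound s hs)
  have hD0 : 0 < D := by linarith
  have hd := dilated_pos D j.1 i.1
  have hs0 : 0 ≤ s := hs₀.trans hs.1
  rw [norm_shifted_inv hu]
  -- As s ≤ r₁, the decay cancels the bracket weight up to D^s, uniformly in the distance.
  have h1 : dilated D j.1 i.1 ^ (-r₁) ≤ dilated D j.1 i.1 ^ (-s) :=
    Real.rpow_le_rpow_of_exponent_le (one_le_dilated _ _ _) (by linarith [hs.2])
  have h2 : japanese (i.1 - j.1) ^ s ≤ D ^ s * dilated D j.1 i.1 ^ s := by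
    rw [← Real.mul_rpow hD0.le hd.le]
    exact Real.rpow_le_rpow (japanese_pos _).le (japanese_le_dilated hD _ _) hs0
  have hJ := japanese_pos (i.1 - j.1)
  calc _ ≤ (S * dilated D j.1 i.1 ^ (-s)) * (D ^ s * dilated D j.1 i.1 ^ s) := by
        refine mul_le_mul ((hdecay i i.2 j j.2).trans ?_) h2 (by positivity) (by positivity)
        gcongr
    _ = S * D ^ s := by
        rw [Real.rpow_neg hd.le]
        field_simp

end Model

/-! ### Covering the bad sites and finding a clean sphere. -/

section Geometry

variable {d : ℕ}

theorem mem_cube_iff_forall {L : ℕ} {n k : Fin d → ℤ} :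
    k ∈ cube L n ↔ ∀ i, n i - L ≤ k i ∧ k i ≤ n i + L := by
  rw [cube, Finset.mem_Icc, Pi.le_def, Pi.le_def, ← forall_and]

/-- Every site of a large cube lies deep, relative to the large cube, in some smaller cube. -/
theorem exists_inner_cube {l L : ℕ} (hlL : l ≤ L) {n x : Fin d → ℤ} (hx : x ∈ cube L n) :
    ∃ c ∈ cube L n, cube l c ⊆ cube L n ∧ x ∈ cube l c ∧
      ∀ j ∈ cube L n \ cube l c, (l : ℝ) ≤ ‖x - j‖ := by
  rw [mem_cube_iff_forall] at hx
  have hlL' : (l : ℤ) ≤ L := by exact_mod_cast hlL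
  -- The centre is `x` pushed coordinatewise into the cube of radius L - l. Each face of the small
  -- cube is then at distance at least l from `x` or lies on a face of the large cube.
  refine ⟨fun i => max (n i - L + l) (min (n i + L - l) (x i)), ?_, ?_, ?_, ?_⟩
  · rw [mem_cube_iff_forall]
    intro i
    have := hx i
    omega
  · intro k hk
    rw [mem_cube_iff_forall] at hk ⊢
    intro i
    have := hx i
    have := hk i
    omega
  · rw [mem_cube_iff_forall]
    intro i
    have := hx i
    omega
  · intro j hj
    obtain ⟨hj1, hj2⟩ := Finset.mem_sdiff.1 hj
    rw [mem_cube_iff_forall] at hj1 hj2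
    obtain ⟨i, hi⟩ := not_forall.1 hj2
    have h1 := hx i
    have h2 := hj1 i
    have h3 : (l : ℤ) ≤ |x i - j i| := by
      rw [le_abs]
      omega
    refine le_trans ?_ (norm_le_pi_norm (x - j) i)
    rw [Pi.sub_apply, Int.norm_eq_abs]
    exact_mod_cast h3

/-- A maximal separated family of centres is a net. -/
theorem exists_net {J : ℕ} {a : ℝ} {A : Finset (Fin d → ℤ)}
    (h : ∀ T ⊆ A, (T : Set (Fin d → ℤ)).Pairwise (fun c c' => a < ‖c - c'‖) → T.card < J) :
    ∃ T : Finset (Fin d → ℤ), T.card < J ∧ ∀ c ∈ A, ∃ t ∈ T, ‖c - t‖ ≤ max a 0 := by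
  classical
  obtain ⟨T, hT, hmax⟩ := Finset.exists_max_image
    (A.powerset.filter fun T : Finset (Fin d → ℤ) =>
      (T : Set (Fin d → ℤ)).Pairwise (fun c c' => a < ‖c - c'‖))
    Finset.card ⟨∅, by simp⟩
  obtain ⟨hTA, hTp⟩ := Finset.mem_filter.1 hT
  rw [Finset.mem_powerset] at hTA
  refine ⟨T, h T hTA hTp, fun c hc => ?_⟩
  by_contra! hcon
  -- The radius `max a 0` matters here: a centre in `T` is at distance 0 from itself, even for
  -- negative `a`.
  have hcT : c ∉ T := fun hcT => by simpa using hcon c hcT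
  have h1 : insert c T ∈ A.powerset.filter
      fun T : Finset (Fin d → ℤ) =>
        (T : Set (Fin d → ℤ)).Pairwise (fun c c' => a < ‖c - c'‖) := by
    rw [Finset.mem_filter, Finset.mem_powerset]
    refine ⟨Finset.insert_subset hc hTA, ?_⟩
    rw [Finset.coe_insert]
    refine hTp.insert fun t ht _ => ?_
    have := (le_max_left _ _).trans_lt (hcon t ht)
    exact ⟨this, by rwa [norm_sub_rev]⟩
  have h2 := hmax _ h1
  rw [Finset.card_insert_of_notMem hcT] at h2
  omega

/-- Around any point there is a sphere far from a set covered by few small balls. -/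
theorem exists_radius {J : ℕ} {D a : ℝ} (hD : 0 < D) (ha : a < D)
    {T B : Finset (Fin d → ℤ)}
    (hT : T.card < J) (hB : ∀ z ∈ B, ∃ t ∈ T, ‖z - t‖ ≤ a) (x : Fin d → ℤ) :
    ∃ ϱ, 0 ≤ ϱ ∧ ϱ ≤ 6 * J * D ∧ ∀ z ∈ B, ϱ + 2 * D ≤ ‖x - z‖ ∨ ‖x - z‖ ≤ ϱ - 2 * D := by
  by_contra! hcon
  -- Try the `J` radii 6(k+1)D. An obstruction to one lies within 2D of its sphere, hence its
  -- covering centre within 2D + a < 3D. These windows are disjoint and there are fewer than `J`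
  -- centres.
  have h1 : ∀ k : Fin J, ∃ t ∈ T, |‖x - t‖ - 6 * ((k : ℕ) + 1) * D| < 3 * D := by
    intro k
    have hk : ((k : ℕ) : ℝ) + 1 ≤ J := by exact_mod_cast k.2
    obtain ⟨z, hz, hz1, hz2⟩ := hcon (6 * ((k : ℕ) + 1) * D) (by positivity) (by gcongr)
    obtain ⟨t, ht, hzt⟩ := hB z hz
    refine ⟨t, ht, ?_⟩
    have h2 := norm_sub_norm_le (x - z) (x - t)
    have h3 := norm_sub_norm_le (x - t) (x - z)
    rw [sub_sub_sub_cancel_left] at h2 h3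
    rw [norm_sub_rev t z] at h2
    rw [abs_lt]
    constructor <;> linarith
  choose t ht hxt using h1
  obtain ⟨k, -, k', -, hne, heq⟩ := Finset.exists_ne_map_eq_of_card_lt_of_maps_to
    (s := (Finset.univ : Finset (Fin J))) (t := T) (by simpa using hT)
    (fun k _ => ht k)
  have h2 := abs_lt.1 (hxt k)
  have h3 := abs_lt.1 (hxt k')
  rw [heq] at h2
  have h4 : (1 : ℝ) ≤ |((k : ℕ) : ℝ) - ((k' : ℕ) : ℝ)| := by
    have : (1 : ℤ) ≤ |((k : ℕ) : ℤ) - ((k' : ℕ) : ℤ)| :=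
      Int.one_le_abs (sub_ne_zero.2 fun h => hne (Fin.ext (by exact_mod_cast h)))
    exact_mod_cast this
  rcases le_abs.1 h4 with h | h <;> nlinarith

end Geometry

/-! ### Criteria for a cube to be good. -/

/-- The deterministic induction step of the multi-scale analysis. -/
theorem isGood_of_sparse {d : ℕ} {b s₀ r r₁ C₀ τ' δ lam E Y Q : ℝ} {v : (Fin d → ℤ) → ℝ}
    {l L J : ℕ} {n : Fin d → ℤ} (hC₀ : 0 < C₀) (hs₀ : 0 ≤ s₀) (hb : (d : ℝ) < b)
    (hq : s₀ ≤ r₁ - s₀) (hr : r₁ - s₀ + b ≤ r) (hr₁ : b ≤ r₁) (hrr : r₁ ≤ r) (hlam : 1 ≤ lam)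
    (hl : 1 ≤ l) (hlL : l ≤ L) (hY : 4 ≤ Y)
    (hX : IsUnit (block (kern r lam v E) (cube L n)))
    (hQ : ∀ x ∈ cube L n, ∀ y ∈ cube L n, |green (kern r lam v E) (cube L n) x y| ≤ Q)
    (hsparse : ∀ T ⊆ cube L n,
      (∀ c ∈ T, cube l c ⊆ cube L n ∧ IsBad C₀ s₀ r₁ τ' r lam v E δ l c) →
      (T : Set (Fin d → ℤ)).Pairwise (fun c c' => 2 * (l : ℝ) < ‖c - c'‖) → T.card < J)
    (hsmall₁ : (2 ^ (r₁ + 2 * (r₁ - s₀)) + 2 ^ (r + r₁ + 1)) * japaneseSum d b *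
      (l : ℝ) ^ (-(r₁ - s₀)) *
        (Real.sqrt ((2 * l + 1) ^ d / C₀) * (l : ℝ) ^ (τ' + δ * (r₁ - s₀))) ≤ 1 / 2)
    (hsmall₂ : Q * (2 * (6 * J * (l * Y)) + 1) ^ d *
      (2 ^ r₁ * Y ^ (-(r₁ - s₀)) * ((2 + 2 ^ (r₁ + 1)) * japaneseSum d b)) ≤ 1 / 2)
    (hfinal : ∀ s ∈ Set.Icc s₀ r₁, Real.sqrt (C₀ * (4 * L + 1) ^ d) *
      (2 * (2 ^ (r₁ - s₀) * (Real.sqrt ((2 * l + 1) ^ d / C₀) * (l : ℝ) ^ (τ' + δ * s₀)) +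
        (12 * J + 4) ^ r₁ * Q) * (l * Y) ^ s) ≤ (L : ℝ) ^ (τ' + δ * s)) :
    IsGood C₀ s₀ r₁ τ' r lam v E δ L n := by
  classical
  have hl' : (1 : ℝ) ≤ l := by exact_mod_cast hl
  have hY0 : 0 < Y := by linarith
  have hD : 1 ≤ (l : ℝ) * Y := by nlinarith
  have hnmem : n ∈ cube L n := by rw [mem_cube_iff_forall]; intro i; omega
  have hQ0 : 0 ≤ Q := (abs_nonneg _).trans (hQ n hnmem n hnmem)
  obtain ⟨T, hTJ, hT⟩ := exists_net (J := J) (a := 2 * (l : ℝ))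
    (A := (cube L n).filter fun c => cube l c ⊆ cube L n ∧ IsBad C₀ s₀ r₁ τ' r lam v E δ l c)
    (fun T hTA hTp => hsparse T (hTA.trans (Finset.filter_subset _ _))
      (fun c hc => (Finset.mem_filter.1 (hTA hc)).2) hTp)
  rw [max_eq_left (by positivity)] at hT
  set B := (cube L n).filter fun x => ¬ ∃ c, cube l c ⊆ cube L n ∧ x ∈ cube l c ∧
      (∀ j ∈ cube L n \ cube l c, (l : ℝ) ≤ ‖x - j‖) ∧ IsGood C₀ s₀ r₁ τ' r lam v E δ l c
    with hBdef
  -- A bad site is within l of the centre of a bad small cube, and that centre within 2l of the net.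
  have hB : ∀ z ∈ B, ∃ t ∈ T, ‖z - t‖ ≤ 3 * (l : ℝ) := by
    intro z hz
    obtain ⟨hzX, hz⟩ := Finset.mem_filter.1 hz
    obtain ⟨c, hc1, hc2, hc3, hc4⟩ := exists_inner_cube hlL hzX
    have hc5 : IsBad C₀ s₀ r₁ τ' r lam v E δ l c := fun h => hz ⟨c, hc2, hc3, hc4, h⟩
    obtain ⟨t, ht, hct⟩ := hT c (Finset.mem_filter.2 ⟨hc1, hc2, hc5⟩)
    refine ⟨t, ht, ?_⟩
    have h1 := (mem_cube l c z).1 hc3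
    have h2 := norm_add_le (z - c) (c - t)
    rw [sub_add_sub_cancel] at h2
    linarith
  refine isGood_of_decay (S := 2 * (2 ^ (r₁ - s₀) * (Real.sqrt ((2 * l + 1) ^ d / C₀) *
    (l : ℝ) ^ (τ' + δ * s₀)) + (12 * J + 4) ^ r₁ * Q)) hC₀ hs₀ (by positivity) hD hX
    (fun x hx y hy => ?_) hfinal
  refine abs_green_le_of_sparse (B := B) (b := b) (N := (2 * (6 * J * (l * Y)) + 1) ^ d)
    (hasDecay_kern hlam v E) hb (by linarith) hr hr₁ hrr hl' hY hX
    (by have : (0 : ℝ) ≤ J := Nat.cast_nonneg J; linarith) (by positivity) hQ ?_ ?_ hsmall₁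
    hsmall₂ hx hy
  · intro x hx hxB
    have h1 : ∃ c, cube l c ⊆ cube L n ∧ x ∈ cube l c ∧
      (∀ j ∈ cube L n \ cube l c, (l : ℝ) ≤ ‖x - j‖) ∧
        IsGood C₀ s₀ r₁ τ' r lam v E δ l c := by
      by_contra h
      exact hxB (Finset.mem_filter.2 ⟨hx, h⟩)
    obtain ⟨c, hc1, hc2, hc3, hc4⟩ := h1
    refine ⟨cube l c, hc1, hc2, isUnit_shifted_iff.1 hc4.1, fun i hi => ?_, hc3,
      fun i hi => ?_,
      sum_green_row_le_of_isGood hC₀ hc4 ⟨hq, by linarith⟩ hc2⟩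
    · have h1 := (mem_cube l c x).1 hc2
      have h2 := (mem_cube l c i).1 hi
      have h3 := norm_sub_le (x - c) (i - c)
      rw [sub_sub_sub_cancel_right] at h3
      linarith
    -- Single entries are bounded at the lowest order s₀: this bound enters the final size of G,
    -- where the order q used for contraction would be too expensive.
    · refine le_trans ?_ (sum_green_row_le_of_isGood hC₀ hc4 (q := s₀) ⟨le_rfl, by linarith⟩ hc2)
      refine le_trans (le_mul_of_one_le_right (abs_nonneg _)
        (Real.one_le_rpow (one_le_japanese (x - i)) hs₀)) ?_
      exact Finset.single_le_sum (f := fun i => |green (kern r lam v E) (cube l c) x i| *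
        japanese (x - i) ^ s₀) (fun i _ => mul_nonneg (abs_nonneg _)
          (Real.rpow_nonneg (japanese_pos _).le _)) hi
  · intro x _
    obtain ⟨a, ha0, haJ, ha⟩ := exists_radius (D := (l : ℝ) * Y) (a := 3 * l) (by linarith)
      (by nlinarith) hTJ hB x
    refine ⟨a, ha0, by linarith, ha, (card_filter_norm_le _ x ha0).trans ?_⟩
    gcongr

/-- At strong disorder, a cube on which the potential avoids `E` is good. -/
theorem isGood_of_potential_far {d : ℕ} {b s₀ r r₁ C₀ τ' δ lam E η : ℝ} {v : (Fin d → ℤ) → ℝ}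
    {L : ℕ} {n : Fin d → ℤ} (hC₀ : 0 < C₀) (hs₀ : 0 ≤ s₀) (hb : (d : ℝ) < b)
    (hr₁ : b ≤ r₁) (hrr : r₁ ≤ r) (hlam : 0 < lam) (hη : 0 < η)
    (hv : ∀ j ∈ cube L n, η ≤ |v j - E|)
    (hsmall : lam⁻¹ * η⁻¹ * (2 ^ (r₁ + 1) * japaneseSum d b) ≤ 1 / 2)
    (hfinal : ∀ s ∈ Set.Icc s₀ r₁, Real.sqrt (C₀ * (4 * L + 1) ^ d) * (2 * η⁻¹) ≤
      (L : ℝ) ^ (τ' + δ * s)) :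
    IsGood C₀ s₀ r₁ τ' r lam v E δ L n := by
  classical
  set X := cube L n with hXdef
  set K := kern r lam v E with hK
  have hS := japaneseSum_pos hb
  have hr₁0 : 0 ≤ r₁ := (Nat.cast_nonneg d).trans (hb.le.trans hr₁)
  have hdiag : ∀ x, K x x = v x - E := by
    intro x
    simp [hK, kern, hop]
  have hoff : ∀ x j, x ≠ j → |K x j| ≤ lam⁻¹ * japanese (x - j) ^ (-r) := by
    intro x j hxj
    have h := hop_nonneg r x j
    rw [hK, kern, if_neg hxj, add_zero, abs_of_nonneg (by positivity)]
    gcongr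
    exact hop_le_japanese r x j
  have hu : IsUnit (block K X) := by
    rw [Matrix.isUnit_iff_isUnit_det, isUnit_iff_ne_zero]
    -- Strict diagonal dominance: a row of hopping sums to at most η/2.
    refine det_ne_zero_of_sum_row_lt_diag fun i => ?_
    have h1 : ∑ j ∈ Finset.univ.erase i, ‖block K X i j‖ ≤ lam⁻¹ * japaneseSum d b := by
      have h2 : ∑ j ∈ Finset.univ.erase i, ‖block K X i j‖ ≤
          ∑ j : X, lam⁻¹ * japanese (i.1 - j.1) ^ (-b) := by
        refine (Finset.sum_le_sum (g := fun j : X => lam⁻¹ * japanese (i.1 - j.1) ^ (-b))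
          fun j hj => ?_).trans ?_
        · have hij : i.1 ≠ j.1 := fun h => (Finset.ne_of_mem_erase hj) (Subtype.ext h.symm)
          refine (hoff _ _ hij).trans ?_
          gcongr ?_ * ?_
          exact Real.rpow_le_rpow_of_exponent_le (one_le_japanese _) (by linarith)
        · refine Finset.sum_le_sum_of_subset_of_nonneg (Finset.subset_univ _) fun j _ _ => ?_
          have := japanese_pos (i.1 - j.1)
          positivity
      refine h2.trans ?_
      rw [← Finset.mul_sum, Finset.sum_coe_sort X (fun j => japanese (i.1 - j) ^ (-b))]
      gcongr
      exact sum_japanese_le hb _ _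
    have h3 : ‖block K X i i‖ = |v i - E| := by
      rw [← hdiag]; rfl
    rw [h3]
    refine lt_of_le_of_lt h1 (lt_of_lt_of_le ?_ (hv i i.2))
    have h4 : (1 : ℝ) ≤ 2 ^ (r₁ + 1) := Real.one_le_rpow (by norm_num) (by linarith)
    have h5 : lam⁻¹ * η⁻¹ * japaneseSum d b ≤ 1 / 2 := by
      refine le_trans ?_ hsmall
      gcongr
      nlinarith
    calc lam⁻¹ * japaneseSum d b = lam⁻¹ * η⁻¹ * japaneseSum d b * η := by field_simp
      _ ≤ 1 / 2 * η := by gcongr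
      _ < η := by linarith
  refine isGood_of_decay (S := 2 * η⁻¹) (D := 1) hC₀ hs₀ (by positivity) le_rfl hu
    (fun x hx y hy => ?_) (fun s hs => by rw [Real.one_rpow, mul_one]; exact hfinal s hs)
  refine le_two_mul_of_self_improving (u := fun x => |green K X x y|) (S := η⁻¹)
    (w := fun x => dilated 1 y x ^ (-r₁)) (fun _ _ => abs_nonneg _)
    (fun x _ => Real.rpow_pos_of_pos (dilated_pos 1 y x) _) (fun Ψ hΨ0 hΨ x hx => ?_) x hx
  have hw : 0 < dilated 1 y x ^ (-r₁) := Real.rpow_pos_of_pos (dilated_pos 1 y x) _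
  have h1 := sum_mul_green hu hx hy
  rw [← Finset.add_sum_erase _ _ hx, hdiag] at h1
  have h2 : |∑ j ∈ X.erase x, K x j * green K X j y| ≤
      lam⁻¹ * Ψ * (2 ^ (r₁ + 1) * japaneseSum d b * dilated 1 y x ^ (-r₁)) := by
    have h3 : ∀ j ∈ X.erase x, |K x j * green K X j y| ≤
        lam⁻¹ * Ψ * (japanese (x - j) ^ (-r) * dilated 1 y j ^ (-r₁)) := by
      intro j hj
      rw [abs_mul]
      have hJ := japanese_pos (x - j)
      calc _ ≤ (lam⁻¹ * japanese (x - j) ^ (-r)) * (Ψ * dilated 1 y j ^ (-r₁)) :=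
            mul_le_mul (hoff x j (Finset.ne_of_mem_erase hj).symm)
              (hΨ j (Finset.mem_of_mem_erase hj)) (abs_nonneg _) (by positivity)
        _ = _ := by ring
    refine (Finset.abs_sum_le_sum_abs _ _).trans ((Finset.sum_le_sum h3).trans ?_)
    rw [← Finset.mul_sum]
    -- With D = 1 every off-diagonal site is far, and no power of D has to be gained, so q = 0.
    have h4 := sum_far_le (q := 0) (r := r) (D := 1) hb le_rfl (by linarith) hr₁ hrr le_rfl
      (X.erase x) x y
    rw [neg_zero, Real.rpow_zero, mul_one] at h4
    gcongr
    refine le_trans (Finset.sum_le_sum_of_subset_of_nonneg ?_ fun j _ _ => ?_) h4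
    · intro j hj
      refine Finset.mem_filter.2 ⟨hj, one_le_norm_of_ne_zero (sub_ne_zero.2 ?_)⟩
      exact (Finset.ne_of_mem_erase hj).symm
    · have := japanese_pos (x - j)
      have := dilated_pos 1 y j
      positivity
  have h5 : |if x = y then (1 : ℝ) else 0| ≤ dilated 1 y x ^ (-r₁) := by
    split_ifs with h
    · rw [h]; simp [dilated]
    · rw [abs_zero]; exact hw.le
  have h6 : |v x - E| * |green K X x y| ≤ dilated 1 y x ^ (-r₁) +
      lam⁻¹ * Ψ * (2 ^ (r₁ + 1) * japaneseSum d b * dilated 1 y x ^ (-r₁)) := by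
    rw [← abs_mul, eq_sub_of_add_eq h1]
    exact (abs_sub _ _).trans (add_le_add h5 h2)
  have h7 : η * |green K X x y| ≤ dilated 1 y x ^ (-r₁) +
      lam⁻¹ * Ψ * (2 ^ (r₁ + 1) * japaneseSum d b * dilated 1 y x ^ (-r₁)) :=
    (mul_le_mul_of_nonneg_right (hv x hx) (abs_nonneg _)).trans h6
  calc |green K X x y| = η⁻¹ * (η * |green K X x y|) := by field_simp
    _ ≤ η⁻¹ * (dilated 1 y x ^ (-r₁) +
      lam⁻¹ * Ψ * (2 ^ (r₁ + 1) * japaneseSum d b * dilated 1 y x ^ (-r₁))) := by gcongr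
    _ = (η⁻¹ + Ψ * (lam⁻¹ * η⁻¹ * (2 ^ (r₁ + 1) * japaneseSum d b))) *
        dilated 1 y x ^ (-r₁) := by ring
    _ ≤ (η⁻¹ + Ψ * (1 / 2)) * dilated 1 y x ^ (-r₁) := by gcongr
    _ = _ := by ring

/-! ### Near-kernel vectors of symmetric matrices. -/

section NearKernel

open Matrix

variable {ι : Type*} [Fintype ι]

/-- `A` has a unit vector that it maps to a vector of length at most `ε`. -/
def NearKernel (A : Matrix ι ι ℝ) (ε : ℝ) : Prop :=
  ∃ u : ι → ℝ, u ⬝ᵥ u = 1 ∧ (A *ᵥ u) ⬝ᵥ (A *ᵥ u) ≤ ε ^ 2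

/-- As `NearKernel`, with a vector that has at least average mass at `x`. -/
def NearKernelAt (A : Matrix ι ι ℝ) (ε : ℝ) (x : ι) : Prop :=
  ∃ u : ι → ℝ, u ⬝ᵥ u = 1 ∧ (A *ᵥ u) ⬝ᵥ (A *ᵥ u) ≤ ε ^ 2 ∧ 1 ≤ Fintype.card ι * u x ^ 2

theorem NearKernel.exists_at {A : Matrix ι ι ℝ} {ε : ℝ} (h : NearKernel A ε) :
    ∃ x, NearKernelAt A ε x := by
  obtain ⟨u, hu, hA⟩ := h
  by_contra! hcon
  have h1 : ∀ x, Fintype.card ι * u x ^ 2 < 1 := fun x => by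
    by_contra hx
    exact hcon x ⟨u, hu, hA, not_lt.1 hx⟩
  have hne : Nonempty ι := by
    by_contra hne
    rw [not_nonempty_iff] at hne
    simp [dotProduct] at hu
  have hc : (0 : ℝ) < Fintype.card ι := by exact_mod_cast Fintype.card_pos
  have h2 : ∑ x : ι, Fintype.card ι * u x ^ 2 < ∑ _x : ι, (1 : ℝ) :=
    Finset.sum_lt_sum_of_nonempty Finset.univ_nonempty fun x _ => h1 x
  rw [← Finset.mul_sum] at h2
  have h3 : ∑ x, u x ^ 2 = 1 := by
    rw [← hu]
    exact Finset.sum_congr rfl fun x _ => sq (u x)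
  rw [h3] at h2
  simp at h2

theorem abs_dotProduct_le {u w : ι → ℝ} {a b : ℝ} (ha : 0 ≤ a) (hb : 0 ≤ b)
    (hu : u ⬝ᵥ u ≤ a ^ 2) (hw : w ⬝ᵥ w ≤ b ^ 2) : |u ⬝ᵥ w| ≤ a * b := by
  have h1 := Finset.sum_mul_sq_le_sq_mul_sq Finset.univ u w
  refine abs_le_of_sq_le_sq ?_ (by positivity)
  have h2 : ∀ z : ι → ℝ, ∑ i, z i ^ 2 = z ⬝ᵥ z := fun z =>
    Finset.sum_congr rfl fun i _ => sq (z i)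
  rw [h2, h2] at h1
  have h3 : 0 ≤ w ⬝ᵥ w := by rw [← h2]; positivity
  calc (u ⬝ᵥ w) ^ 2 ≤ (u ⬝ᵥ u) * (w ⬝ᵥ w) := h1
    _ ≤ a ^ 2 * b ^ 2 := by gcongr
    _ = _ := by ring

variable [DecidableEq ι]

/-- By homogeneity ‖Au‖ ≥ ε‖u‖ for all u; this forces injectivity, and on the columns of the inverse
it gives the bound. It turns non-resonance into the a priori bound on the Green's function. -/
theorem isUnit_of_not_nearKernel {A : Matrix ι ι ℝ} {ε : ℝ} (hε : 0 < ε)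
    (h : ¬ NearKernel A ε) : IsUnit A ∧ ∀ i j, |A⁻¹ i j| ≤ ε⁻¹ := by
  have hpos : ∀ u : ι → ℝ, 0 ≤ u ⬝ᵥ u := fun u => Finset.sum_nonneg fun i _ => mul_self_nonneg _
  have key : ∀ u : ι → ℝ, ε ^ 2 * (u ⬝ᵥ u) ≤ (A *ᵥ u) ⬝ᵥ (A *ᵥ u) := by
    intro u
    by_contra! hcon
    have hu : 0 < u ⬝ᵥ u := by
      rcases (hpos u).eq_or_lt with h0 | h0
      · rw [← h0, mul_zero] at hcon
        exact absurd hcon (not_lt.2 (hpos _))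
      · exact h0
    have hs := Real.sqrt_pos.2 hu
    have hss := Real.mul_self_sqrt hu.le
    refine h ⟨(Real.sqrt (u ⬝ᵥ u))⁻¹ • u, ?_, ?_⟩
    · rw [smul_dotProduct, dotProduct_smul, smul_eq_mul, smul_eq_mul, ← mul_assoc, ← mul_inv, hss]
      exact inv_mul_cancel₀ hu.ne'
    · rw [mulVec_smul, smul_dotProduct, dotProduct_smul, smul_eq_mul, smul_eq_mul, ← mul_assoc,
        ← mul_inv, hss, inv_mul_le_iff₀ hu]
      linarith
  have hu : IsUnit A := by
    rw [← mulVec_injective_iff_isUnit]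
    intro u w huw
    have h1 := key (u - w)
    have h2 : A *ᵥ (u - w) = 0 := by
      rw [mulVec_sub, sub_eq_zero]; exact huw
    rw [h2, dotProduct_zero] at h1
    have h3 : (u - w) ⬝ᵥ (u - w) = 0 :=
      le_antisymm (nonpos_of_mul_nonpos_right h1 (by positivity)) (hpos _)
    exact sub_eq_zero.1 (dotProduct_self_eq_zero.1 h3)
  refine ⟨hu, fun i j => ?_⟩
  have h1 : A *ᵥ (A⁻¹ *ᵥ Pi.single j 1) = Pi.single j 1 := by
    rw [mulVec_mulVec, mul_nonsing_inv _ ((isUnit_iff_isUnit_det _).1 hu), one_mulVec]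
  have h2 := key (A⁻¹ *ᵥ Pi.single j 1)
  rw [h1, single_one_dotProduct, Pi.single_eq_same] at h2
  have h3 : (A⁻¹ i j) ^ 2 ≤ (A⁻¹ *ᵥ Pi.single j 1) ⬝ᵥ (A⁻¹ *ᵥ Pi.single j 1) := by
    have h4 : ∀ k, (A⁻¹ *ᵥ Pi.single j 1) k = A⁻¹ k j := fun k => by
      rw [mulVec_single_one]; rfl
    rw [dotProduct, sq, ← h4 i]
    exact Finset.single_le_sum (f := fun k => (A⁻¹ *ᵥ Pi.single j 1) k *
      (A⁻¹ *ᵥ Pi.single j 1) k) (fun k _ => mul_self_nonneg _) (Finset.mem_univ i)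
  refine abs_le_of_sq_le_sq ?_ (by positivity)
  rw [inv_pow, ← one_div (ε ^ 2), le_div_iff₀ (by positivity)]
  nlinarith

/-- Parseval in an eigenbasis: if every eigenvalue were farther than ε from `E`, then A - E would
stretch every unit vector by more than ε. -/
theorem exists_eigenvalue_near {A : Matrix ι ι ℝ} (hA : A.IsHermitian) {E ε : ℝ} (hε : 0 ≤ ε)
    (h : NearKernel (A - E • (1 : Matrix ι ι ℝ)) ε) : ∃ i, |hA.eigenvalues i - E| ≤ ε := by
  obtain ⟨u, hu, hAu⟩ := h
  by_contra! hcon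
  have hnorm : ∀ w : ι → ℝ, ∑ i, (w ⬝ᵥ (hA.eigenvectorBasis i).ofLp) ^ 2 = w ⬝ᵥ w := by
    intro w
    have h1 := hA.eigenvectorBasis.sum_sq_norm_inner_right (WithLp.toLp 2 w)
    have h2 : ∀ i, ‖inner ℝ (hA.eigenvectorBasis i) (WithLp.toLp 2 w)‖ ^ 2 =
        (w ⬝ᵥ (hA.eigenvectorBasis i).ofLp) ^ 2 := by
      intro i
      rw [EuclideanSpace.inner_eq_star_dotProduct, Real.norm_eq_abs, sq_abs]
      simp
    simp_rw [h2] at h1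
    rw [h1, EuclideanSpace.norm_sq_eq]
    exact Finset.sum_congr rfl fun i _ => by rw [Real.norm_eq_abs, sq_abs, sq]
  have hcoef : ∀ i, ((A - E • (1 : Matrix ι ι ℝ)) *ᵥ u) ⬝ᵥ (hA.eigenvectorBasis i).ofLp =
      (hA.eigenvalues i - E) * (u ⬝ᵥ (hA.eigenvectorBasis i).ofLp) := by
    intro i
    have hT : Aᵀ = A := by
      have := hA.eq
      rwa [conjTranspose_eq_transpose_of_trivial] at this
    have h1 : (A *ᵥ u) ⬝ᵥ (hA.eigenvectorBasis i).ofLp =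
        hA.eigenvalues i * (u ⬝ᵥ (hA.eigenvectorBasis i).ofLp) := by
      rw [dotProduct_comm, dotProduct_mulVec, ← mulVec_transpose, hT, hA.mulVec_eigenvectorBasis,
        smul_dotProduct, smul_eq_mul, dotProduct_comm]
    rw [sub_mulVec, sub_dotProduct, h1, smul_mulVec, one_mulVec, smul_dotProduct, smul_eq_mul]
    ring
  have h1 := hnorm ((A - E • (1 : Matrix ι ι ℝ)) *ᵥ u)
  simp_rw [hcoef] at h1
  have h2 := hnorm u
  rw [hu] at h2
  have hlt : ∀ i, 0 < (hA.eigenvalues i - E) ^ 2 - ε ^ 2 := fun i => by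
    have := sq_lt_sq' (by linarith [hcon i]) (hcon i)
    rw [sq_abs] at this
    linarith
  have h3 : ∑ i, ((hA.eigenvalues i - E) ^ 2 - ε ^ 2) *
      (u ⬝ᵥ (hA.eigenvectorBasis i).ofLp) ^ 2 ≤ 0 := by
    have : ∑ i, ((hA.eigenvalues i - E) ^ 2 - ε ^ 2) *
      (u ⬝ᵥ (hA.eigenvectorBasis i).ofLp) ^ 2 =
        ∑ i, ((hA.eigenvalues i - E) * (u ⬝ᵥ (hA.eigenvectorBasis i).ofLp)) ^ 2 -
        ε ^ 2 * ∑ i, (u ⬝ᵥ (hA.eigenvectorBasis i).ofLp) ^ 2 := by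
      rw [Finset.mul_sum, ← Finset.sum_sub_distrib]
      exact Finset.sum_congr rfl fun i _ => by ring
    rw [this, h1, h2]
    linarith
  have h4 : ∀ i, (u ⬝ᵥ (hA.eigenvectorBasis i).ofLp) ^ 2 = 0 := by
    intro i
    have h5 := Finset.single_le_sum (f := fun i => ((hA.eigenvalues i - E) ^ 2 - ε ^ 2) *
      (u ⬝ᵥ (hA.eigenvectorBasis i).ofLp) ^ 2) (fun i _ => mul_nonneg (hlt i).le (sq_nonneg _))
      (Finset.mem_univ i)
    refine le_antisymm (nonpos_of_mul_nonpos_right (h5.trans h3) (hlt i)) (sq_nonneg _)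
  simp [h4] at h2

/-- Allows the unknown energy to be replaced by a nearby eigenvalue of the other cube. -/
theorem NearKernel.perturb {A : Matrix ι ι ℝ} {E e ε : ℝ} (hε : 0 ≤ ε)
    (h : NearKernel (A - E • (1 : Matrix ι ι ℝ)) ε) (he : |e - E| ≤ ε) :
    NearKernel (A - e • (1 : Matrix ι ι ℝ)) (2 * ε) := by
  obtain ⟨u, hu, hAu⟩ := h
  refine ⟨u, hu, ?_⟩
  set w := (A - E • (1 : Matrix ι ι ℝ)) *ᵥ u with hw
  have h1 : (A - e • (1 : Matrix ι ι ℝ)) *ᵥ u = w - (e - E) • u := by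
    rw [hw, sub_mulVec, sub_mulVec, smul_mulVec, smul_mulVec, one_mulVec, sub_smul]
    abel
  have h2 := abs_dotProduct_le (u := w) (w := u) hε zero_le_one hAu (by rw [hu]; norm_num)
  rw [h1, sub_dotProduct, dotProduct_sub, dotProduct_sub, smul_dotProduct, smul_dotProduct,
    dotProduct_smul, dotProduct_smul, hu, dotProduct_comm u w]
  simp only [smul_eq_mul, mul_one]
  have h3 : |(e - E) * (w ⬝ᵥ u)| ≤ ε * ε := by
    rw [abs_mul]
    exact mul_le_mul he (by linarith) (abs_nonneg _) hε
  have h4 : (e - E) * (e - E) ≤ ε * ε := by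
    rw [← abs_mul_abs_self]
    exact mul_self_le_mul_self (abs_nonneg _) he
  have h5 := (abs_le.1 h3).1
  nlinarith

/-- Changing one diagonal entry of a symmetric matrix by more than `2 ε N` destroys a near-kernel
vector with mass there. -/
theorem abs_le_of_nearKernelAt {A A' : Matrix ι ι ℝ} (hA : Aᵀ = A) {ε t : ℝ} (hε : 0 ≤ ε) {x : ι}
    (hAA' : ∀ u, A' *ᵥ u = A *ᵥ u + (t * u x) • Pi.single x 1) (h : NearKernelAt A ε x)
    (h' : NearKernelAt A' ε x) : |t| ≤ 2 * ε * Fintype.card ι := by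
  obtain ⟨u, hu, hAu, hux⟩ := h
  obtain ⟨w, hw, hAw, hwx⟩ := h'
  have hN : (0 : ℝ) ≤ Fintype.card ι := Nat.cast_nonneg _
  have h1 := abs_dotProduct_le (u := A *ᵥ u) (w := w) hε zero_le_one hAu (by rw [hw]; norm_num)
  have h2 := abs_dotProduct_le (u := A' *ᵥ w) (w := u) hε zero_le_one hAw (by rw [hu]; norm_num)
  -- By symmetry the two near-kernel relations, tested against each other's vector, differ only by
  -- the rank-one term. Both pairings are at most ε, while |w x · u x| is at least 1/N.
  have h3 : (A' *ᵥ w) ⬝ᵥ u = (A *ᵥ u) ⬝ᵥ w + t * (w x * u x) := by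
    rw [hAA', add_dotProduct, smul_dotProduct, single_one_dotProduct, smul_eq_mul,
      dotProduct_comm (A *ᵥ u) w, dotProduct_mulVec, ← mulVec_transpose, hA, mul_assoc]
  have h4 : |t| * (|w x| * |u x|) ≤ 2 * ε := by
    rw [← abs_mul, ← abs_mul]
    have h5 : t * (w x * u x) = (A' *ᵥ w) ⬝ᵥ u - (A *ᵥ u) ⬝ᵥ w := by rw [h3]; ring
    rw [h5]
    refine (abs_sub _ _).trans ?_
    linarith
  have h6 : 1 ≤ Fintype.card ι * (|w x| * |u x|) := by
    refine le_of_sq_le_sq ?_ (by positivity)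
    have h7 : (Fintype.card ι * (|w x| * |u x|)) ^ 2 =
        (Fintype.card ι * u x ^ 2) * (Fintype.card ι * w x ^ 2) := by
      rw [mul_pow, mul_pow, sq_abs, sq_abs]; ring
    rw [h7]
    nlinarith
  calc |t| ≤ |t| * (Fintype.card ι * (|w x| * |u x|)) := le_mul_of_one_le_right (abs_nonneg _) h6
    _ = (|t| * (|w x| * |u x|)) * Fintype.card ι := by ring
    _ ≤ _ := by gcongr

end NearKernel

/-! ### Closedness and conditioning. -/

section Closed

open Matrix

/-- Projection along a compact factor is closed. This makes events quantified over unit vectors or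
energies closed in the potential, hence measurable. -/
theorem isClosed_exists_mem_compact {α β : Type*} [TopologicalSpace α] [TopologicalSpace β]
    {K : Set β} (hK : IsCompact K) {C : Set (α × β)} (hC : IsClosed C) :
    IsClosed {a | ∃ k ∈ K, (a, k) ∈ C} := by
  have : CompactSpace K := isCompact_iff_compactSpace.1 hK
  have h1 : IsClosed {p : α × K | (p.1, (p.2 : β)) ∈ C} := hC.preimage (by fun_prop)
  convert isClosedMap_fst_of_compactSpace _ h1 using 1
  ext a
  simp

variable {ι α : Type*} [Fintype ι] [TopologicalSpace α] {A : α → Matrix ι ι ℝ}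

theorem isCompact_unit_sphere : IsCompact {u : ι → ℝ | u ⬝ᵥ u = 1} := by
  refine IsCompact.of_isClosed_subset (isCompact_Icc (a := fun _ : ι => (-1 : ℝ)) (b := fun _ => 1))
    (isClosed_eq (by fun_prop) continuous_const) fun u hu => ?_
  have h1 : ∀ i, |u i| ≤ 1 := fun i => by
    refine abs_le_one_iff_mul_self_le_one.2 ?_
    rw [← (hu : u ⬝ᵥ u = 1)]
    exact Finset.single_le_sum (f := fun i => u i * u i) (fun i _ => mul_self_nonneg _)
      (Finset.mem_univ i)
  exact ⟨fun i => (abs_le.1 (h1 i)).1, fun i => (abs_le.1 (h1 i)).2⟩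

theorem isClosed_nearKernel (hA : Continuous A) (ε : ℝ) : IsClosed {a | NearKernel (A a) ε} := by
  refine isClosed_exists_mem_compact (isCompact_unit_sphere (ι := ι))
    (C := {p : α × (ι → ℝ) | (A p.1 *ᵥ p.2) ⬝ᵥ (A p.1 *ᵥ p.2) ≤ ε ^ 2}) ?_
  exact isClosed_le (by fun_prop) continuous_const

theorem isClosed_nearKernelAt (hA : Continuous A) (ε : ℝ) (x : ι) :
    IsClosed {a | NearKernelAt (A a) ε x} := by
  refine isClosed_exists_mem_compact (isCompact_unit_sphere (ι := ι))
    (C := {p : α × (ι → ℝ) | (A p.1 *ᵥ p.2) ⬝ᵥ (A p.1 *ᵥ p.2) ≤ ε ^ 2} ∩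
      {p : α × (ι → ℝ) | 1 ≤ Fintype.card ι * p.2 x ^ 2}) ?_
  exact (isClosed_le (by fun_prop) continuous_const).inter
    (isClosed_le continuous_const (by fun_prop))

end Closed

section Glue

variable {d : ℕ} {S T : Finset (Fin d → ℤ)}

/-- The potential with values `a` on `S`, `b` on `T \ S` and `0` elsewhere. -/
def glue (S T : Finset (Fin d → ℤ)) (a : S → ℝ) (b : T → ℝ) (j : Fin d → ℤ) : ℝ :=
  if h : j ∈ S then a ⟨j, h⟩ else if h : j ∈ T then b ⟨j, h⟩ else 0

theorem continuous_glue : Continuous fun p : (S → ℝ) × (T → ℝ) => glue S T p.1 p.2 := by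
  refine continuous_pi fun j => ?_
  unfold glue
  by_cases h : j ∈ S
  · simp only [h, dite_true]; fun_prop
  · by_cases h' : j ∈ T
    · simp only [h, h', dite_true, dite_false]; fun_prop
    · simp only [h, h', dite_false]; fun_prop

theorem glue_restrict {v : (Fin d → ℤ) → ℝ} {j : Fin d → ℤ} (hj : j ∈ S ∪ T) :
    glue S T (fun i => v i) (fun i => v i) j = v j := by
  unfold glue
  by_cases h : j ∈ S
  · simp [h]
  · simp [h, (Finset.mem_union.1 hj).resolve_left h]

/-- Membership in `W` is decided by the coordinates in `S`. -/
def DependsOnlyOn {d : ℕ} (W : Set ((Fin d → ℤ) → ℝ)) (S : Finset (Fin d → ℤ)) : Prop :=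
  ∀ v v' : (Fin d → ℤ) → ℝ, (∀ j ∈ S, v j = v' j) → v ∈ W → v' ∈ W

variable {Ω : Type*} [MeasurableSpace Ω] {P : Measure Ω} [IsProbabilityMeasure P]
  {V : (Fin d → ℤ) → Ω → ℝ}

/-- Fubini's theorem for closed sets of potentials. -/
theorem measure_le_of_section (hV : ∀ n, Measurable (V n)) (hind : iIndepFun V P)
    (hST : Disjoint S T) {W : Set ((Fin d → ℤ) → ℝ)} (hW : IsClosed W)
    (hdep : DependsOnlyOn W (S ∪ T)) {c : ENNReal}
    (h : ∀ b : T → ℝ, P {ω | glue S T (fun i => V i ω) b ∈ W} ≤ c) :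
    P {ω | (fun j => V j ω) ∈ W} ≤ c := by
  have hA : MeasurableSet {p : (S → ℝ) × (T → ℝ) | glue S T p.1 p.2 ∈ W} :=
    (hW.preimage continuous_glue).measurableSet
  have hX : Measurable fun ω (i : S) => V i ω := measurable_pi_lambda _ fun i => hV i
  have hY : Measurable fun ω (i : T) => V i ω := measurable_pi_lambda _ fun i => hV i
  have hXY := (indepFun_iff_map_prod_eq_prod_map_map hX.aemeasurable hY.aemeasurable).1
    (hind.indepFun_finset S T hST hV)
  have h1 : {ω | (fun j => V j ω) ∈ W} ⊆ (fun ω => ((fun i : S => V i ω), fun i : T => V i ω)) ⁻¹'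
      {p : (S → ℝ) × (T → ℝ) | glue S T p.1 p.2 ∈ W} := by
    intro ω hω
    exact hdep _ _ (fun j hj => (glue_restrict (v := fun j => V j ω) hj).symm) hω
  refine (measure_mono h1).trans ?_
  rw [← Measure.map_apply (hX.prodMk hY) hA, hXY]
  have : IsProbabilityMeasure (P.map fun ω (i : S) => V i ω) :=
    Measure.isProbabilityMeasure_map hX.aemeasurable
  have : IsProbabilityMeasure (P.map fun ω (i : T) => V i ω) :=
    Measure.isProbabilityMeasure_map hY.aemeasurable
  rw [Measure.prod_apply_symm hA]
  have h2 : ∀ b : T → ℝ, (P.map fun ω (i : S) => V i ω)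
      ((fun a => (a, b)) ⁻¹' {p : (S → ℝ) × (T → ℝ) | glue S T p.1 p.2 ∈ W}) ≤ c := by
    intro b
    rw [Measure.map_apply hX (measurable_prodMk_right hA)]
    exact h b
  refine (lintegral_mono h2).trans ?_
  simp

end Glue

/-! ### Wegner estimates. -/

section Wegner

open Matrix

variable {d : ℕ} {r lam : ℝ} {X : Finset (Fin d → ℤ)}

theorem continuous_block_kern {α : Type*} [TopologicalSpace α] {v : α → (Fin d → ℤ) → ℝ}
    {E : α → ℝ} (hv : Continuous v) (hE : Continuous E) :
    Continuous fun a => block (kern r lam (v a) (E a)) X := by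
  refine continuous_matrix fun i j => ?_
  by_cases h : (i : Fin d → ℤ) = j
  · simp only [block, kern, of_apply, h, if_true]
    fun_prop
  · simp only [block, kern, of_apply, h, if_false]
    fun_prop

theorem block_kern_transpose (v : (Fin d → ℤ) → ℝ) (E : ℝ) :
    (block (kern r lam v E) X)ᵀ = block (kern r lam v E) X := by
  ext i j
  simp only [block, kern, transpose_apply, of_apply]
  rw [hop_comm]
  by_cases h : (i : Fin d → ℤ) = j
  · simp [h]
  · rw [if_neg (fun h' : (j : Fin d → ℤ) = i => h h'.symm), if_neg h]

theorem block_kern_congr {v v' : (Fin d → ℤ) → ℝ} (h : ∀ j ∈ X, v j = v' j) (E : ℝ) :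
    block (kern r lam v E) X = block (kern r lam v' E) X := by
  ext i j
  simp only [block, kern, of_apply]
  rw [h i i.2]

theorem block_kern_eq_sub (v : (Fin d → ℤ) → ℝ) (E : ℝ) :
    block (kern r lam v E) X = block (kern r lam v 0) X - E • (1 : Matrix X X ℝ) := by
  ext i j
  by_cases h : i = j
  · subst h; simp [block, kern]; ring
  · simp [block, kern, h]

theorem block_kern_update {v v' : (Fin d → ℤ) → ℝ} {x : X} (h : ∀ j ∈ X, j ≠ x → v' j = v j)
    (E : ℝ) (u : X → ℝ) : block (kern r lam v' E) X *ᵥ u =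
      block (kern r lam v E) X *ᵥ u + ((v' x - v x) * u x) • Pi.single x 1 := by
  have h1 : block (kern r lam v' E) X =
      block (kern r lam v E) X + diagonal (Pi.single x (v' x - v x)) := by
    ext i j
    by_cases hij : i = j
    · subst hij
      by_cases hix : i = x
      · subst hix; simp [block, kern]; ring
      · have := h i i.2 fun h => hix (Subtype.ext h)
        simp [block, kern, hix, this]
    · simp [block, kern, hij]
  rw [h1, add_mulVec]
  congr 1
  ext i
  rw [mulVec_diagonal]
  by_cases hix : i = x
  · subst hix; simp
  · simp [hix]

variable {Ω : Type*} [MeasurableSpace Ω] {P : Measure Ω} [IsProbabilityMeasure P]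
  {V : (Fin d → ℤ) → Ω → ℝ} {μ : Measure ℝ} {κ ρ t₀ : ℝ}

/-- Freeze every potential value except the one at `x`. By `abs_le_of_nearKernelAt` two admissible
values there differ by at most 2ε|X|, so all lie in an interval of length 4ε|X| centred at any one
of them. -/
theorem measure_nearKernelAt_le (hV : ∀ n, Measurable (V n)) (hlaw : ∀ n, P.map (V n) = μ)
    (hind : iIndepFun V P)
    (hμ : ∀ a b : ℝ, a < b → b - a ≤ t₀ →
      μ (Set.Icc a b) ≤ ENNReal.ofReal (κ⁻¹ * (b - a) ^ ρ))
    {ε : ℝ} (hε : 0 < ε) (ht₀ : 4 * ε * X.card ≤ t₀) (e : ℝ) (x : X) :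
    P {ω | NearKernelAt (block (kern r lam (fun j => V j ω) e) X) ε x} ≤
      ENNReal.ofReal (κ⁻¹ * (4 * ε * X.card) ^ ρ) := by
  have hX : (0 : ℝ) < X.card :=
    Nat.cast_pos.2 (Finset.card_pos.2 ⟨x.1, x.2⟩)
  have hunion : {(x : Fin d → ℤ)} ∪ X.erase x = X := by
    rw [← Finset.insert_eq, Finset.insert_erase x.2]
  refine measure_le_of_section (S := {(x : Fin d → ℤ)}) (T := X.erase x)
    (W := {v | NearKernelAt (block (kern r lam v e) X) ε x}) hV hind ?_
    (isClosed_nearKernelAt (continuous_block_kern continuous_id continuous_const) ε x) ?_ ?_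
  · rw [Finset.disjoint_singleton_left]; exact Finset.notMem_erase _ _
  · intro v v' hvv' hv
    rw [hunion] at hvv'
    rwa [Set.mem_ofPred_eq, ← block_kern_congr hvv']
  · intro b
    simp only [Set.mem_ofPred_eq]
    set g : Ω → (Fin d → ℤ) → ℝ := fun ω =>
      glue {(x : Fin d → ℤ)} (X.erase x) (fun i => V i ω) b with hg
    rcases Set.eq_empty_or_nonempty {ω | NearKernelAt (block (kern r lam (g ω) e) X) ε x} with
      h0 | ⟨ω₀, hω₀⟩
    · rw [h0, measure_empty]; exact zero_le
    · have hgx : ∀ ω, g ω x = V x ω := fun ω => by simp [hg, glue]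
      have hgne : ∀ ω, ∀ j ∈ X, j ≠ x → g ω j = g ω₀ j := fun ω j _ hj => by
        simp [hg, glue, hj]
      set t := 2 * ε * (X.card : ℝ) with ht
      have ht0 : 0 < t := by positivity
      have hsub : {ω | NearKernelAt (block (kern r lam (g ω) e) X) ε x} ⊆
          V x ⁻¹' Set.Icc (V x ω₀ - t) (V x ω₀ + t) := by
        intro ω hω
        have h1 := abs_le_of_nearKernelAt (block_kern_transpose _ _) hε.le
          (block_kern_update (hgne ω) e) hω₀ hω
        rw [hgx, hgx, Fintype.card_coe] at h1
        have h2 := abs_le.1 h1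
        exact ⟨by linarith, by linarith⟩
      refine (measure_mono hsub).trans ?_
      rw [← Measure.map_apply (hV x) measurableSet_Icc, hlaw]
      have h3 : V x ω₀ + t - (V x ω₀ - t) = 4 * ε * X.card := by rw [ht]; ring
      have h4 := hμ (V x ω₀ - t) (V x ω₀ + t) (by linarith) (by rw [h3]; exact ht₀)
      rwa [h3] at h4

/-- Potentials for which `H_X` and `H_Y` both nearly have an eigenvalue at a common energy. -/
def resonantSet (r lam : ℝ) (X Y : Finset (Fin d → ℤ)) (E₀ η ε : ℝ) :
    Set ((Fin d → ℤ) → ℝ) :=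
  {v | ∃ E ∈ Set.Icc (E₀ - η) (E₀ + η), NearKernel (block (kern r lam v E) X) ε ∧
    NearKernel (block (kern r lam v E) Y) ε}

theorem isClosed_resonantSet (X Y : Finset (Fin d → ℤ)) (E₀ η ε : ℝ) :
    IsClosed (resonantSet r lam X Y E₀ η ε) := by
  refine isClosed_exists_mem_compact isCompact_Icc
    (C := {p : ((Fin d → ℤ) → ℝ) × ℝ | NearKernel (block (kern r lam p.1 p.2) X) ε} ∩
      {p : ((Fin d → ℤ) → ℝ) × ℝ | NearKernel (block (kern r lam p.1 p.2) Y) ε}) ?_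
  exact (isClosed_nearKernel (continuous_block_kern continuous_fst continuous_snd) ε).inter
    (isClosed_nearKernel (continuous_block_kern continuous_fst continuous_snd) ε)

theorem dependsOnlyOn_resonantSet (X Y : Finset (Fin d → ℤ)) (E₀ η ε : ℝ) :
    DependsOnlyOn (resonantSet r lam X Y E₀ η ε) (X ∪ Y) := by
  rintro v v' h ⟨E, hE, h1, h2⟩
  refine ⟨E, hE, ?_, ?_⟩
  · rwa [← block_kern_congr fun j hj => h j (Finset.mem_union_left _ hj)]
  · rwa [← block_kern_congr fun j hj => h j (Finset.mem_union_right _ hj)]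

/-- The two-cube Wegner estimate. -/
theorem measure_resonantSet_le (hV : ∀ n, Measurable (V n)) (hlaw : ∀ n, P.map (V n) = μ)
    (hind : iIndepFun V P)
    (hμ : ∀ a b : ℝ, a < b → b - a ≤ t₀ →
      μ (Set.Icc a b) ≤ ENNReal.ofReal (κ⁻¹ * (b - a) ^ ρ))
    {ε : ℝ} (hε : 0 < ε) {Y : Finset (Fin d → ℤ)} (hXY : Disjoint X Y)
    (ht₀ : 8 * ε * X.card ≤ t₀) (E₀ η : ℝ) :
    P {ω | (fun j => V j ω) ∈ resonantSet r lam X Y E₀ η ε} ≤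
      Y.card * (X.card * ENNReal.ofReal (κ⁻¹ * (8 * ε * X.card) ^ ρ)) := by
  refine measure_le_of_section hV hind hXY (isClosed_resonantSet X Y E₀ η ε)
    (dependsOnlyOn_resonantSet X Y E₀ η ε) fun b => ?_
  -- Given the potential on `Y`, the eigenvalues of H_Y are fixed numbers; the filling by 0 on `X`
  -- does not affect them. They replace the common energy, so the bound does not involve η.
  set w : (Fin d → ℤ) → ℝ := glue X Y 0 b with hw
  have hherm : (block (kern r lam w 0) Y).IsHermitian := by
    rw [Matrix.IsHermitian, conjTranspose_eq_transpose_of_trivial, block_kern_transpose]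
  have hsub : {ω | glue X Y (fun i => V i ω) b ∈ resonantSet r lam X Y E₀ η ε} ⊆
      ⋃ i : Y, ⋃ x : X, {ω | NearKernelAt (block (kern r lam (fun j => V j ω)
        (hherm.eigenvalues i)) X) (2 * ε) x} := by
    rintro ω ⟨E, -, h1, h2⟩
    have h3 : block (kern r lam (glue X Y (fun i => V i ω) b) E) Y =
        block (kern r lam w E) Y := by
      refine block_kern_congr (fun j hj => ?_) E
      have hjX : j ∉ X := fun h => Finset.disjoint_left.1 hXY h hj
      simp [hw, glue, hjX]
    rw [h3, block_kern_eq_sub] at h2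
    obtain ⟨i, hi⟩ := exists_eigenvalue_near hherm hε.le h2
    have h4 : block (kern r lam (glue X Y (fun i => V i ω) b) 0) X =
        block (kern r lam (fun j => V j ω) 0) X := by
      refine block_kern_congr (fun j hj => ?_) 0
      simp [glue, hj]
    rw [block_kern_eq_sub, h4] at h1
    obtain ⟨x, hx⟩ := (h1.perturb hε.le hi).exists_at
    rw [← block_kern_eq_sub] at hx
    exact Set.mem_iUnion₂.2 ⟨i, x, hx⟩
  have hone : ∀ (i : Y) (x : X), P {ω | NearKernelAt (block (kern r lam (fun j => V j ω)
      (hherm.eigenvalues i)) X) (2 * ε) x} ≤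
      ENNReal.ofReal (κ⁻¹ * (8 * ε * X.card) ^ ρ) := by
    intro i x
    have h5 : 4 * (2 * ε) * (X.card : ℝ) = 8 * ε * X.card := by ring
    have := measure_nearKernelAt_le (r := r) (lam := lam) (X := X) hV hlaw hind hμ
      (ε := 2 * ε) (by positivity) (by rw [h5]; exact ht₀) (hherm.eigenvalues i) x
    rwa [h5] at this
  calc _ ≤ _ := measure_mono hsub
    _ ≤ ∑ i : Y, P (⋃ x : X, {ω | NearKernelAt (block (kern r lam (fun j => V j ω)
        (hherm.eigenvalues i)) X) (2 * ε) x}) := measure_iUnion_fintype_le _ _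
    _ ≤ ∑ _i : Y, ∑ _x : X, ENNReal.ofReal (κ⁻¹ * (8 * ε * X.card) ^ ρ) :=
        Finset.sum_le_sum fun i _ => (measure_iUnion_fintype_le _ _).trans
          (Finset.sum_le_sum fun x _ => hone i x)
    _ = _ := by simp

end Wegner

/-! ### Events localised in a region, and independence. -/

section LocalBound

variable {d : ℕ} {Ω : Type*} [MeasurableSpace Ω]

/-- The σ-algebra generated by the potential on `S`. -/
abbrev coordAlgebra (V : (Fin d → ℤ) → Ω → ℝ) (S : Set (Fin d → ℤ)) : MeasurableSpace Ω :=
  ⨆ j ∈ S, MeasurableSpace.comap (V j) inferInstance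

/-- `A` is contained in an event of probability at most `c` that depends only on the potential
on `S`. -/
def LocalBound (V : (Fin d → ℤ) → Ω → ℝ) (P : Measure Ω) (S : Set (Fin d → ℤ)) (A : Set Ω)
    (c : ENNReal) : Prop :=
  ∃ C, MeasurableSet[coordAlgebra V S] C ∧ A ⊆ C ∧ P C ≤ c

variable {V : (Fin d → ℤ) → Ω → ℝ} {P : Measure Ω} {S T : Set (Fin d → ℤ)} {A B : Set Ω}
  {a b : ENNReal}

theorem coordAlgebra_mono {Ω : Type*} {V : (Fin d → ℤ) → Ω → ℝ} (h : S ⊆ T) : coordAlgebra V S ≤ coordAlgebra V T :=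
  biSup_mono h

theorem LocalBound.measure_le (h : LocalBound V P S A a) : P A ≤ a := by
  obtain ⟨C, -, hAC, hC⟩ := h
  exact (measure_mono hAC).trans hC

theorem LocalBound.mono (h : LocalBound V P S A a) (hST : S ⊆ T) (hBA : B ⊆ A) (hab : a ≤ b) :
    LocalBound V P T B b := by
  obtain ⟨C, hCm, hAC, hC⟩ := h
  exact ⟨C, coordAlgebra_mono hST _ hCm, hBA.trans hAC, hC.trans hab⟩

theorem localBound_empty : LocalBound V P S ∅ a :=
  ⟨∅, @MeasurableSet.empty _ (coordAlgebra V S), le_rfl, by simp⟩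

theorem LocalBound.union (hA : LocalBound V P S A a) (hB : LocalBound V P S B b) :
    LocalBound V P S (A ∪ B) (a + b) := by
  obtain ⟨C, hCm, hAC, hC⟩ := hA
  obtain ⟨D, hDm, hBD, hD⟩ := hB
  exact ⟨C ∪ D, @MeasurableSet.union _ (coordAlgebra V S) _ _ hCm hDm, Set.union_subset_union hAC hBD,
    (measure_union_le _ _).trans (add_le_add hC hD)⟩

theorem LocalBound.iUnion {ι : Type*} [Fintype ι] {A : ι → Set Ω}
    (h : ∀ i, LocalBound V P S (A i) a) :
    LocalBound V P S (⋃ i, A i) (Fintype.card ι * a) := by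
  choose C hCm hAC hC using h
  refine ⟨⋃ i, C i, @MeasurableSet.iUnion _ _ (coordAlgebra V S) _ _ hCm,
    Set.iUnion_mono hAC, (measure_iUnion_fintype_le _ _).trans ?_⟩
  refine (Finset.sum_le_sum fun i _ => hC i).trans ?_
  simp

/-- Independence is applied to the enclosing events, so `A` and `B` need not be measurable. -/
theorem LocalBound.inter (hV : ∀ n, Measurable (V n)) (hind : iIndepFun V P)
    (hST : Disjoint S T) (hA : LocalBound V P S A a) (hB : LocalBound V P T B b) :
    LocalBound V P (S ∪ T) (A ∩ B) (a * b) := by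
  obtain ⟨C, hCm, hAC, hC⟩ := hA
  obtain ⟨D, hDm, hBD, hD⟩ := hB
  refine ⟨C ∩ D, @MeasurableSet.inter _ (coordAlgebra V (S ∪ T)) _ _
    (coordAlgebra_mono Set.subset_union_left _ hCm)
    (coordAlgebra_mono Set.subset_union_right _ hDm), Set.inter_subset_inter hAC hBD, ?_⟩
  have h1 := indep_iSup_of_disjoint (m := fun j => MeasurableSpace.comap (V j) inferInstance)
    (fun j => (hV j).comap_le) hind hST
  rw [(Indep_iff _ _ _).1 h1 C D hCm hDm]
  exact mul_le_mul' hC hD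

theorem LocalBound.iInter [IsProbabilityMeasure P] (hV : ∀ n, Measurable (V n))
    (hind : iIndepFun V P) {h : ℕ}
    {S : Fin h → Set (Fin d → ℤ)} (hS : Pairwise fun i j => Disjoint (S i) (S j))
    {A : Fin h → Set Ω} (hA : ∀ i, LocalBound V P (S i) (A i) a) :
    LocalBound V P (⋃ i, S i) (⋂ i, A i) (a ^ h) := by
  induction h with
  | zero =>
    refine ⟨Set.univ, @MeasurableSet.univ _ (coordAlgebra V _), Set.subset_univ _, ?_⟩
    simp
  | succ h ih =>
    have h1 := ih (S := fun i => S i.succ) (A := fun i => A i.succ)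
      (fun i j hij => hS fun h => hij (Fin.succ_injective _ h)) (fun i => hA i.succ)
    have h2 : Disjoint (S 0) (⋃ i : Fin h, S i.succ) :=
      Set.disjoint_iUnion_right.2 fun i => hS (Fin.succ_ne_zero i).symm
    refine ((hA 0).inter hV hind h2 h1).mono ?_ ?_ ?_
    · exact Set.union_subset (Set.subset_iUnion S 0)
        (Set.iUnion_subset fun i => Set.subset_iUnion S i.succ)
    · exact Set.subset_inter (Set.iInter_subset A 0)
        (Set.subset_iInter fun i => Set.iInter_subset A i.succ)
    · rw [pow_succ, mul_comm]

/-- Such an event is its own enclosing event: it is the preimage of a closed set of configurations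
on `S`. -/
theorem localBound_of_isClosed (S : Finset (Fin d → ℤ)) {W : Set ((Fin d → ℤ) → ℝ)}
    (hW : IsClosed W) (hdep : DependsOnlyOn W S) (h : P {ω | (fun j => V j ω) ∈ W} ≤ a) :
    LocalBound V P S {ω | (fun j => V j ω) ∈ W} a := by
  refine ⟨_, ?_, le_rfl, h⟩
  have h1 : {ω | (fun j => V j ω) ∈ W} =
      (fun ω (i : S) => V i ω) ⁻¹' {b | glue S ∅ b (fun _ => 0) ∈ W} := by
    ext ω
    have hg : ∀ j ∈ S, glue S ∅ (fun i : S => V i ω) (fun _ => 0) j = V j ω := fun j hj => by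
      simp [glue, hj]
    exact ⟨hdep _ _ fun j hj => (hg j hj).symm, hdep _ _ hg⟩
  rw [h1]
  have h2 : IsClosed {b : S → ℝ | glue S ∅ b (fun _ => 0) ∈ W} :=
    hW.preimage (continuous_glue.comp (by fun_prop : Continuous fun b : S → ℝ =>
      (b, fun _ : (∅ : Finset (Fin d → ℤ)) => (0 : ℝ))))
  have h3 : @Measurable _ _ (coordAlgebra V S) _ (fun ω (i : S) => V i ω) := by
    refine @measurable_pi_lambda _ _ _ (coordAlgebra V S) _ _ fun i => ?_
    have h4 : MeasurableSpace.comap (V i) inferInstance ≤ coordAlgebra V S :=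
      le_iSup₂_of_le (i : Fin d → ℤ) i.2 le_rfl
    exact (comap_measurable (V i)).mono h4 le_rfl
  exact h3 h2.measurableSet

end LocalBound

/-! ### The probabilistic induction step. -/

theorem disjoint_cube {d : ℕ} {l : ℕ} {c c' : Fin d → ℤ} (h : 2 * (l : ℝ) < ‖c - c'‖) :
    Disjoint (cube l c) (cube l c') := by
  rw [Finset.disjoint_left]
  intro k hk hk'
  rw [mem_cube] at hk hk'
  have := norm_sub_le (k - c') (k - c)
  rw [sub_sub_sub_cancel_left] at this
  linarith

theorem natCast_card_cube {d : ℕ} (L : ℕ) (n : Fin d → ℤ) :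
    ((cube L n).card : ENNReal) = ENNReal.ofReal ((2 * L + 1) ^ d) := by
  rw [← card_cube L n, ENNReal.ofReal_natCast]

/-- Potentials for which, at some energy in `I`, there are `J` separated bad small cubes in
`Λ_L(n)`. -/
def crowdedSet {d : ℕ} (l L J : ℕ) (I : Set ℝ)
    (bad : ((Fin d → ℤ) → ℝ) → ℝ → (Fin d → ℤ) → Prop) (n : Fin d → ℤ) :
    Set ((Fin d → ℤ) → ℝ) :=
  {v | ∃ E ∈ I, ∃ T ⊆ cube L n, (∀ c ∈ T, cube l c ⊆ cube L n ∧ bad v E c) ∧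
    (T : Set (Fin d → ℤ)).Pairwise (fun c c' => 2 * (l : ℝ) < ‖c - c'‖) ∧ J ≤ T.card}

/-- The 2h separated centres are grouped into h pairs. Letting each pair choose its own energy
enlarges the event but splits it into h events in disjoint regions, each of cost `a`; the prefactor
counts the choices of centres. -/
theorem localBound_crowdedSet {d : ℕ} {Ω : Type*} [MeasurableSpace Ω] {P : Measure Ω}
    [IsProbabilityMeasure P] {V : (Fin d → ℤ) → Ω → ℝ} (hV : ∀ n, Measurable (V n))
    (hind : iIndepFun V P) {I : Set ℝ} {l L h : ℕ}
    {bad : ((Fin d → ℤ) → ℝ) → ℝ → (Fin d → ℤ) → Prop} {a : ENNReal}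
    (hsmall : ∀ m n : Fin d → ℤ, 2 * (l : ℝ) < ‖m - n‖ → LocalBound V P (cube l m ∪ cube l n)
      {ω | ∃ E ∈ I, bad (fun j => V j ω) E m ∧ bad (fun j => V j ω) E n} a) (n : Fin d → ℤ) :
    LocalBound V P (cube L n) {ω | (fun j => V j ω) ∈ crowdedSet l L (2 * h) I bad n}
      (ENNReal.ofReal ((2 * L + 1) ^ d) ^ (2 * h) * a ^ h) := by
  classical
  have h1 : ∀ c : Fin h × Fin 2 → cube L n, LocalBound V P (cube L n)
      {ω | (∀ i, cube l (c i).1 ⊆ cube L n) ∧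
        (∀ i j, i ≠ j → 2 * (l : ℝ) < ‖(c i).1 - (c j).1‖) ∧
        ∀ k, ∃ E ∈ I, bad (fun j => V j ω) E (c (k, 0)) ∧ bad (fun j => V j ω) E (c (k, 1))}
      (a ^ h) := by
    intro c
    by_cases hc : (∀ i, cube l (c i).1 ⊆ cube L n) ∧
        (∀ i j, i ≠ j → 2 * (l : ℝ) < ‖(c i).1 - (c j).1‖)
    · obtain ⟨hc1, hc2⟩ := hc
      have h2 := LocalBound.iInter (P := P) hV hind
        (S := fun k => ((cube l (c (k, 0)).1 : Set (Fin d → ℤ)) ∪ cube l (c (k, 1)).1))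
        (fun k k' hkk' => by
          have h3 : ∀ s s', Disjoint (cube l (c (k, s)).1 : Set (Fin d → ℤ))
              (cube l (c (k', s')).1) := fun s s' =>
            Finset.disjoint_coe.2 (disjoint_cube (hc2 _ _ fun h =>
              hkk' (congrArg Prod.fst h)))
          simp [Set.disjoint_union_left, Set.disjoint_union_right, h3])
        (fun k => hsmall (c (k, 0)) (c (k, 1)) (hc2 _ _ (by simp)))
      refine h2.mono ?_ ?_ le_rfl
      · exact Set.iUnion_subset fun k => Set.union_subset
          (Finset.coe_subset.2 (hc1 _)) (Finset.coe_subset.2 (hc1 _))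
      · rintro ω ⟨-, -, hω⟩
        exact Set.mem_iInter.2 hω
    · refine (localBound_empty).mono le_rfl ?_ le_rfl
      rintro ω ⟨hω1, hω2, -⟩
      exact hc ⟨hω1, hω2⟩
  refine (LocalBound.iUnion h1).mono le_rfl ?_ ?_
  · rintro ω ⟨E, hE, T, hTn, hTb, hTp, hTh⟩
    obtain ⟨e⟩ := Function.Embedding.nonempty_of_card_le (α := Fin h × Fin 2) (β := T)
      (by simpa [mul_comm] using hTh)
    refine Set.mem_iUnion.2 ⟨fun i => ⟨(e i).1, hTn (e i).2⟩, fun i => (hTb _ (e i).2).1,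
      fun i j hij => hTp (e i).2 (e j).2 fun h => hij (e.injective (Subtype.ext h)),
      fun k => ⟨E, hE, (hTb _ (e (k, 0)).2).2, (hTb _ (e (k, 1)).2).2⟩⟩
  · rw [Fintype.card_fun, Fintype.card_coe, Fintype.card_prod, Fintype.card_fin,
      Fintype.card_fin, Nat.cast_pow, natCast_card_cube, mul_comm h 2]

/-- The probabilistic induction step of the multi-scale analysis. -/
theorem localBound_step {d : ℕ} {Ω : Type*} [MeasurableSpace Ω] {P : Measure Ω}
    [IsProbabilityMeasure P] {V : (Fin d → ℤ) → Ω → ℝ} (hV : ∀ n, Measurable (V n))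
    (hind : iIndepFun V P) {μ : Measure ℝ} (hlaw : ∀ n, P.map (V n) = μ) {κ ρ t₀ : ℝ}
    (hμ : ∀ a b : ℝ, a < b → b - a ≤ t₀ →
      μ (Set.Icc a b) ≤ ENNReal.ofReal (κ⁻¹ * (b - a) ^ ρ))
    {r lam E₀ η ε : ℝ} {l L h : ℕ} (hε : 0 < ε) (ht₀ : 8 * ε * (2 * L + 1) ^ d ≤ t₀)
    {bad bad' : ((Fin d → ℤ) → ℝ) → ℝ → (Fin d → ℤ) → Prop}
    (hdet : ∀ v E n, ¬ NearKernel (block (kern r lam v E) (cube L n)) ε →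
      (∀ T ⊆ cube L n, (∀ c ∈ T, cube l c ⊆ cube L n ∧ bad v E c) →
        (T : Set (Fin d → ℤ)).Pairwise (fun c c' => 2 * (l : ℝ) < ‖c - c'‖) →
        T.card < 2 * h) → ¬ bad' v E n) {a : ENNReal}
    (hsmall : ∀ m n : Fin d → ℤ, 2 * (l : ℝ) < ‖m - n‖ → LocalBound V P (cube l m ∪ cube l n)
      {ω | ∃ E ∈ Set.Icc (E₀ - η) (E₀ + η), bad (fun j => V j ω) E m ∧ bad (fun j => V j ω) E n} a)
    {m n : Fin d → ℤ} (hmn : 2 * (L : ℝ) < ‖m - n‖) :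
    LocalBound V P (cube L m ∪ cube L n)
      {ω | ∃ E ∈ Set.Icc (E₀ - η) (E₀ + η), bad' (fun j => V j ω) E m ∧
        bad' (fun j => V j ω) E n}
      (2 * (ENNReal.ofReal ((2 * L + 1) ^ d) ^ (2 * h) * a ^ h) +
        ENNReal.ofReal ((2 * L + 1) ^ d) * (ENNReal.ofReal ((2 * L + 1) ^ d) *
          ENNReal.ofReal (κ⁻¹ * (8 * ε * (2 * L + 1) ^ d) ^ ρ))) := by
  have hres : LocalBound V P (cube L m ∪ cube L n)
      {ω | (fun j => V j ω) ∈ resonantSet r lam (cube L m) (cube L n) E₀ η ε}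
      (ENNReal.ofReal ((2 * L + 1) ^ d) * (ENNReal.ofReal ((2 * L + 1) ^ d) *
          ENNReal.ofReal (κ⁻¹ * (8 * ε * (2 * L + 1) ^ d) ^ ρ))) := by
    have h1 := measure_resonantSet_le (r := r) (lam := lam) hV hlaw hind hμ hε
      (disjoint_cube hmn) (by rw [card_cube]; exact ht₀) E₀ η
    rw [natCast_card_cube, natCast_card_cube, card_cube] at h1
    have h2 := localBound_of_isClosed _ (isClosed_resonantSet _ _ _ _ _)
      (dependsOnlyOn_resonantSet _ _ _ _ _) h1
    rwa [Finset.coe_union] at h2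
  have hsp := localBound_crowdedSet (L := L) (h := h) hV hind hsmall
  have hm := (hsp m).mono (T := (cube L m : Set (Fin d → ℤ)) ∪ cube L n) Set.subset_union_left
    Set.Subset.rfl le_rfl
  have hn := (hsp n).mono (T := (cube L m : Set (Fin d → ℤ)) ∪ cube L n) Set.subset_union_right
    Set.Subset.rfl le_rfl
  refine ((hm.union hn).union hres).mono Set.Subset.rfl ?_ (add_le_add (two_mul _).ge le_rfl)
  rintro ω ⟨E, hE, hm, hn⟩
  have hkey : ∀ z, bad' (fun j => V j ω) E z →
      (fun j => V j ω) ∈ crowdedSet l L (2 * h) (Set.Icc (E₀ - η) (E₀ + η)) bad z ∨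
      NearKernel (block (kern r lam (fun j => V j ω) E) (cube L z)) ε := by
    intro z hbz
    by_contra! hcon
    refine hdet _ E z hcon.2 (fun T hT hTb hTp => ?_) hbz
    by_contra hTh
    exact hcon.1 ⟨E, hE, T, hT, hTb, hTp, not_lt.1 hTh⟩
  -- Unless one of the two cubes is crowded, both are resonant, and at the same energy `E`.
  rcases hkey m hm with h1 | h1
  · exact Or.inl (Or.inl h1)
  · rcases hkey n hn with h2 | h2
    · exact Or.inl (Or.inr h2)
    · exact Or.inr ⟨E, hE, h1, h2⟩

/-! ### Exponent bookkeeping for large scales. -/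

section Asymptotics

open Filter

theorem eventually_mul_rpow_le {C c ε : ℝ} (hc : c < 0) (hε : 0 < ε) :
    ∀ᶠ x : ℝ in atTop, C * x ^ c ≤ ε := by
  have h1 := (tendsto_rpow_neg_atTop (neg_pos.2 hc)).const_mul C
  rw [neg_neg, mul_zero] at h1
  exact (h1.eventually (gt_mem_nhds hε)).mono fun x hx => le_of_lt hx

theorem eventually_mul_rpow_le_rpow {C a b : ℝ} (h : a < b) :
    ∀ᶠ x : ℝ in atTop, C * x ^ a ≤ x ^ b := by
  filter_upwards [eventually_mul_rpow_le (C := C) (sub_neg.2 h) one_pos, eventually_gt_atTop 0]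
    with x hx hx0
  calc C * x ^ a = C * x ^ (a - b) * x ^ b := by
        rw [mul_assoc, ← Real.rpow_add hx0]; ring_nf
    _ ≤ 1 * x ^ b := by gcongr
    _ = _ := one_mul _

theorem sqrt_mul_pow_le {A B y z : ℝ} (hA : 0 ≤ A) (hB : 0 ≤ B) (hy : 0 ≤ y) (hz : 0 ≤ z)
    (hzy : z ≤ B * y) (d : ℕ) :
    Real.sqrt (A * z ^ d) ≤ Real.sqrt (A * B ^ d) * y ^ ((d : ℝ) / 2) := by
  have h1 : y ^ ((d : ℝ) / 2) = Real.sqrt (y ^ d) := by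
    rw [Real.sqrt_eq_rpow, ← Real.rpow_natCast, ← Real.rpow_mul hy]
    ring_nf
  rw [h1, ← Real.sqrt_mul (by positivity), mul_assoc, ← mul_pow]
  gcongr

/-- Contraction at good sites: the gain l^{-q} against the row sums of a good cube. The first
parameter inequality supplies the hypothesis. -/
theorem eventually_row_small {C C₀ q a : ℝ} {d : ℕ} (hC : 0 ≤ C) (hC₀ : 0 < C₀)
    (h : (d : ℝ) / 2 + a < q) :
    ∀ᶠ x : ℝ in atTop, C * x ^ (-q) * (Real.sqrt ((2 * x + 1) ^ d / C₀) * x ^ a) ≤ 1 / 2 := by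
  filter_upwards [eventually_mul_rpow_le (C := C * Real.sqrt (C₀⁻¹ * 3 ^ d))
    (sub_neg.2 h) (by norm_num : (0 : ℝ) < 1 / 2), eventually_ge_atTop 1] with x hx hx1
  have hx0 : 0 < x := by linarith
  have h1 := sqrt_mul_pow_le (A := C₀⁻¹) (by positivity) (by norm_num : (0 : ℝ) ≤ 3) hx0.le
    (by linarith : 0 ≤ 2 * x + 1) (by linarith) d
  rw [div_eq_mul_inv, mul_comm _ C₀⁻¹]
  calc _ ≤ C * x ^ (-q) * (Real.sqrt (C₀⁻¹ * 3 ^ d) * x ^ ((d : ℝ) / 2) * x ^ a) := by gcongr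
    _ = C * Real.sqrt (C₀⁻¹ * 3 ^ d) * (x ^ (-q) * (x ^ ((d : ℝ) / 2) * x ^ a)) := by ring
    _ = C * Real.sqrt (C₀⁻¹ * 3 ^ d) * x ^ ((d : ℝ) / 2 + a - q) := by
        rw [← Real.rpow_add hx0, ← Real.rpow_add hx0]; ring_nf
    _ ≤ _ := hx

/-- Contraction at bad sites: the gain Y^{-q} against the a priori bound x^a and the volume of a
ball of radius of order x^{1+ξ}. The second parameter inequality supplies the hypothesis. -/
theorem eventually_cutoff_small {C C' J a ξ q : ℝ} {d : ℕ} (hC : 0 ≤ C) (hC' : 0 ≤ C')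
    (hJ : 0 ≤ J) (hξ : 0 ≤ ξ) (h : a + (1 + ξ) * d < ξ * q) :
    ∀ᶠ x : ℝ in atTop, x ^ a * (2 * (6 * J * (x * x ^ ξ)) + 1) ^ d *
      (C * (x ^ ξ) ^ (-q) * C') ≤ 1 / 2 := by
  filter_upwards [eventually_mul_rpow_le (C := (12 * J + 1) ^ d * C * C')
    (sub_neg.2 h) (by norm_num : (0 : ℝ) < 1 / 2), eventually_ge_atTop 1] with x hx hx1
  have hx0 : 0 < x := by linarith
  have h1 : x * x ^ ξ = x ^ (1 + ξ) := by rw [Real.rpow_add hx0, Real.rpow_one]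
  have h2 : 1 ≤ x ^ (1 + ξ) := Real.one_le_rpow hx1 (by linarith)
  have h3 : (2 * (6 * J * (x * x ^ ξ)) + 1) ^ d ≤ (12 * J + 1) ^ d * x ^ ((1 + ξ) * d) := by
    rw [Real.rpow_mul hx0.le, Real.rpow_natCast, ← mul_pow, h1]
    refine pow_le_pow_left₀ (by positivity) ?_ d
    nlinarith
  calc _ ≤ x ^ a * ((12 * J + 1) ^ d * x ^ ((1 + ξ) * d)) * (C * (x ^ ξ) ^ (-q) * C') := by gcongr
    _ = (12 * J + 1) ^ d * C * C' * (x ^ a * x ^ ((1 + ξ) * d) * x ^ (ξ * -q)) := by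
        rw [Real.rpow_mul hx0.le ξ]; ring
    _ = (12 * J + 1) ^ d * C * C' * x ^ (a + (1 + ξ) * d - ξ * q) := by
        rw [← Real.rpow_add hx0, ← Real.rpow_add hx0]; ring_nf
    _ ≤ _ := hx

/-- The s-dependent part x^{(1+ξ)s} fits into L^{δs} because 1 + ξ ≤ αδ. All other powers are
independent of s and fit into L^{τ'} by the third parameter inequality. -/
theorem eventually_sobolev_bound {C₀ c₁ c₂ s₀ r₁ α τ τ' ξ δ : ℝ} {d : ℕ} (hC₀ : 0 < C₀)
    (hc₁ : 0 ≤ c₁) (hc₂ : 0 ≤ c₂) (hs₀ : (d : ℝ) / 2 < s₀) (hα : 1 < α) (hτ : 0 < τ)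
    (hτ' : 0 < τ') (hξ : 0 < ξ) (hδ : 0 < δ) (hδ1 : δ < 1)
    (h3 : α⁻¹ * (2 * τ' + 2 * α * τ + (5 + 4 * ξ + 2 * δ) * s₀) + s₀ < τ')
    (hαδ : (1 + ξ) / α ≤ δ) :
    ∀ᶠ x : ℝ in atTop, ∀ L : ℝ, x ^ α / 2 ≤ L → L ≤ x ^ α → ∀ s ∈ Set.Icc s₀ r₁,
      Real.sqrt (C₀ * (4 * L + 1) ^ d) * (2 * (c₁ * (Real.sqrt ((2 * x + 1) ^ d / C₀) *
        x ^ (τ' + δ * s₀)) + c₂ * x ^ (α * τ)) * (x * x ^ ξ) ^ s) ≤ L ^ (τ' + δ * s) := by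
  have hα0 : 0 < α := by linarith
  have hd : (0 : ℝ) ≤ (d : ℝ) / 2 := by positivity
  have hs₀0 : 0 < s₀ := by linarith
  -- A generous common exponent for both summands, chosen to match the third parameter inequality.
  set m := 2 * τ' + 2 * α * τ + (5 + 4 * ξ + 2 * δ) * s₀ with hm
  have hm1 : (d : ℝ) / 2 + (τ' + δ * s₀) ≤ m := by
    have : 0 < α * τ := by positivity
    have : 0 < ξ * s₀ := by positivity
    have : 0 < δ * s₀ := by positivity
    nlinarith
  have hm2 : α * τ ≤ m := by
    have : 0 < α * τ := by positivity
    have : 0 < (5 + 4 * ξ + 2 * δ) * s₀ := by positivity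
    nlinarith
  have hexp : α * (d / 2) + m < α * τ' := by
    have h4 : m + α * s₀ < α * τ' := by
      have := mul_lt_mul_of_pos_left h3 hα0
      rwa [mul_add, mul_inv_cancel_left₀ hα0.ne'] at this
    nlinarith
  set A := Real.sqrt (C₀ * 5 ^ d) with hA
  set B := Real.sqrt (C₀⁻¹ * 3 ^ d) with hB
  have hA0 : 0 ≤ A := Real.sqrt_nonneg _
  have hB0 : 0 ≤ B := Real.sqrt_nonneg _
  filter_upwards [eventually_mul_rpow_le_rpow (C := A * (2 * (c₁ * B + c₂)) * 2 ^ (τ' + r₁)) hexp,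
    eventually_ge_atTop 1] with x hx hx1 L hL1 hL2 s hs
  have hx0 : 0 < x := by linarith
  have hxα : 1 ≤ x ^ α := Real.one_le_rpow hx1 hα0.le
  have hL0 : 0 < L := by linarith
  have hs0 : 0 < s := hs₀0.trans_le hs.1
  have e1 := sqrt_mul_pow_le (A := C₀) hC₀.le (by norm_num : (0 : ℝ) ≤ 5)
    (by positivity : 0 ≤ x ^ α) (by linarith : 0 ≤ 4 * L + 1) (by linarith) d
  rw [← Real.rpow_mul hx0.le] at e1
  have e2 := sqrt_mul_pow_le (A := C₀⁻¹) (by positivity) (by norm_num : (0 : ℝ) ≤ 3) hx0.le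
    (by linarith : 0 ≤ 2 * x + 1) (by linarith) d
  rw [mul_comm, ← div_eq_mul_inv] at e2
  have e3 : Real.sqrt ((2 * x + 1) ^ d / C₀) * x ^ (τ' + δ * s₀) ≤ B * x ^ m := by
    calc _ ≤ B * x ^ ((d : ℝ) / 2) * x ^ (τ' + δ * s₀) := by gcongr
      _ = B * x ^ ((d : ℝ) / 2 + (τ' + δ * s₀)) := by rw [mul_assoc, ← Real.rpow_add hx0]
      _ ≤ _ := by
        gcongr
  have e4 : x ^ (α * τ) ≤ x ^ m := Real.rpow_le_rpow_of_exponent_le hx1 hm2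
  have e5 : (x * x ^ ξ) ^ s ≤ x ^ (α * (δ * s)) := by
    have h5 : x * x ^ ξ = x ^ (1 + ξ) := by rw [Real.rpow_add hx0, Real.rpow_one]
    rw [h5, ← Real.rpow_mul hx0.le]
    refine Real.rpow_le_rpow_of_exponent_le hx1 ?_
    have h6 := (div_le_iff₀ hα0).1 hαδ
    nlinarith
  -- The factor 2^{τ'+r₁} pays for L ≥ x^α/2, the loss from the integer part, uniformly in s ≤ r₁.
  have e6 : x ^ (α * τ') * x ^ (α * (δ * s)) ≤ 2 ^ (τ' + r₁) * L ^ (τ' + δ * s) := by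
    have h7 : 0 ≤ τ' + δ * s := by positivity
    calc x ^ (α * τ') * x ^ (α * (δ * s)) = (2 * (x ^ α / 2)) ^ (τ' + δ * s) := by
          rw [mul_div_cancel₀ _ (by norm_num : (2 : ℝ) ≠ 0), ← Real.rpow_mul hx0.le, mul_add,
            Real.rpow_add hx0]
      _ = 2 ^ (τ' + δ * s) * (x ^ α / 2) ^ (τ' + δ * s) :=
          Real.mul_rpow (by norm_num) (by positivity)
      _ ≤ 2 ^ (τ' + r₁) * L ^ (τ' + δ * s) := by
          gcongr
          · norm_num
          · nlinarith [hs.2]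
  have h2p : (0 : ℝ) < 2 ^ (τ' + r₁) := by positivity
  refine le_of_mul_le_mul_left (le_trans ?_ e6) h2p
  calc _ ≤ 2 ^ (τ' + r₁) * ((A * x ^ (α * (d / 2))) *
        (2 * (c₁ * (B * x ^ m) + c₂ * x ^ m) * x ^ (α * (δ * s)))) := by gcongr
    _ = A * (2 * (c₁ * B + c₂)) * 2 ^ (τ' + r₁) * (x ^ (α * (d / 2)) * x ^ m) *
        x ^ (α * (δ * s)) := by ring
    _ ≤ _ := by
        rw [← Real.rpow_add hx0]
        gcongr

theorem cast_volume_le {L : ℝ} (hL : 1 ≤ L) (d : ℕ) :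
    (2 * L + 1) ^ d ≤ 3 ^ d * L ^ (d : ℝ) := by
  rw [Real.rpow_natCast, ← mul_pow]
  exact pow_le_pow_left₀ (by linarith) (by linarith) d

/-- The lower bound on τ says exactly 2d + ρ(d - τ) < -2p. Half of the target is left for crowding.
-/
theorem eventually_wegner_small {κ ρ p τ t₀ : ℝ} {d : ℕ} (hκ : 0 < κ) (hρ : 0 < ρ) (hp : 0 < p)
    (hτ : (2 * p + (2 + ρ) * d) / ρ < τ) (ht₀ : 0 < t₀) :
    ∀ᶠ L : ℝ in atTop, 8 * L ^ (-τ) * (2 * L + 1) ^ d ≤ t₀ ∧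
      (2 * L + 1) ^ d * ((2 * L + 1) ^ d * (κ⁻¹ * (8 * L ^ (-τ) * (2 * L + 1) ^ d) ^ ρ)) ≤
        1 / 2 * L ^ (-(2 * p)) := by
  have hτ' := (div_lt_iff₀ hρ).1 hτ
  have hd : (0 : ℝ) ≤ d := Nat.cast_nonneg d
  have h1 : (d : ℝ) - τ < 0 := by nlinarith
  have h2 : (2 + ρ) * d - ρ * τ < -(2 * p) := by nlinarith
  filter_upwards [eventually_mul_rpow_le (C := 8 * 3 ^ d) h1 ht₀,
    eventually_mul_rpow_le_rpow (C := 2 * ((3 ^ d) * ((3 ^ d) * (κ⁻¹ * (8 * 3 ^ d) ^ ρ)))) h2,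
    eventually_ge_atTop 1] with L hL1 hL2 hL
  have hL0 : 0 < L := by linarith
  have hv := cast_volume_le hL d
  have h3 : 8 * L ^ (-τ) * (2 * L + 1) ^ d ≤ 8 * 3 ^ d * L ^ ((d : ℝ) - τ) := by
    calc _ ≤ 8 * L ^ (-τ) * (3 ^ d * L ^ (d : ℝ)) := by gcongr
      _ = 8 * 3 ^ d * (L ^ (d : ℝ) * L ^ (-τ)) := by ring
      _ = _ := by rw [← Real.rpow_add hL0, sub_eq_add_neg]
  refine ⟨h3.trans hL1, ?_⟩
  calc _ ≤ (3 ^ d * L ^ (d : ℝ)) * ((3 ^ d * L ^ (d : ℝ)) *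
        (κ⁻¹ * (8 * 3 ^ d * L ^ ((d : ℝ) - τ)) ^ ρ)) := by gcongr
    _ = (3 ^ d) * ((3 ^ d) * (κ⁻¹ * (8 * 3 ^ d) ^ ρ)) *
        (L ^ (d : ℝ) * L ^ (d : ℝ) * L ^ (((d : ℝ) - τ) * ρ)) := by
        rw [Real.mul_rpow (by positivity) (by positivity), ← Real.rpow_mul hL0.le]; ring
    _ = 1 / 2 * (2 * ((3 ^ d) * ((3 ^ d) * (κ⁻¹ * (8 * 3 ^ d) ^ ρ))) *
        L ^ ((2 + ρ) * d - ρ * τ)) := by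
        rw [← Real.rpow_add hL0, ← Real.rpow_add hL0]; ring_nf
    _ ≤ _ := by gcongr

/-- With J = 2h, the condition is αdJ - pJ < -2αp: choices of centres times h pair probabilities
against L^{-2p}. -/
theorem eventually_crowded_small {α p : ℝ} {d h : ℕ} (hp : 0 < p) (hh : 0 < h)
    (hJ : α * d + 2 * α * p / (2 * h : ℕ) < p) :
    ∀ᶠ x : ℝ in atTop, ∀ L : ℝ, 1 ≤ L → L ≤ x ^ α →
      2 * (((2 * L + 1) ^ d) ^ (2 * h) * (x ^ (-(2 * p))) ^ h) ≤ 1 / 2 * L ^ (-(2 * p)) := by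
  have hh' : (0 : ℝ) < h := by exact_mod_cast hh
  have h1 : α * d * (2 * h) - 2 * p * h < -(2 * p * α) := by
    push_cast at hJ
    have h2 : α * d * (2 * h) + 2 * α * p < p * (2 * h) := by
      have := mul_lt_mul_of_pos_right hJ (by positivity : (0 : ℝ) < 2 * h)
      rwa [add_mul, div_mul_cancel₀ _ (by positivity)] at this
    linarith
  filter_upwards [eventually_mul_rpow_le_rpow (C := 4 * (3 ^ d) ^ (2 * h)) h1,
    eventually_ge_atTop 1] with x hx hx1 L hL1 hL2
  have hx0 : 0 < x := by linarith
  have h2 : (2 * L + 1) ^ d ≤ 3 ^ d * x ^ (α * d) := by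
    refine (cast_volume_le hL1 d).trans ?_
    rw [Real.rpow_mul hx0.le]
    gcongr
  have h3 : x ^ (-(2 * p * α)) ≤ L ^ (-(2 * p)) := by
    rw [show -(2 * p * α) = α * (-(2 * p)) by ring, Real.rpow_mul hx0.le]
    exact Real.rpow_le_rpow_of_nonpos (by linarith) hL2 (by linarith)
  calc _ ≤ 2 * ((3 ^ d * x ^ (α * d)) ^ (2 * h) * (x ^ (-(2 * p))) ^ h) := by gcongr
    _ = 1 / 2 * (4 * (3 ^ d) ^ (2 * h) * x ^ (α * d * (2 * h) - 2 * p * h)) := by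
        rw [mul_pow, ← Real.rpow_natCast (x ^ (α * d)), ← Real.rpow_natCast (x ^ (-(2 * p))),
          ← Real.rpow_mul hx0.le, ← Real.rpow_mul hx0.le, sub_eq_add_neg, Real.rpow_add hx0]
        push_cast
        ring_nf
    _ ≤ 1 / 2 * L ^ (-(2 * p)) := by
        gcongr
        exact hx.trans h3

theorem half_rpow_le_floor {α : ℝ} (hα : 0 ≤ α) {x : ℝ} (hx : 1 ≤ x) :
    x ^ α / 2 ≤ ⌊x ^ α⌋₊ := by
  have h1 : 1 ≤ x ^ α := Real.one_le_rpow hx hα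
  have h2 := Nat.lt_floor_add_one (x ^ α)
  have h3 : (1 : ℝ) ≤ ⌊x ^ α⌋₊ := by exact_mod_cast (Nat.one_le_floor_iff _).2 h1
  linarith

theorem le_floor_rpow {α : ℝ} (hα : 1 ≤ α) (l : ℕ) : l ≤ ⌊(l : ℝ) ^ α⌋₊ := by
  rcases Nat.eq_zero_or_pos l with h | h
  · rw [h]; exact Nat.zero_le _
  · refine Nat.le_floor ?_
    exact Real.self_le_rpow_of_one_le (by exact_mod_cast h) hα

end Asymptotics

/-! ### Hölder regularity and the initial scale. -/

theorem exists_holder_scale {ρ κ : ℝ} {μ : Measure ℝ} (hκ : 0 < κ)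
    (h : ENNReal.ofReal κ < holderOrder ρ μ) :
    ∃ t₀ : ℝ, 0 < t₀ ∧ ∀ a b : ℝ, a < b → b - a ≤ t₀ →
      μ (Set.Icc a b) ≤ ENNReal.ofReal (κ⁻¹ * (b - a) ^ ρ) := by
  have h1 : holderInv ρ μ < (ENNReal.ofReal κ)⁻¹ := by
    rw [holderOrder] at h
    have := ENNReal.inv_lt_inv.2 h
    rwa [inv_inv] at this
  rw [holderInv] at h1
  simp only [iInf_lt_iff] at h1
  obtain ⟨t₀, ht₀, h2⟩ := h1
  refine ⟨t₀, ht₀, fun a b hab habt => ?_⟩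
  have hab0 : 0 < b - a := sub_pos.2 hab
  have habs : |a - b| = b - a := by rw [abs_sub_comm, abs_of_pos hab0]
  have h3 : ENNReal.ofReal (|a - b| ^ (-ρ)) * μ (Set.Icc a b) ≤ (ENNReal.ofReal κ)⁻¹ := by
    refine le_trans ?_ h2.le
    refine le_iSup_of_le a (le_iSup_of_le b (le_iSup_of_le ?_ le_rfl))
    rw [habs]
    exact ⟨hab0, habt⟩
  have hpos : 0 < (b - a) ^ ρ := Real.rpow_pos_of_pos hab0 ρ
  rw [habs, Real.rpow_neg hab0.le, ENNReal.ofReal_inv_of_pos hpos,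
    ← ENNReal.ofReal_inv_of_pos hκ] at h3
  have hne0 : ENNReal.ofReal ((b - a) ^ ρ) ≠ 0 := (ENNReal.ofReal_pos.2 hpos).ne'
  calc μ (Set.Icc a b) = ENNReal.ofReal ((b - a) ^ ρ) *
        ((ENNReal.ofReal ((b - a) ^ ρ))⁻¹ * μ (Set.Icc a b)) := by
        rw [← mul_assoc, ENNReal.mul_inv_cancel hne0 ENNReal.ofReal_ne_top, one_mul]
    _ ≤ ENNReal.ofReal ((b - a) ^ ρ) * ENNReal.ofReal κ⁻¹ := by gcongr
    _ = _ := by rw [← ENNReal.ofReal_mul hpos.le, mul_comm]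

/-- The half-width of the energy window in the initial step. -/
noncomputable def energyWindow (κ ρ p : ℝ) (d L : ℕ) : ℝ :=
  1 / 4 * (κ * ((3 : ℝ) ^ d)⁻¹ * (max 1 (L : ℝ)) ^ (-(d + 2 * p))) ^ (1 / ρ)

theorem energyWindow_pos {κ : ℝ} (hκ : 0 < κ) (ρ p : ℝ) (d L : ℕ) :
    0 < energyWindow κ ρ p d L := by
  have : (0 : ℝ) < max 1 (L : ℝ) := lt_max_of_lt_left one_pos
  unfold energyWindow
  positivity

theorem four_mul_energyWindow {κ : ℝ} (hκ : 0 < κ) (ρ p : ℝ) (d : ℕ) {L : ℕ} (hL : 1 ≤ L) :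
    4 * energyWindow κ ρ p d L =
      (κ * ((3 : ℝ) ^ d)⁻¹) ^ (1 / ρ) * (L : ℝ) ^ (-((d + 2 * p) / ρ)) := by
  have hL' : (1 : ℝ) ≤ L := by exact_mod_cast hL
  rw [energyWindow, max_eq_right hL', Real.mul_rpow (by positivity) (by positivity),
    ← Real.rpow_mul (by positivity)]
  ring_nf

/-- The interval [E₀ - 2η, E₀ + 2η] has length 4η. With this value the union bound over at most 3^d
L^d sites gives L^{-2p}. -/
theorem four_mul_energyWindow_rpow {κ ρ : ℝ} (hκ : 0 < κ) (hρ : 0 < ρ) (p : ℝ) (d : ℕ) {L : ℕ}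
    (hL : 1 ≤ L) : (4 * energyWindow κ ρ p d L) ^ ρ =
      κ * ((3 : ℝ) ^ d)⁻¹ * (L : ℝ) ^ (-(d + 2 * p)) := by
  have hL' : (1 : ℝ) ≤ L := by exact_mod_cast hL
  rw [energyWindow, max_eq_right hL', ← mul_assoc, mul_one_div_cancel (by norm_num), one_mul,
    ← Real.rpow_mul (by positivity), one_div_mul_cancel hρ.ne', Real.rpow_one]

section InitialScale

open Filter

variable {d : ℕ} {Ω : Type*} [MeasurableSpace Ω] {P : Measure Ω} {V : (Fin d → ℤ) → Ω → ℝ}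

theorem localBound_potential_near (hV : ∀ n, Measurable (V n)) {μ : Measure ℝ}
    (hlaw : ∀ n, P.map (V n) = μ) {κ ρ t₀ : ℝ}
    (hμ : ∀ a b : ℝ, a < b → b - a ≤ t₀ →
      μ (Set.Icc a b) ≤ ENNReal.ofReal (κ⁻¹ * (b - a) ^ ρ))
    {η : ℝ} (hη : 0 < η) (hη₀ : 4 * η ≤ t₀) (E₀ : ℝ) (L : ℕ) (m : Fin d → ℤ) :
    LocalBound V P (cube L m)
      {ω | ∃ j ∈ cube L m, V j ω ∈ Set.Icc (E₀ - 2 * η) (E₀ + 2 * η)}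
      (ENNReal.ofReal ((2 * L + 1) ^ d) * ENNReal.ofReal (κ⁻¹ * (4 * η) ^ ρ)) := by
  have h1 : ∀ j : cube L m, LocalBound V P (cube L m)
      (V j ⁻¹' Set.Icc (E₀ - 2 * η) (E₀ + 2 * η)) (ENNReal.ofReal (κ⁻¹ * (4 * η) ^ ρ)) := by
    intro j
    refine ⟨_, ?_, Set.Subset.rfl, ?_⟩
    · have h2 : MeasurableSpace.comap (V j) inferInstance ≤ coordAlgebra V (cube L m) :=
        le_iSup₂_of_le (j : Fin d → ℤ) j.2 le_rfl
      exact h2 _ ⟨_, measurableSet_Icc, rfl⟩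
    · rw [← Measure.map_apply (hV j) measurableSet_Icc, hlaw]
      have h3 : E₀ + 2 * η - (E₀ - 2 * η) = 4 * η := by ring
      have := hμ (E₀ - 2 * η) (E₀ + 2 * η) (by linarith) (by linarith)
      rwa [h3] at this
  refine (LocalBound.iUnion h1).mono Set.Subset.rfl ?_ ?_
  · rintro ω ⟨j, hj, hω⟩
    exact Set.mem_iUnion.2 ⟨⟨j, hj⟩, hω⟩
  · rw [Fintype.card_coe, natCast_card_cube]

/-- The size conditions of the initial step. -/
theorem eventually_initial {C C₀ κ ρ p s₀ τ τ' t₀ : ℝ} (hκ : 0 < κ) (hρ : 0 < ρ)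
    (hp : 0 < p) (hC₀ : 0 < C₀) (ht₀ : 0 < t₀) (hs₀ : (d : ℝ) / 2 < s₀)
    (hτ : (2 * p + (2 + ρ) * d) / ρ < τ) (hτ' : 2 * τ + s₀ < τ') :
    ∀ᶠ L : ℕ in atTop, 4 * energyWindow κ ρ p d L ≤ t₀ ∧
      Real.sqrt (C₀ * (4 * L + 1) ^ d) * (2 * (energyWindow κ ρ p d L)⁻¹) ≤ (L : ℝ) ^ τ' ∧
      (L : ℝ)⁻¹ * C ≤ 1 / 2 := by
  have hd : (0 : ℝ) ≤ d := Nat.cast_nonneg d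
  have h1 : 0 < (d + 2 * p) / ρ := by positivity
  have h2 : (d : ℝ) / 2 + (d + 2 * p) / ρ < τ' := by
    have h3 : (d + 2 * p) / ρ ≤ (2 * p + (2 + ρ) * d) / ρ := by
      refine div_le_div_of_nonneg_right ?_ hρ.le
      nlinarith
    linarith
  set D := (κ * ((3 : ℝ) ^ d)⁻¹) ^ (1 / ρ) with hD
  have hD0 : 0 < D := by positivity
  filter_upwards [tendsto_natCast_atTop_atTop.eventually
      (eventually_mul_rpow_le (C := D) (neg_lt_zero.2 h1) ht₀),
    tendsto_natCast_atTop_atTop.eventually (eventually_mul_rpow_le_rpow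
      (C := Real.sqrt (C₀ * 5 ^ d) * (8 * D⁻¹)) h2),
    tendsto_natCast_atTop_atTop.eventually
      (eventually_mul_rpow_le (C := C) (by norm_num : (-1 : ℝ) < 0)
        (by norm_num : (0 : ℝ) < 1 / 2)), eventually_ge_atTop 1] with L hL1 hL2 hL3 hL
  have hL' : (1 : ℝ) ≤ L := by exact_mod_cast hL
  have hL0 : (0 : ℝ) < L := by linarith
  have h4 := four_mul_energyWindow hκ ρ p d hL
  refine ⟨by rw [h4]; exact hL1, ?_, ?_⟩
  · have h5 : 2 * (energyWindow κ ρ p d L)⁻¹ = 8 * D⁻¹ * (L : ℝ) ^ ((d + 2 * p) / ρ) := by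
      have h6 : energyWindow κ ρ p d L = D * (L : ℝ) ^ (-((d + 2 * p) / ρ)) / 4 := by
        rw [← h4]; ring
      rw [h6, Real.rpow_neg hL0.le]
      field_simp
      norm_num
    have h6 := sqrt_mul_pow_le (A := C₀) hC₀.le (by norm_num : (0 : ℝ) ≤ 5) hL0.le
      (by linarith : (0 : ℝ) ≤ 4 * L + 1) (by linarith) d
    rw [h5]
    calc _ ≤ Real.sqrt (C₀ * 5 ^ d) * (L : ℝ) ^ ((d : ℝ) / 2) *
          (8 * D⁻¹ * (L : ℝ) ^ ((d + 2 * p) / ρ)) := by gcongr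
      _ = Real.sqrt (C₀ * 5 ^ d) * (8 * D⁻¹) *
          ((L : ℝ) ^ ((d : ℝ) / 2) * (L : ℝ) ^ ((d + 2 * p) / ρ)) := by ring
      _ ≤ _ := by rw [← Real.rpow_add hL0]; exact hL2
  · rw [← Real.rpow_neg_one, mul_comm]
    exact hL3

end InitialScale

/-! ### The multi-scale induction. -/

theorem le_scale {α : ℝ} (hα : 1 ≤ α) (L₀ k : ℕ) : L₀ ≤ scale α L₀ k := by
  induction k with
  | zero => exact le_rfl
  | succ k ih => exact ih.trans (le_floor_rpow hα _)

end LongRangeMSA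

open LongRangeMSA in
theorem mainTheorem3 (d : ℕ) (hd : 1 ≤ d) (ρ κ p : ℝ) (hκ : 0 < κ) :
    -- `η` depends only on `L₀, κ, ρ, p, d`
    ∃ η : ℕ → ℝ, (∀ L₀, 0 < η L₀) ∧
    ∀ (s₀ C₀ : ℝ), (d : ℝ) / 2 < s₀ → 0 < C₀ →
    -- `lam₀` depends only on `L₀, κ, ρ, p, d, s₀` and the normalisation `C₀` of the norms
    ∃ lam₀ : ℕ → ℝ, (∀ L₀, 0 < lam₀ L₀) ∧
    ∀ (μ : Measure ℝ) [IsProbabilityMeasure μ] (M r r₁ α τ τ' ξ δ : ℝ) (J : ℕ),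
      IsHolder ρ μ → ENNReal.ofReal κ < holderOrder ρ μ →
      μ.support.Nontrivial → 0 < M → μ.support ⊆ Set.Icc (-M) M →
      (d : ℝ) < r → s₀ ≤ r₁ → r₁ < r - d / 2 →
      1 < α → 1 < τ → 1 < τ' → 1 < r₁ → 0 < ξ → 0 < δ → δ < 1 →
      ParamIneq α τ τ' ξ δ r₁ s₀ →
      (2 * p + (2 + ρ) * d) / ρ < τ →
      (1 + ξ) / α ≤ δ →
      0 < J → Even J → α * d + 2 * α * p / J < p →
      -- the threshold does not depend on `E₀`, `λ` or the probability space
      ∃ Lmin : ℕ, 0 < Lmin ∧ ∀ L₀ : ℕ, Lmin ≤ L₀ →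
      ∀ E₀ : ℝ, |E₀| ≤ 2 * (hopNorm d r + M) →
      ∀ (Ω : Type*) [MeasurableSpace Ω] (P : Measure Ω) [IsProbabilityMeasure P]
        (V : (Fin d → ℤ) → Ω → ℝ),
        (∀ n, Measurable (V n)) → (∀ n, P.map (V n) = μ) → iIndepFun V P →
      ∀ lam : ℝ, 1 ≤ lam → lam₀ L₀ ≤ lam →
      ∀ (k : ℕ) (m n : Fin d → ℤ), 2 * (scale α L₀ k : ℝ) < ‖m - n‖ →
        P {ω | ∃ E ∈ Set.Icc (E₀ - η L₀) (E₀ + η L₀),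
            IsBad C₀ s₀ r₁ τ' r lam (fun j => V j ω) E δ (scale α L₀ k) m ∧
            IsBad C₀ s₀ r₁ τ' r lam (fun j => V j ω) E δ (scale α L₀ k) n}
          ≤ ENNReal.ofReal ((scale α L₀ k : ℝ) ^ (-(2 * p))) := by
  -- The constants in the strong-disorder criterion depend on r and r₁, which λ₀ may not. The factor
  -- L₀ in λ₀ = L₀/η gives (λη)^{-1} ≤ 1/L₀, which beats them above the threshold; `max 1` only
  -- secures positivity at L₀ = 0.
  refine ⟨energyWindow κ ρ p d, energyWindow_pos hκ ρ p d, fun s₀ C₀ hs₀ hC₀ =>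
    ⟨fun L₀ => max 1 (L₀ : ℝ) / energyWindow κ ρ p d L₀, fun L₀ =>
      div_pos (lt_max_of_lt_left one_pos) (energyWindow_pos hκ ρ p d L₀), ?_⟩⟩
  intro μ _ M r r₁ α τ τ' ξ δ J hHolder hκμ _ _ _ hdr hs₀r₁ hr₁r hα hτ1 hτ'1 _ hξ hδ hδ1 hpar hτ
    hαδ hJ hJe hpJ
  obtain ⟨hpar1, hpar2, hpar3⟩ := hpar
  have hρ := hHolder.1
  have hd0 : (0 : ℝ) < d := by exact_mod_cast hd
  have hs₀0 : 0 < s₀ := by linarith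
  rcases le_or_gt p 0 with hp | hp
  -- For p ≤ 0 the claimed bound is at least 1.
  · refine ⟨1, one_pos, fun L₀ hL₀ E₀ _ Ω _ P _ V _ _ _ lam _ _ k m n _ => ?_⟩
    have h1 : (1 : ℝ) ≤ scale α L₀ k := by exact_mod_cast hL₀.trans (le_scale hα.le L₀ k)
    refine prob_le_one.trans (ENNReal.one_le_ofReal.2 (Real.one_le_rpow h1 (by linarith)))
  obtain ⟨h, rfl⟩ : ∃ h, J = 2 * h := by
    obtain ⟨h, rfl⟩ := hJe
    exact ⟨h, (two_mul h).symm⟩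
  obtain ⟨t₀, ht₀, hμ⟩ := exists_holder_scale hκ hκμ
  have hα0 : 0 < α := by linarith
  have hδs : 0 < δ * s₀ := by positivity
  have hr₁s : 2 * s₀ < r₁ := by nlinarith
  have hτs : 2 * τ + s₀ < τ' := by
    have h1 := mul_lt_mul_of_pos_left hpar3 hα0
    rw [mul_add, mul_inv_cancel_left₀ hα0.ne'] at h1
    have h2 : 0 < ξ * s₀ := by positivity
    have h3 : α * (2 * τ + s₀) < α * τ' := by nlinarith
    exact lt_of_mul_lt_mul_left h3 hα0.le
  -- The summability exponent must exceed d, be at most r₁, and satisfy q + b ≤ r for q = r₁ - s₀.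
  -- Both entries exceed d, by s₀ > d/2 and r₁ < r - d/2.
  set b := min (2 * s₀) (r - r₁ + s₀) with hb_def
  have hb : (d : ℝ) < b := lt_min (by linarith) (by linarith)
  have hb1 : b ≤ 2 * s₀ := min_le_left _ _
  have hb2 : b ≤ r - r₁ + s₀ := min_le_right _ _
  have hS := japaneseSum_pos hb
  have hh : 0 < h := by omega
  have ev := (tendsto_natCast_atTop_atTop (R := ℝ)).eventually
    ((eventually_row_small (C := (2 ^ (r₁ + 2 * (r₁ - s₀)) + 2 ^ (r + r₁ + 1)) * japaneseSum d b)
      (C₀ := C₀) (q := r₁ - s₀) (a := τ' + δ * (r₁ - s₀)) (d := d) (by positivity) hC₀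
      (by nlinarith)).and
    ((eventually_cutoff_small (C := 2 ^ r₁) (C' := (2 + 2 ^ (r₁ + 1)) * japaneseSum d b)
      (J := (2 * h : ℕ)) (a := α * τ) (ξ := ξ) (q := r₁ - s₀) (d := d) (by positivity)
      (by positivity) (by positivity) hξ.le (by nlinarith)).and
    ((eventually_sobolev_bound (c₁ := 2 ^ (r₁ - s₀)) (c₂ := (12 * (2 * h : ℕ) + 4) ^ r₁)
      (r₁ := r₁) (d := d) hC₀ (by positivity) (by positivity) hs₀ hα (by linarith) (by linarith)
      hξ hδ hδ1 hpar3 hαδ).and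
    ((eventually_wegner_small hκ hρ hp hτ ht₀).and
    ((eventually_crowded_small hp hh hpJ).and
      (eventually_mul_rpow_le_rpow (C := 4) hξ))))))
  obtain ⟨N₀, hN₀⟩ := Filter.eventually_atTop.1 (ev.and (eventually_initial
    (C := 2 ^ (r₁ + 1) * japaneseSum d b) hκ hρ hp hC₀ ht₀ hs₀ hτ hτs))
  refine ⟨max N₀ 1, lt_max_of_lt_right one_pos, fun L₀ hL₀ E₀ _ Ω _ P _ V hV hlaw hind lam hlam1
    hlam k => ?_⟩
  beta_reduce at hlam
  have hN₀L : N₀ ≤ L₀ := (le_max_left _ _).trans hL₀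
  have h1L : 1 ≤ L₀ := (le_max_right _ _).trans hL₀
  have hη := energyWindow_pos hκ ρ p d L₀
  set η := energyWindow κ ρ p d L₀ with hη_def
  suffices hmain : ∀ m n : Fin d → ℤ, 2 * (scale α L₀ k : ℝ) < ‖m - n‖ →
      LocalBound V P (cube (scale α L₀ k) m ∪ cube (scale α L₀ k) n)
        {ω | ∃ E ∈ Set.Icc (E₀ - η) (E₀ + η),
          IsBad C₀ s₀ r₁ τ' r lam (fun j => V j ω) E δ (scale α L₀ k) m ∧
          IsBad C₀ s₀ r₁ τ' r lam (fun j => V j ω) E δ (scale α L₀ k) n}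
        (ENNReal.ofReal ((scale α L₀ k : ℝ) ^ (-(2 * p)))) from
    fun m n hmn => (hmain m n hmn).measure_le
  induction k with
  | zero =>
    intro m n _
    have hL0 : (1 : ℝ) ≤ L₀ := by exact_mod_cast h1L
    have hLpos : (0 : ℝ) < L₀ := by linarith
    obtain ⟨-, hI1, hI2, hI3⟩ := hN₀ L₀ hN₀L
    -- One of the two cubes already gives the full bound at the initial scale.
    refine (localBound_potential_near hV hlaw hμ hη hI1 E₀ L₀ m).mono
      Set.subset_union_left ?_ ?_
    · rintro ω ⟨E, hE, hbad, -⟩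
      by_contra hcon
      refine hbad (isGood_of_potential_far (b := b) (η := η) hC₀ hs₀0.le hb (by linarith)
        (by linarith) (by linarith) hη (fun j hj => ?_) ?_ (fun s hs => ?_))
      · have h1 : ¬ (V j ω ∈ Set.Icc (E₀ - 2 * η) (E₀ + 2 * η)) := fun h => hcon ⟨j, hj, h⟩
        rw [Set.mem_Icc, not_and_or, not_le, not_le] at h1
        rw [le_abs]
        rcases h1 with h1 | h1
        · exact Or.inr (by linarith [hE.1])
        · exact Or.inl (by linarith [hE.2])
      · have h1 : lam⁻¹ * η⁻¹ ≤ (L₀ : ℝ)⁻¹ := by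
          rw [max_eq_right hL0, div_le_iff₀ hη] at hlam
          rw [← mul_inv]
          exact inv_anti₀ hLpos hlam
        exact (mul_le_mul_of_nonneg_right h1 (by positivity)).trans hI3
      · refine hI2.trans (Real.rpow_le_rpow_of_exponent_le hL0 ?_)
        have : 0 ≤ δ * s := mul_nonneg hδ.le (hs₀0.le.trans hs.1)
        linarith
    · rw [← ENNReal.ofReal_mul (by positivity), four_mul_energyWindow_rpow hκ hρ p d h1L]
      refine ENNReal.ofReal_le_ofReal ?_
      calc _ ≤ (3 ^ d * (L₀ : ℝ) ^ (d : ℝ)) *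
            (κ⁻¹ * (κ * ((3 : ℝ) ^ d)⁻¹ * (L₀ : ℝ) ^ (-(d + 2 * p)))) := by
            gcongr
            exact cast_volume_le hL0 d
        _ = (L₀ : ℝ) ^ (d : ℝ) * (L₀ : ℝ) ^ (-(d + 2 * p)) := by field_simp
        _ = (L₀ : ℝ) ^ (-(2 * p)) := by
            rw [← Real.rpow_add hLpos]; ring_nf
        _ ≤ _ := le_rfl
  | succ k ih =>
    intro m n hmn
    set l := scale α L₀ k with hl_def
    have hL_def : scale α L₀ (k + 1) = ⌊(l : ℝ) ^ α⌋₊ := rfl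
    set L := scale α L₀ (k + 1) with hL_def'
    have hlL : l ≤ L := le_floor_rpow hα.le l
    have hL₀l : L₀ ≤ l := le_scale hα.le L₀ k
    have hl1 : 1 ≤ l := h1L.trans hL₀l
    have hl1' : (1 : ℝ) ≤ l := by exact_mod_cast hl1
    have hl0 : (0 : ℝ) < l := by linarith
    have hL1' : (1 : ℝ) ≤ L := by exact_mod_cast hl1.trans hlL
    have hLpos : (0 : ℝ) < L := by linarith
    have hLle : (L : ℝ) ≤ (l : ℝ) ^ α := by rw [hL_def]; exact Nat.floor_le (by positivity)
    have hLge : (l : ℝ) ^ α / 2 ≤ L := by rw [hL_def]; exact half_rpow_le_floor hα0.le hl1'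
    obtain ⟨⟨c1, c2, c3, -, c5, c6⟩, -⟩ := hN₀ l (hN₀L.trans hL₀l)
    -- The Wegner estimate is needed at the new scale; the other conditions are taken at the old
    -- one. The scales never drop below L₀, so one threshold serves all.
    obtain ⟨⟨-, -, -, c4, -, -⟩, -⟩ := hN₀ L (hN₀L.trans (hL₀l.trans hlL))
    rw [Real.rpow_zero, mul_one] at c6
    have hε : (0 : ℝ) < (L : ℝ) ^ (-τ) := by positivity
    refine (localBound_step (r := r) (lam := lam) (E₀ := E₀) (η := η) (l := l) (L := L) (h := h)
      hV hind hlaw hμ hε c4.1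
      (bad := fun v E c => IsBad C₀ s₀ r₁ τ' r lam v E δ l c)
      (bad' := fun v E c => IsBad C₀ s₀ r₁ τ' r lam v E δ L c)
      (fun v E z hz hsp => ?_) ih hmn).mono Set.Subset.rfl Set.Subset.rfl ?_
    · obtain ⟨hu, hG⟩ := isUnit_of_not_nearKernel hε hz
      have hQ : ∀ x ∈ cube L z, ∀ y ∈ cube L z,
          |green (kern r lam v E) (cube L z) x y| ≤ (l : ℝ) ^ (α * τ) := by
        intro x hx y hy
        rw [green_of_mem hx hy]
        refine (hG _ _).trans ?_
        -- Non-resonance at ε = L^{-τ} gives the a priori bound L^τ ≤ l^{ατ}.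
        rw [Real.rpow_neg hLpos.le, inv_inv, Real.rpow_mul hl0.le]
        exact Real.rpow_le_rpow hLpos.le hLle (by linarith)
      refine not_not.2 (isGood_of_sparse (b := b) (Y := (l : ℝ) ^ ξ) (J := 2 * h) hC₀ hs₀0.le hb
        (by linarith) (by linarith) (by linarith) (by linarith) hlam1 hl1 hlL c6 hu hQ hsp c1 c2
        (c3 L hLge hLle))
    · have hl2 : (0 : ℝ) ≤ (l : ℝ) ^ (-(2 * p)) := by positivity
      have hN : (0 : ℝ) ≤ (2 * L + 1) ^ d := by positivity
      have hW : 0 ≤ κ⁻¹ * (8 * (L : ℝ) ^ (-τ) * (2 * L + 1) ^ d) ^ ρ := by positivity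
      rw [← ENNReal.ofReal_pow hN, ← ENNReal.ofReal_pow hl2,
        ← ENNReal.ofReal_mul (by positivity), ← ENNReal.ofReal_mul hN, ← ENNReal.ofReal_mul hN,
        ← ENNReal.ofReal_ofNat 2, ← ENNReal.ofReal_mul (by norm_num),
        ← ENNReal.ofReal_add (by positivity) (by positivity)]
      refine ENNReal.ofReal_le_ofReal ?_
      linarith [c5 L hL1' hLle, c4.2]
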